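/- **Theorem 3.1.** A set $S\subseteq 2^\omega$ is a *Scott set* if it is a nonempty Turing ideal (if $x,y\in S$ and $z\le_T x\oplus y$, then $z\in S$) and every infinite tree $T\subseteq 2^{<\omega}$ that is computable in some element of $S$ has an infinite path $f\in S$. *Presburger arithmetic* $\mathrm{Pr}$ is the complete first-order theory of $(\mathbb Z,+,<)$. Fix a standard Gödel coding of the formulas of its language, and call a complete type over $\emptyset$ computable in $x\in 2^\omega$ if the set of Gödel codes of its formulas is computable in $x$. For $S\subseteq 2^\omega$, a model $M\models \mathrm{Pr}$ is *$S$-saturated* if 1. every complete type $p\in S_n(\emptyset)$ of $\mathrm{Pr}$ ($n\in\mathbb N$) that is realized in $M$ is computable in some element of $S$; and 2. whenever $n\in\mathbb N$, $p(x,\overline y)\in S_{n+1}(\emptyset)$ is computable in some element of $S$, $\overline a\in M^n$, and $p(x,\overline a)$ is finitely satisfiable in $M$, the type $p(x,\overline a)$ is realized in $M$. Then for every Scott set $S$ there is an $S$-saturated model of Presburger arithmetic. -/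

import Mathlib

/-! ### Turing reducibility, Turing ideals and Scott sets on Cantor space -/

/-- A point of Cantor space `2^ω`, seen as a `{0,1}`-valued total function on `ℕ`. -/
def cantorFun (x : ℕ → Bool) : ℕ →. ℕ := fun n => Part.some (x n).toNat

/-- `x ≤_T y` for points of Cantor space. -/
def CantorTuringLE (x y : ℕ → Bool) : Prop := TuringReducible (cantorFun x) (cantorFun y)

/-- The disjoint union `x ⊕ y`: `x` on the even numbers, `y` on the odd numbers. -/
def cantorJoin (x y : ℕ → Bool) : ℕ → Bool :=
  fun n => if n % 2 = 0 then x (n / 2) else y (n / 2)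

open Classical in
/-- The characteristic function of a set of natural numbers. -/
noncomputable def charFun (A : Set ℕ) : ℕ → Bool := fun n => decide (n ∈ A)

/-- The set `A ⊆ ℕ` is computable in `x`. -/
def SetComputableIn (A : Set ℕ) (x : ℕ → Bool) : Prop := CantorTuringLE (charFun A) x

/-- A (nonempty) Turing ideal. -/
structure IsTuringIdeal (S : Set (ℕ → Bool)) : Prop where
  nonempty : S.Nonempty
  mem_of_le_join : ∀ x ∈ S, ∀ y ∈ S, ∀ z, CantorTuringLE z (cantorJoin x y) → z ∈ S

/-- A tree `T ⊆ 2^{<ω}`: a set of finite binary strings closed under initial segments. -/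
def IsBinaryTree (T : Set (List Bool)) : Prop := ∀ σ ∈ T, ∀ τ, τ <+: σ → τ ∈ T

/-- The tree `T` is computable in `x`, finite binary strings being coded by natural numbers. -/
def TreeComputableIn (T : Set (List Bool)) (x : ℕ → Bool) : Prop :=
  SetComputableIn ((fun σ : List Bool => Encodable.encode σ) '' T) x

/-- `f` is an infinite path through `T`: all its finite initial segments are in `T`. -/
def IsPathThrough (f : ℕ → Bool) (T : Set (List Bool)) : Prop :=
  ∀ n : ℕ, (List.range n).map f ∈ T

/-- Scott sets. -/
structure IsScottSet (S : Set (ℕ → Bool)) : Prop where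
  ideal : IsTuringIdeal S
  exists_path : ∀ T : Set (List Bool), IsBinaryTree T → T.Infinite →
    (∃ x ∈ S, TreeComputableIn T x) → ∃ f ∈ S, IsPathThrough f T

/-! ### Presburger arithmetic as the complete theory of `(ℤ, +, <)` -/

/-- The function symbols: one binary symbol `+`. -/
inductive PrFunc : ℕ → Type
  | add : PrFunc 2

/-- The relation symbols: one binary symbol `<`. -/
inductive PrRel : ℕ → Type
  | lt : PrRel 2

/-- The language `{+, <}`. -/
abbrev prLanguage : FirstOrder.Language.{0, 0} := ⟨PrFunc, PrRel⟩

/-- The standard structure `(ℤ, +, <)`. -/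
instance prStructureInt : prLanguage.Structure ℤ where
  funMap | PrFunc.add, v => v 0 + v 1
  RelMap | PrRel.lt, v => v 0 < v 1

/-- Presburger arithmetic: `Th(ℤ, +, <)`. -/
def Pr : prLanguage.Theory := prLanguage.completeTheory ℤ

/-! ### Gödel coding of formulas -/

/-- Gödel codes of terms; free variables are coded by even numbers and bound ones by odd numbers. -/
def prTermCode {n k : ℕ} : prLanguage.Term (Fin n ⊕ Fin k) → ℕ
  | .var (Sum.inl i) => Nat.pair 0 (2 * (i : ℕ))
  | .var (Sum.inr j) => Nat.pair 0 (2 * (j : ℕ) + 1)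
  | .func PrFunc.add ts => Nat.pair 1 (Nat.pair (prTermCode (ts 0)) (prTermCode (ts 1)))

/-- Gödel codes of formulas with free variables indexed by `Fin n` and `k` bound variables. -/
def prFormulaCode {n : ℕ} : {k : ℕ} → prLanguage.BoundedFormula (Fin n) k → ℕ
  | _, .falsum => Nat.pair 0 0
  | _, .equal t₁ t₂ => Nat.pair 1 (Nat.pair (prTermCode t₁) (prTermCode t₂))
  | _, .rel PrRel.lt ts => Nat.pair 2 (Nat.pair (prTermCode (ts 0)) (prTermCode (ts 1)))
  | _, .imp φ ψ => Nat.pair 3 (Nat.pair (prFormulaCode φ) (prFormulaCode ψ))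
  | _, .all φ => Nat.pair 4 (prFormulaCode φ)

/-! ### Types and `S`-saturation -/

/-- The formula `φ` in the variables indexed by `Fin n` belongs to the complete `n`-type `p`. -/
def TypeContains {n : ℕ} (p : Pr.CompleteType (Fin n)) (φ : prLanguage.Formula (Fin n)) : Prop :=
  FirstOrder.Language.Formula.equivSentence φ ∈ p

/-- The set of Gödel codes of the formulas in a complete type over `∅`. -/
def typeCodes {n : ℕ} (p : Pr.CompleteType (Fin n)) : Set ℕ :=
  {m | ∃ φ : prLanguage.Formula (Fin n), TypeContains p φ ∧ prFormulaCode φ = m}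

/-- The complete type `p` is computable in some element of `S`. -/
def TypeComputableIn (S : Set (ℕ → Bool)) {n : ℕ} (p : Pr.CompleteType (Fin n)) : Prop :=
  ∃ x ∈ S, SetComputableIn (typeCodes p) x

/-- `p(x, a)` is finitely satisfiable in `M`; the variable `x` has index `0`. -/
def FinitelySatisfiableAt (M : Pr.ModelType.{0, 0, 0}) {n : ℕ} (p : Pr.CompleteType (Fin (n + 1)))
    (a : Fin n → M) : Prop :=
  ∀ Δ : Set (prLanguage.Formula (Fin (n + 1))), Δ.Finite → (∀ φ ∈ Δ, TypeContains p φ) →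
    ∃ b : M, ∀ φ ∈ Δ, φ.Realize (Fin.cons b a : Fin (n + 1) → M)

/-- `p(x, a)` is realized in `M`. -/
def RealizedAt (M : Pr.ModelType.{0, 0, 0}) {n : ℕ} (p : Pr.CompleteType (Fin (n + 1)))
    (a : Fin n → M) : Prop :=
  ∃ b : M, ∀ φ : prLanguage.Formula (Fin (n + 1)), TypeContains p φ →
    φ.Realize (Fin.cons b a : Fin (n + 1) → M)

/-- `S`-saturated models of Presburger arithmetic. -/
structure IsSSaturated (S : Set (ℕ → Bool)) (M : Pr.ModelType.{0, 0, 0}) : Prop where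
  realized_computable : ∀ (n : ℕ) (p : Pr.CompleteType (Fin n)),
    p ∈ Pr.realizedTypes M (Fin n) → TypeComputableIn S p
  realizes : ∀ (n : ℕ) (p : Pr.CompleteType (Fin (n + 1))), TypeComputableIn S p →
    ∀ a : Fin n → M, FinitelySatisfiableAt M p a → RealizedAt M p a

/-! The model is an explicit ordered group. Over a dense linear order of indices without endpoints,
enlarged by a greatest index `⊤`, take the finitely supported real functions in the lexicographic
order: smaller indices carry larger magnitudes, and `⊤` carries the standard part. Coefficients are
restricted to the rational vector space of reals that can be approximated computably in a member of
`S`. Divisibility is governed separately. Each index has a color, a rational sequence that converges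
profinitely up to a denominator, computably in a member of `S`. A `ℚ`-linear retraction `π` of `ℝ`
onto `ℚ` attaches to `h` the residue sequence `∑ π(h_γ) color(γ)`. The group `idealModel` consists
of those `h` whose coefficient at `⊤` is rational and whose residue sequence is eventually integral.
Subtracting a suitable integer from `h` makes the sequence eventually divisible by `N`, so this is a
Z-group (`isDiscreteZGroup_idealModel`).

All Z-groups have the theory of `ℤ`, by a back-and-forth argument of finite precision: tuples that
agree on the signs of linear forms of height at most `K` and on residues modulo `K!` can be extended
at a controlled loss of precision (`ZApprox.exists_extension`), and so agree on formulas of bounded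
code (`ZApprox.realize_iff`). Over `ℤ` the same step bounds the range of a quantifier, which yields
the decision procedure `formulaEval`.

Types realized in the model are computable in `S`. Whether an integral combination of fixed reals
vanishes is decided by coordinates in a finite rational basis, and the sign of a nonzero combination
is found by searching through approximations. The signs of linear forms in a tuple and its residues
are therefore computable, so one can search for an integer tuple that is close enough for a given
formula and evaluate the formula there (`IsComputableTuple.idealComputable_codes`).

Conversely, a finitely satisfiable type over `a` is a limit of types of elements `β K`; it
prescribes residues and a cut in the rational span `W` of `a` and the unit. If the cut sits at an
element of `W`, then `β` is eventually constant. Otherwise `LexSpace.exists_cutRealized` realizes it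
by `w + ρ t^γ` with `w ∈ W`. Either the magnitude already occurs in `W`, and then `ρ` is
approximated by comparing rational multiples of an element of `W` with the cut, a comparison that
the type decides; or the magnitude is new, density supplies `γ`, and `ρ = ±1`. Finally a term `t^γ'`
with `γ' > γ` is added whose color is the discrepancy between the prescribed and the present
residues; it is too small to disturb the cut, and every admissible color occurs at arbitrarily late
indices (`exists_color_eq`). Cut and residues determine the type, by `eventually_realize_cons_iff`.
-/

open Encodable

/-! ### Functions computable in a member of a Turing ideal -/

/-- The total function `f : ℕ → ℕ` is computable in some element of `S`. -/
def NatIdealComputable (S : Set (ℕ → Bool)) (f : ℕ → ℕ) : Prop :=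
  ∃ x ∈ S, Nat.RecursiveIn {cantorFun x} (fun n => Part.some (f n))

/-- The function `f` between coded types is computable in some element of `S`. -/
def IdealComputable (S : Set (ℕ → Bool)) {α σ : Type*} [Primcodable α] [Primcodable σ]
    (f : α → σ) : Prop :=
  NatIdealComputable S (fun n => encode ((decode (α := α) n).map f))

namespace NatIdealComputable

variable {S : Set (ℕ → Bool)}

theorem of_computable (hS : IsTuringIdeal S) {f : ℕ → ℕ} (hf : Computable f) :
    NatIdealComputable S f := by
  obtain ⟨x, hx⟩ := hS.nonempty
  exact ⟨x, hx, RecursiveIn.iff_nat.1 hf.partrec.recursiveIn⟩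

theorem mem_join_left (x y : ℕ → Bool) :
    Nat.RecursiveIn {cantorFun (cantorJoin x y)} (cantorFun x) := by
  have h : Nat.RecursiveIn {cantorFun (cantorJoin x y)} (fun n => Part.some (2 * n)) :=
    Nat.Primrec.recursiveIn (Primrec.nat_iff.1
      (Primrec.nat_mul.comp (Primrec.const 2) Primrec.id))
  refine (Nat.RecursiveIn.comp (.oracle _ (Set.mem_singleton _)) h).of_eq fun n => ?_
  refine (Part.bind_some _ _).trans ?_
  simp [cantorFun, cantorJoin]

theorem mem_join_right (x y : ℕ → Bool) :
    Nat.RecursiveIn {cantorFun (cantorJoin x y)} (cantorFun y) := by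
  have h : Nat.RecursiveIn {cantorFun (cantorJoin x y)} (fun n => Part.some (2 * n + 1)) :=
    Nat.Primrec.recursiveIn (Primrec.nat_iff.1
      (Primrec.succ.comp (Primrec.nat_mul.comp (Primrec.const 2) Primrec.id)))
  refine (Nat.RecursiveIn.comp (.oracle _ (Set.mem_singleton _)) h).of_eq fun n => ?_
  have : (2 * n + 1) / 2 = n := by omega
  refine (Part.bind_some _ _).trans ?_
  simp [cantorFun, cantorJoin, this]

/-- Two functions computable in members of a Turing ideal are computable in a common member. -/
theorem common (hS : IsTuringIdeal S) {f g : ℕ → ℕ} (hf : NatIdealComputable S f)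
    (hg : NatIdealComputable S g) : ∃ x ∈ S,
      Nat.RecursiveIn {cantorFun x} (fun n => Part.some (f n)) ∧
      Nat.RecursiveIn {cantorFun x} (fun n => Part.some (g n)) := by
  obtain ⟨x, hx, hf⟩ := hf
  obtain ⟨y, hy, hg⟩ := hg
  refine ⟨cantorJoin x y, hS.mem_of_le_join x hx y hy _ TuringReducible.rfl,
    hf.subst ?_, hg.subst ?_⟩
  · rintro _ rfl; exact mem_join_left x y
  · rintro _ rfl; exact mem_join_right x y

theorem comp (hS : IsTuringIdeal S) {f g : ℕ → ℕ} (hf : NatIdealComputable S f)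
    (hg : NatIdealComputable S g) : NatIdealComputable S (fun n => f (g n)) := by
  obtain ⟨x, hx, hf, hg⟩ := common hS hf hg
  exact ⟨x, hx, (hf.comp hg).of_eq fun n => by simp⟩

theorem pair (hS : IsTuringIdeal S) {f g : ℕ → ℕ} (hf : NatIdealComputable S f)
    (hg : NatIdealComputable S g) : NatIdealComputable S (fun n => Nat.pair (f n) (g n)) := by
  obtain ⟨x, hx, hf, hg⟩ := common hS hf hg
  exact ⟨x, hx, (hf.pair hg).of_eq fun n => by simp [Seq.seq]⟩

/-- The search halts on every input, so minimization relative to the same oracle yields a total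
function. -/
theorem find {p : ℕ → ℕ} (hp : NatIdealComputable S p)
    (h : ∀ a, ∃ n, p (Nat.pair a n) = 0) : NatIdealComputable S (fun a => Nat.find (h a)) := by
  obtain ⟨x, hx, hp⟩ := hp
  refine ⟨x, hx, hp.rfind.of_eq fun a => ?_⟩
  rw [Part.eq_some_iff]
  refine Nat.mem_rfind.2 ⟨?_, fun {m} hm => ?_⟩
  · simpa using Nat.find_spec (h a)
  · simpa using Nat.find_min (h a) hm

theorem comp₂ (hS : IsTuringIdeal S) {f : ℕ → ℕ → ℕ} (hf : Computable₂ f) {g h : ℕ → ℕ}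
    (hg : NatIdealComputable S g) (hh : NatIdealComputable S h) :
    NatIdealComputable S (fun n => f (g n) (h n)) := by
  have := (of_computable hS (f := fun m => f m.unpair.1 m.unpair.2)
    (hf.comp (Computable.fst.comp Computable.unpair) (Computable.snd.comp Computable.unpair))).comp
    hS (hg.pair hS hh)
  simpa using this

end NatIdealComputable

namespace IdealComputable

variable {S : Set (ℕ → Bool)} {α β γ σ : Type*} [Primcodable α] [Primcodable β] [Primcodable γ]
  [Primcodable σ]

theorem of_computable (hS : IsTuringIdeal S) {f : α → σ} (hf : Computable f) :
    IdealComputable S f :=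
  NatIdealComputable.of_computable hS
    (Computable.encode.comp (Computable.option_map Computable.decode (hf.comp Computable.snd)))

theorem of_primrec (hS : IsTuringIdeal S) {f : α → σ} (hf : Primrec f) : IdealComputable S f :=
  of_computable hS hf.to_comp

theorem comp (hS : IsTuringIdeal S) {f : β → σ} {g : α → β} (hf : IdealComputable S f)
    (hg : IdealComputable S g) : IdealComputable S (fun a => f (g a)) := by
  -- The code of `some b` is one more than the code of `b`, so the output of `g` is shifted down
  -- before `f` reads it; the test against `0` below takes care of numbers that code nothing.
  have h1 := NatIdealComputable.comp hS hf (NatIdealComputable.comp hS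
    (NatIdealComputable.of_computable hS Computable.pred) hg)
  have h2 : Computable₂ fun m k : ℕ => if m = 0 then 0 else k :=
    (Primrec.ite (Primrec.eq.comp Primrec.fst (Primrec.const 0)) (Primrec.const 0)
      Primrec.snd).to_comp
  have h3 := NatIdealComputable.comp₂ hS h2 hg h1
  unfold IdealComputable
  convert h3 using 2 with n
  cases h : decode (α := α) n <;> simp

theorem pair (hS : IsTuringIdeal S) {f : α → β} {g : α → γ} (hf : IdealComputable S f)
    (hg : IdealComputable S g) : IdealComputable S (fun a => (f a, g a)) := by
  have h2 : Computable₂ fun m k : ℕ => if m = 0 then 0 else Nat.pair (m - 1) (k - 1) + 1 :=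
    (Primrec.ite (Primrec.eq.comp Primrec.fst (Primrec.const 0)) (Primrec.const 0)
      (Primrec.succ.comp (Primrec₂.natPair.comp (Primrec.pred.comp Primrec.fst)
        (Primrec.pred.comp Primrec.snd)))).to_comp
  have h3 := NatIdealComputable.comp₂ hS h2 hf hg
  unfold IdealComputable
  convert h3 using 2 with n
  cases h : decode (α := α) n <;> simp

theorem comp₂ (hS : IsTuringIdeal S) {f : β → γ → σ} (hf : Primrec₂ f) {g : α → β} {h : α → γ}
    (hg : IdealComputable S g) (hh : IdealComputable S h) :
    IdealComputable S (fun a => f (g a) (h a)) :=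
  (of_primrec hS hf).comp hS (hg.pair hS hh)

theorem find (hS : IsTuringIdeal S) {p : α → ℕ → Bool}
    (hp : IdealComputable S (fun q : α × ℕ => p q.1 q.2))
    (h : ∀ a, ∃ n, p a n = true) : IdealComputable S (fun a => Nat.find (h a)) := by
  -- Among the codes `0`, `1`, `2` of `none`, `some false`, `some true` only `1` counts as failure,
  -- so the search also stops on numbers that code no element of `α`.
  have h2 : Computable fun m : ℕ => if m = 1 then 1 else 0 :=
    (Primrec.ite (Primrec.eq.comp Primrec.id (Primrec.const 1)) (Primrec.const 1)
      (Primrec.const 0)).to_comp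
  have h3 := NatIdealComputable.comp hS (NatIdealComputable.of_computable hS h2) hp
  have key : ∀ a n, (if encode ((decode (α := α × ℕ) (Nat.pair a n)).map
      fun q => p q.1 q.2) = 1 then 1 else 0) = 0 ↔
      ∀ b, decode (α := α) a = some b → p b n = true := by
    intro a n
    cases hd : decode (α := α) a with
    | none => simp [hd]
    | some b => cases hb : p b n <;> simp [hd, hb]
  have hex : ∀ a, ∃ n, (if encode ((decode (α := α × ℕ) (Nat.pair a n)).map
      fun q => p q.1 q.2) = 1 then 1 else 0) = 0 := by
    intro a
    simp_rw [key]
    cases hd : decode (α := α) a with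
    | none => simp
    | some b => obtain ⟨n, hn⟩ := h b; exact ⟨n, by rintro _ ⟨⟩; exact hn⟩
  have h4 := NatIdealComputable.find h3 hex
  have h5 : NatIdealComputable S fun n => encode ((decode (α := α) n).map fun _ => ()) :=
    of_primrec hS (Primrec.const ())
  have h6 : Computable₂ fun m k : ℕ => if m = 0 then 0 else k + 1 :=
    (Primrec.ite (Primrec.eq.comp Primrec.fst (Primrec.const 0)) (Primrec.const 0)
      (Primrec.succ.comp Primrec.snd)).to_comp
  have h7 := NatIdealComputable.comp₂ hS h6 h5 h4
  unfold IdealComputable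
  convert h7 using 2 with n
  cases hd : decode (α := α) n with
  | none => simp
  | some b =>
    simp only [Option.map_some, encode_some, Nat.succ_eq_add_one]
    rw [if_neg (by simp)]
    congr 1
    refine (Nat.find_congr' ?_)
    intro m
    rw [key, hd]
    simp

theorem and (hS : IsTuringIdeal S) {p q : α → Bool} (hp : IdealComputable S p)
    (hq : IdealComputable S q) : IdealComputable S (fun a => p a && q a) :=
  comp₂ hS Primrec.and hp hq

theorem not (hS : IsTuringIdeal S) {p : α → Bool} (hp : IdealComputable S p) :
    IdealComputable S (fun a => !p a) :=
  (of_primrec hS Primrec.not).comp hS hp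

theorem of_eq {f g : α → σ} (hf : IdealComputable S f) (h : ∀ a, f a = g a) :
    IdealComputable S g := (funext h : f = g) ▸ hf

/-- Closure of computable predicates under bounded universal quantification. -/
theorem ball (hS : IsTuringIdeal S) {p : α → ℕ → Bool}
    (hp : IdealComputable S (fun q : α × ℕ => p q.1 q.2)) {B : α → ℕ} (hB : IdealComputable S B) :
    IdealComputable S (fun a => decide (∀ n < B a, p a n = true)) := by
  have h1 : IdealComputable S (fun q : α × ℕ =>
      (fun (a : α) (n : ℕ) => decide (B a ≤ n) || !p a n) q.1 q.2) :=
    comp₂ hS Primrec.or (comp₂ hS Primrec.nat_le.decide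
      (hB.comp hS (of_primrec hS Primrec.fst)) (of_primrec hS Primrec.snd)) (hp.not hS)
  -- Search for a counterexample; `B a` itself passes the test, so the search halts, and the answer
  -- depends on whether it halts before the bound.
  have h2 := find hS (p := fun a n => decide (B a ≤ n) || !p a n) h1 (fun a => ⟨B a, by simp⟩)
  refine (comp₂ hS Primrec.nat_le.decide hB h2).of_eq fun a => ?_
  rw [decide_eq_decide]
  constructor
  · intro h n hn
    have := Nat.find_min _ (hn.trans_le h)
    simpa [hn] using this
  · intro h
    by_contra hlt
    push Not at hlt
    have h3 := Nat.find_spec (p := fun n => (decide (B a ≤ n) || !p a n) = true) ⟨B a, by simp⟩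
    rw [h _ hlt] at h3
    simp only [Bool.not_true, Bool.or_false, decide_eq_true_eq] at h3
    omega

end IdealComputable

theorem SetComputableIn.idealComputable {S : Set (ℕ → Bool)} {A : Set ℕ} {x : ℕ → Bool}
    (hx : x ∈ S) (h : SetComputableIn A x) : IdealComputable S (charFun A) := by
  refine ⟨x, hx, ?_⟩
  have h1 : Nat.RecursiveIn {cantorFun x} (cantorFun (charFun A)) := RecursiveIn.iff_nat.1 h
  refine (Nat.RecursiveIn.comp .succ h1).of_eq fun n => ?_
  refine (Part.bind_some _ _).trans ?_
  cases hb : charFun A n <;> simp [hb]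

theorem IdealComputable.exists_setComputableIn {S : Set (ℕ → Bool)} (hS : IsTuringIdeal S)
    {A : Set ℕ} (h : IdealComputable S (charFun A)) : ∃ x ∈ S, SetComputableIn A x := by
  have h1 := NatIdealComputable.comp hS
    (NatIdealComputable.of_computable hS Computable.pred) h
  obtain ⟨x, hx, h1⟩ := h1
  refine ⟨x, hx, RecursiveIn.iff_nat.2 (h1.of_eq fun n => ?_)⟩
  cases hb : charFun A n <;> simp [cantorFun, hb]

/-! ### Primitive recursive integer arithmetic -/

namespace Primrec

/-- The code of `n` is `2 * n` and that of `-(n + 1)` is `2 * n + 1`. Sign and size are thus read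
off from parity, and the ring operations reduce to naturals through `z = z.toNat - (-z).toNat`. -/
theorem int_ofNat : Primrec (fun n : ℕ => (n : ℤ)) := by
  refine (Primrec.encode_iff.1 ?_)
  refine (Primrec.nat_mul.comp (Primrec.const 2) Primrec.id).of_eq fun n => ?_
  rfl

theorem int_negSucc : Primrec Int.negSucc := by
  refine (Primrec.encode_iff.1 ?_)
  refine (Primrec.succ.comp (Primrec.nat_mul.comp (Primrec.const 2) Primrec.id)).of_eq fun n => ?_
  rfl

theorem int_toNat : Primrec Int.toNat := by
  have : Primrec fun z : ℤ => if Encodable.encode z % 2 = 0 then Encodable.encode z / 2 else 0 :=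
    Primrec.ite (Primrec.eq.comp (Primrec.nat_mod.comp Primrec.encode (Primrec.const 2))
      (Primrec.const 0)) (Primrec.nat_div.comp Primrec.encode (Primrec.const 2)) (Primrec.const 0)
  refine this.of_eq fun z => ?_
  cases z with
  | ofNat n =>
    have : Encodable.encode (Int.ofNat n) = 2 * n := rfl
    rw [this]; simp
  | negSucc n =>
    have : Encodable.encode (Int.negSucc n) = 2 * n + 1 := rfl
    rw [this, if_neg (by omega)]; rfl

theorem int_negToNat : Primrec fun z : ℤ => (-z).toNat := by
  have : Primrec fun z : ℤ => if Encodable.encode z % 2 = 0 then 0 else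
      Encodable.encode z / 2 + 1 :=
    Primrec.ite (Primrec.eq.comp (Primrec.nat_mod.comp Primrec.encode (Primrec.const 2))
      (Primrec.const 0)) (Primrec.const 0)
      (Primrec.succ.comp (Primrec.nat_div.comp Primrec.encode (Primrec.const 2)))
  refine this.of_eq fun z => ?_
  cases z with
  | ofNat n =>
    have : Encodable.encode (Int.ofNat n) = 2 * n := rfl
    rw [this, if_pos (by omega)]; simp
  | negSucc n =>
    have : Encodable.encode (Int.negSucc n) = 2 * n + 1 := rfl
    rw [this, if_neg (by omega)]
    have : -Int.negSucc n = ((n + 1 : ℕ) : ℤ) := by simp [Int.negSucc_eq]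
    rw [this, Int.toNat_natCast]; omega

theorem int_subNat : Primrec₂ fun a b : ℕ => (a : ℤ) - (b : ℤ) := by
  have : Primrec₂ fun a b : ℕ => if b ≤ a then ((a - b : ℕ) : ℤ) else Int.negSucc (b - a - 1) :=
    Primrec.ite (Primrec.nat_le.comp Primrec.snd Primrec.fst)
      (int_ofNat.comp (Primrec.nat_sub.comp Primrec.fst Primrec.snd))
      (int_negSucc.comp (Primrec.nat_sub.comp (Primrec.nat_sub.comp Primrec.snd Primrec.fst)
        (Primrec.const 1)))
  refine this.of_eq fun a b => ?_
  split_ifs with h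
  · omega
  · rw [Int.negSucc_eq]; omega

theorem int_neg : Primrec fun z : ℤ => -z := by
  refine (int_subNat.comp int_negToNat int_toNat).of_eq fun z => ?_
  omega

theorem int_add : Primrec₂ fun a b : ℤ => a + b := by
  refine (int_subNat.comp
    (Primrec.nat_add.comp (int_toNat.comp Primrec.fst) (int_toNat.comp Primrec.snd))
    (Primrec.nat_add.comp (int_negToNat.comp Primrec.fst)
      (int_negToNat.comp Primrec.snd))).of_eq fun z => ?_
  push_cast; omega

theorem int_sub : Primrec₂ fun a b : ℤ => a - b := by
  refine (int_add.comp Primrec.fst (int_neg.comp Primrec.snd)).of_eq fun z => ?_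
  ring

theorem int_mul : Primrec₂ fun a b : ℤ => a * b := by
  refine (int_subNat.comp
    (Primrec.nat_add.comp
      (Primrec.nat_mul.comp (int_toNat.comp Primrec.fst) (int_toNat.comp Primrec.snd))
      (Primrec.nat_mul.comp (int_negToNat.comp Primrec.fst) (int_negToNat.comp Primrec.snd)))
    (Primrec.nat_add.comp
      (Primrec.nat_mul.comp (int_toNat.comp Primrec.fst) (int_negToNat.comp Primrec.snd))
      (Primrec.nat_mul.comp (int_negToNat.comp Primrec.fst)
        (int_toNat.comp Primrec.snd)))).of_eq fun z => ?_
  obtain ⟨a, b⟩ := z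
  have ha : a = (a.toNat : ℤ) - ((-a).toNat : ℤ) := by omega
  have hb : b = (b.toNat : ℤ) - ((-b).toNat : ℤ) := by omega
  conv_rhs => rw [show ((a, b) : ℤ × ℤ).1 = a from rfl, show ((a, b) : ℤ × ℤ).2 = b from rfl,
    ha, hb]
  push_cast; ring

theorem int_natAbs : Primrec Int.natAbs := by
  refine (Primrec.nat_add.comp int_toNat int_negToNat).of_eq fun z => ?_
  omega

theorem int_lt : PrimrecRel fun a b : ℤ => a < b := by
  refine (Primrec.nat_lt.comp
    (Primrec.nat_add.comp (int_toNat.comp Primrec.fst) (int_negToNat.comp Primrec.snd))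
    (Primrec.nat_add.comp (int_toNat.comp Primrec.snd) (int_negToNat.comp Primrec.fst))).of_eq
    fun z => ?_
  obtain ⟨a, b⟩ := z
  dsimp only
  omega

theorem int_natCast_dvd : PrimrecRel fun (a : ℕ) (b : ℤ) => (a : ℤ) ∣ b := by
  refine (Primrec.eq.comp (Primrec.nat_mod.comp (int_natAbs.comp Primrec.snd) Primrec.fst)
    (Primrec.const 0)).of_eq fun z => ?_
  rw [← Nat.dvd_iff_mod_eq_zero]
  exact Int.natCast_dvd.symm

theorem nat_factorial : Primrec Nat.factorial := by
  refine (Primrec.nat_rec₁ 1 (Primrec.nat_mul.comp₂ (Primrec.succ.comp₂ Primrec₂.left)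
    Primrec₂.right)).of_eq fun n => ?_
  induction n with
  | zero => rfl
  | succ n ih => rw [Nat.factorial_succ, ← ih]

end Primrec

/-! ### Computability of functions defined by well-founded recursion -/

/-- A function satisfying a recursion in which `F a` is computed from the values of `F` on a
computable list of smaller arguments is computable. -/
theorem Computable.of_wellFounded_recursion {α σ : Type*} [Primcodable α] [Primcodable σ]
    {F : α → σ} (subs : α → List α) (comb : α → List σ → σ) (hsubs : Computable subs)
    (hcomb : Computable₂ comb) (μ : α → ℕ) (hμ : ∀ a, ∀ b ∈ subs a, μ b < μ a)
    (hF : ∀ a, F a = comb a ((subs a).map F)) : Computable F := by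
  let call : Nat.Partrec.Code → α → Part σ := fun c a =>
    (c.eval (Encodable.encode a)).bind fun m => (Encodable.decode (α := σ) m : Part σ)
  have hcall : Partrec₂ call :=
    (Nat.Partrec.Code.eval_part.comp Computable.fst (Computable.encode.comp Computable.snd)).bind
      (Computable.ofOption (Computable.decode.comp Computable.snd))
  let step : (Nat.Partrec.Code × α) → ℕ × List σ → Part (List σ) := fun p q =>
    (((subs p.2)[q.1]? : Option α) : Part α).bind fun b =>
      (call p.1 b).map fun s => q.2 ++ [s]
  have happ : Computable₂ fun (r : ((Nat.Partrec.Code × α) × (ℕ × List σ)) × α) (s : σ) =>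
      r.1.2.2 ++ [s] := by
    have h1 : Computable fun p : (((Nat.Partrec.Code × α) × (ℕ × List σ)) × α) × σ =>
        p.1.1.2.2 :=
      Computable.snd.comp (Computable.snd.comp (Computable.fst.comp Computable.fst))
    have h2 : Computable fun p : (((Nat.Partrec.Code × α) × (ℕ × List σ)) × α) × σ => [p.2] :=
      Computable.list_cons.comp Computable.snd (Computable.const [])
    exact Computable.list_append.comp h1 h2
  have hget : Computable fun r : (Nat.Partrec.Code × α) × (ℕ × List σ) =>
      (subs r.1.2)[r.2.1]? :=
    Computable.list_getElem?.comp (hsubs.comp (Computable.snd.comp Computable.fst))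
      (Computable.fst.comp Computable.snd)
  have hcall' : Partrec fun r : ((Nat.Partrec.Code × α) × (ℕ × List σ)) × α =>
      call r.1.1.1 r.2 :=
    hcall.comp (Computable.fst.comp (Computable.fst.comp Computable.fst)) Computable.snd
  have hstep : Partrec₂ step := by
    have h3 : Partrec₂ fun (r : (Nat.Partrec.Code × α) × (ℕ × List σ)) (b : α) =>
        (call r.1.1 b).map fun s => r.2.2 ++ [s] := Partrec.map hcall' happ
    exact Partrec.bind (Computable.ofOption hget) h3
  let body : Nat.Partrec.Code → α → Part σ := fun c a =>
    (Nat.rec (motive := fun _ => Part (List σ)) (Part.some [])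
      (fun y IH => IH.bind fun i => step (c, a) (y, i)) (subs a).length).map (comb a)
  have hbody : Partrec₂ body := by
    refine Partrec.map ?_ ?_
    · exact Partrec.nat_rec (Computable.list_length.comp (hsubs.comp Computable.snd))
        (Computable.const []).partrec
        (hstep.comp (Computable.fst) Computable.snd)
    · exact hcomb.comp (Computable.snd.comp Computable.fst) Computable.snd
  have hf : Partrec₂ fun (c : Nat.Partrec.Code) (n : ℕ) =>
      ((Encodable.decode (α := α) n : Part α).bind fun a => (body c a).map Encodable.encode) := by
    refine Partrec.bind (Computable.ofOption (Computable.decode.comp Computable.snd)) ?_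
    exact Partrec.map (hbody.comp (Computable.fst.comp Computable.fst) Computable.snd)
      (Computable.encode.comp Computable.snd)
  -- Kleene's recursion theorem provides a program that calls itself on the smaller arguments. It is
  -- partial a priori; induction on `μ` shows that it halts with the value `F a`.
  obtain ⟨c, hc⟩ := Nat.Partrec.Code.fixed_point₂ hf
  have main : ∀ k, ∀ a, μ a < k → call c a = Part.some (F a) := by
    intro k
    induction k with
    | zero => intro a h; omega
    | succ k ih =>
      intro a ha
      have hsub : ∀ b ∈ subs a, call c b = Part.some (F b) := fun b hb =>
        ih b (lt_of_lt_of_le (hμ a b hb) (by omega))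
      have hrec : ∀ j ≤ (subs a).length,
          Nat.rec (motive := fun _ => Part (List σ)) (Part.some [])
            (fun y IH => IH.bind fun i => step (c, a) (y, i)) j =
          Part.some (((subs a).take j).map F) := by
        intro j
        induction j with
        | zero => intro _; simp
        | succ j ihj =>
          intro hj
          have hj' : j < (subs a).length := hj
          simp only [ihj hj'.le, Part.bind_some]
          simp only [step, List.getElem?_eq_getElem hj', Part.coe_some, Part.bind_some,
            hsub _ (List.getElem_mem hj'), Part.map_some]
          rw [List.take_succ_eq_append_getElem hj', List.map_append, List.map_cons, List.map_nil]
      have hb : body c a = Part.some (F a) := by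
        simp only [body, hrec _ le_rfl, Part.map_some, List.take_length]
        rw [hF a]
      simp only [call, hc, Encodable.encodek, Part.coe_some, Part.bind_some, hb, Part.map_some]
  have : Partrec fun a => call c a :=
    hcall.comp (Computable.const c) Computable.id
  exact this.of_eq fun a => main (μ a + 1) a (Nat.lt_succ_self _)

/-! ### Z-groups -/

/-- `N` divides `x` in the abelian group `M`. -/
def ZDvd {M : Type*} [AddCommGroup M] (N : ℤ) (x : M) : Prop := ∃ q, x = N • q

namespace ZDvd

variable {M : Type*} [AddCommGroup M] {N : ℤ} {x y : M}

theorem add (hx : ZDvd N x) (hy : ZDvd N y) : ZDvd N (x + y) := by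
  obtain ⟨q, rfl⟩ := hx; obtain ⟨r, rfl⟩ := hy
  exact ⟨q + r, by rw [smul_add]⟩

theorem neg (hx : ZDvd N x) : ZDvd N (-x) := by
  obtain ⟨q, rfl⟩ := hx
  exact ⟨-q, by rw [smul_neg]⟩

theorem sub (hx : ZDvd N x) (hy : ZDvd N y) : ZDvd N (x - y) := by
  rw [sub_eq_add_neg]; exact hx.add hy.neg

theorem smul (k : ℤ) (hx : ZDvd N x) : ZDvd N (k • x) := by
  obtain ⟨q, rfl⟩ := hx
  exact ⟨k • q, smul_comm _ _ _⟩

theorem sum {ι : Type*} {s : Finset ι} {f : ι → M} (h : ∀ i ∈ s, ZDvd N (f i)) :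
    ZDvd N (∑ i ∈ s, f i) := by
  classical
  induction s using Finset.induction_on with
  | empty => exact ⟨0, by simp⟩
  | insert i s hi ih =>
    rw [Finset.sum_insert hi]
    exact (h i (Finset.mem_insert_self i s)).add
      (ih fun j hj => h j (Finset.mem_insert_of_mem hj))

theorem of_dvd {N' : ℤ} (h : N ∣ N') (hx : ZDvd N' x) : ZDvd N x := by
  obtain ⟨q, rfl⟩ := hx; obtain ⟨k, rfl⟩ := h
  exact ⟨k • q, by rw [mul_smul]⟩

theorem iff_of_sub (h : ZDvd N (x - y)) : ZDvd N x ↔ ZDvd N y :=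
  ⟨fun hx => by simpa using hx.sub h, fun hy => by simpa using h.add hy⟩

end ZDvd

/-- `M` is a Z-group with least positive element `e`. -/
structure IsDiscreteZGroup {M : Type*} [AddCommGroup M] [LinearOrder M] (e : M) : Prop where
  pos : 0 < e
  le_of_pos : ∀ x, 0 < x → e ≤ x
  exists_residue : ∀ N : ℤ, 0 < N → ∀ x : M, ∃ r : ℤ, ZDvd N (x - r • e)

theorem isDiscreteZGroup_int : IsDiscreteZGroup (1 : ℤ) where
  pos := one_pos
  le_of_pos _ h := h
  exists_residue _ _ x := ⟨x, 0, by simp⟩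

section ZGroup

variable {M : Type*} [AddCommGroup M] [LinearOrder M] [IsOrderedAddMonoid M] {e : M}

theorem zsmul_pos_iff_of_pos {m : ℤ} (hm : 0 < m) {x : M} : 0 < m • x ↔ 0 < x := by
  constructor
  · intro h
    by_contra hx
    push Not at hx
    have := zsmul_nonneg (neg_nonneg.2 hx) hm.le
    rw [smul_neg] at this
    exact absurd (neg_nonneg.1 this) (not_le.2 h)
  · exact fun h => zsmul_pos h hm

theorem IsDiscreteZGroup.pos_smul_iff (he : IsDiscreteZGroup e) {j : ℤ} : 0 < j • e ↔ 0 < j := by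
  constructor
  · intro h
    by_contra hj
    push Not at hj
    have := zsmul_nonneg he.pos.le (neg_nonneg.2 hj)
    rw [neg_smul] at this
    exact absurd (neg_nonneg.1 this) (not_le.2 h)
  · exact fun h => zsmul_pos he.pos h

/-- For a remainder `0 < r < N`, an equation `r • e = N • q` forces `0 < q`, hence `e ≤ q` and `N •
e ≤ r • e`, which is absurd. -/
theorem IsDiscreteZGroup.dvd_smul_iff (he : IsDiscreteZGroup e) {N : ℤ} (hN : 0 < N) {j : ℤ} :
    ZDvd N (j • e) ↔ N ∣ j := by
  constructor
  · rintro ⟨q, hq⟩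
    have hj : j = N * (j / N) + j % N := (Int.mul_ediv_add_emod j N).symm
    have h1 : (j % N) • e = N • (q - (j / N) • e) := by
      rw [smul_sub, ← hq, smul_smul, ← sub_smul]; congr 1; omega
    by_contra hnd
    have hr : 0 < j % N := lt_of_le_of_ne (Int.emod_nonneg _ hN.ne')
      (fun h => hnd (Int.dvd_of_emod_eq_zero h.symm))
    have hr' : j % N < N := Int.emod_lt_of_pos _ hN
    have h2 : 0 < q - (j / N) • e := by
      rw [← zsmul_pos_iff_of_pos hN, ← h1]; exact zsmul_pos he.pos hr
    have h3 := he.le_of_pos _ h2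
    have h4 : N • e ≤ N • (q - (j / N) • e) := zsmul_le_zsmul_right hN.le h3
    rw [← h1] at h4
    have h5 : 0 < (N - j % N) • e := zsmul_pos he.pos (by omega)
    rw [sub_smul] at h5
    exact absurd h4 (not_le.2 (sub_pos.1 h5))
  · rintro ⟨k, rfl⟩
    exact ⟨k • e, mul_smul _ _ _⟩

theorem IsDiscreteZGroup.dvd_sub_iff (he : IsDiscreteZGroup e) {N : ℤ} (hN : 0 < N) {x : M}
    {r r' : ℤ}
    (h : ZDvd N (x - r • e)) : ZDvd N (x - r' • e) ↔ N ∣ r - r' := by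
  rw [← he.dvd_smul_iff hN]
  apply ZDvd.iff_of_sub
  convert h using 1
  rw [sub_smul]; abel

/-- The representative is taken in `1, …, N` to make it positive. It cannot exceed `u`: otherwise `r
• e - u` would be a positive multiple of `N`, hence at least `N • e`, yet smaller than `r • e`. -/
theorem IsDiscreteZGroup.exists_small_pos (he : IsDiscreteZGroup e) {N : ℤ} (hN : 0 < N)
    {u : M} (hu : 0 < u) :
    ∃ r : ℤ, 0 < r ∧ r ≤ N ∧ ZDvd N (u - r • e) ∧ r • e ≤ u := by
  obtain ⟨r, hr⟩ := he.exists_residue N hN u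
  have h1 : ZDvd N (u - ((r - 1) % N + 1) • e) := by
    rw [he.dvd_sub_iff hN hr]
    exact ⟨(r - 1) / N, by have := Int.mul_ediv_add_emod (r - 1) N; linarith⟩
  have h2 := Int.emod_nonneg (r - 1) hN.ne'
  have h3 := Int.emod_lt_of_pos (r - 1) hN
  refine ⟨(r - 1) % N + 1, by omega, by omega, h1, ?_⟩
  obtain ⟨q, hq⟩ := h1
  by_contra hlt
  push Not at hlt
  have h4 : 0 < -q := by
    rw [← zsmul_pos_iff_of_pos hN, smul_neg, ← hq]
    rw [neg_sub]; exact sub_pos.2 hlt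
  have h5 := he.le_of_pos _ h4
  have h6 : N • e ≤ N • -q := zsmul_le_zsmul_right hN.le h5
  rw [smul_neg, ← hq, neg_sub] at h6
  have h7 : N • e ≥ ((r - 1) % N + 1) • e := by
    have := zsmul_nonneg he.pos.le (show 0 ≤ N - ((r - 1) % N + 1) by omega)
    rw [sub_smul] at this
    exact sub_nonneg.1 this
  have h8 : ((r - 1) % N + 1) • e - u < ((r - 1) % N + 1) • e := sub_lt_self _ hu
  exact absurd (h7.trans h6) (not_le.2 h8)

/-- Relative to a finite set `T`, every element has the same cut as a small integer translate of an
element of `T` in the same residue class. -/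
theorem IsDiscreteZGroup.exists_same_cut (he : IsDiscreteZGroup e) (T : Finset M) (hT : T.Nonempty)
    (z : M) {N : ℤ} (hN : 0 < N) : ∃ t₀ ∈ T, ∃ u : ℤ, |u| ≤ N ∧ ZDvd N (z - (t₀ + u • e)) ∧
      ∀ t ∈ T, (t < z ↔ t < t₀ + u • e) ∧ (z < t ↔ t₀ + u • e < t) := by
  by_cases hz : z ∈ T
  · exact ⟨z, hz, 0, by simpa using hN.le, ⟨0, by simp⟩, fun t _ => by simp⟩
  -- Step up from the greatest element of `T` below `z`, or down from the least element of `T` if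
  -- there is none below. At most `N` units reach the residue class of `z` without passing `z`.
  by_cases hlo : (T.filter (· < z)).Nonempty
  · obtain ⟨t₀, ht₀, hmax⟩ := Finset.exists_max_image _ id hlo
    rw [Finset.mem_filter] at ht₀
    obtain ⟨r, hr0, hrN, hd, hle⟩ := he.exists_small_pos hN (sub_pos.2 ht₀.2)
    have hle' : t₀ + r • e ≤ z := by rwa [add_comm, ← le_sub_iff_add_le]
    have hlt : t₀ < t₀ + r • e := lt_add_of_pos_right _ (zsmul_pos he.pos hr0)
    refine ⟨t₀, ht₀.1, r, by rw [abs_of_pos hr0]; exact hrN, by rwa [← sub_sub],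
      fun t ht => ?_⟩
    rcases lt_trichotomy t z with h | h | h
    · have h1 : t ≤ t₀ := hmax t (Finset.mem_filter.2 ⟨ht, h⟩)
      have h2 := h1.trans_lt hlt
      exact ⟨iff_of_true h h2, iff_of_false h.not_gt h2.not_gt⟩
    · exact absurd (h ▸ ht) hz
    · have h2 := hle'.trans_lt h
      exact ⟨iff_of_false h.not_gt h2.not_gt, iff_of_true h h2⟩
  · have hup : ∀ t ∈ T, z < t := by
      intro t ht
      rcases lt_trichotomy t z with h | h | h
      · exact absurd ⟨t, Finset.mem_filter.2 ⟨ht, h⟩⟩ hlo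
      · exact absurd (h ▸ ht) hz
      · exact h
    obtain ⟨t₀, ht₀, hmin⟩ := Finset.exists_min_image T id hT
    obtain ⟨r, hr0, hrN, hd, hle⟩ := he.exists_small_pos hN (sub_pos.2 (hup t₀ ht₀))
    have hlt : t₀ + (-r) • e < t₀ := by
      rw [neg_smul, ← sub_eq_add_neg]; exact sub_lt_self _ (zsmul_pos he.pos hr0)
    refine ⟨t₀, ht₀, -r, by rw [abs_neg, abs_of_pos hr0]; exact hrN, ?_, fun t ht => ?_⟩
    · convert hd.neg using 1
      rw [neg_smul]; abel
    · have h1 := hup t ht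
      have h2 : t₀ + (-r) • e < t := hlt.trans_le (hmin t ht)
      exact ⟨iff_of_false h1.not_gt h2.not_gt, iff_of_true h1 h2⟩

end ZGroup

/-! ### Linear forms and approximation of tuples -/

section Lin

variable {ι : Type*} [Fintype ι] {M : Type*} [AddCommGroup M]

/-- The integral linear form `∑ cᵢ aᵢ + d e`. -/
def zlin (e : M) (a : ι → M) (c : ι → ℤ) (d : ℤ) : M := ∑ i, c i • a i + d • e

theorem zlin_add (e : M) (a : ι → M) (c c' : ι → ℤ) (d d' : ℤ) :
    zlin e a (c + c') (d + d') = zlin e a c d + zlin e a c' d' := by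
  simp only [zlin, Pi.add_apply, add_smul, Finset.sum_add_distrib]; abel

theorem zlin_smul (e : M) (a : ι → M) (k : ℤ) (c : ι → ℤ) (d : ℤ) :
    zlin e a (k • c) (k * d) = k • zlin e a c d := by
  simp only [zlin, Pi.smul_apply, smul_add, Finset.smul_sum, smul_eq_mul, mul_smul]

theorem zlin_neg (e : M) (a : ι → M) (c : ι → ℤ) (d : ℤ) :
    zlin e a (-c) (-d) = -zlin e a c d := by
  have := zlin_smul e a (-1) c d
  rw [neg_one_smul, neg_one_smul, neg_one_mul] at this
  exact this

theorem zlin_sub (e : M) (a : ι → M) (c c' : ι → ℤ) (d d' : ℤ) :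
    zlin e a (c - c') (d - d') = zlin e a c d - zlin e a c' d' := by
  rw [sub_eq_add_neg, sub_eq_add_neg, zlin_add, zlin_neg, sub_eq_add_neg]

end Lin

/-- The tuples `a` and `b` have the same order relations between linear forms of height at most
`K`, and the same residues modulo `K!`. -/
structure ZApprox (K : ℕ) {ι : Type*} [Fintype ι] {M M' : Type*} [AddCommGroup M] [LinearOrder M]
    [AddCommGroup M'] [LinearOrder M'] (e : M) (e' : M') (a : ι → M) (b : ι → M') : Prop where
  pos_iff : ∀ (c : ι → ℤ) (d : ℤ), (∀ i, |c i| ≤ K) → |d| ≤ K →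
    (0 < zlin e a c d ↔ 0 < zlin e' b c d)
  dvd_iff : ∀ (i : ι) (r : ℤ), ZDvd (K.factorial : ℤ) (a i - r • e) ↔
    ZDvd (K.factorial : ℤ) (b i - r • e')

/-- The loss of precision caused by adjoining one element. -/
def zbound (K : ℕ) : ℕ :=
  2 * (K.factorial * K) + K.factorial * K.factorial + 2 * K.factorial

theorem le_zbound (K : ℕ) : K ≤ zbound K := by
  have := Nat.self_le_factorial K
  unfold zbound; omega

/-- The summand `2 * K.factorial` of `zbound` serves this divisibility: for `L = K!` one has `L ∣
L!` and `L! * L! ∣ (2 * L)!`. -/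
theorem factorial_sq_dvd_factorial_zbound (K : ℕ) :
    K.factorial * K.factorial ∣ (zbound K).factorial := by
  have h1 : K.factorial ∣ K.factorial.factorial := Nat.dvd_factorial K.factorial_pos le_rfl
  refine (mul_dvd_mul h1 h1).trans ((Nat.factorial_mul_factorial_dvd_factorial_add _ _).trans
    (Nat.factorial_dvd_factorial ?_))
  unfold zbound; omega

section

variable {ι : Type*} [Fintype ι] {M M' : Type*} [AddCommGroup M] [LinearOrder M]
  [AddCommGroup M'] [LinearOrder M'] {e : M} {e' : M'} {a : ι → M} {b : ι → M'} {K : ℕ}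

theorem ZApprox.symm (h : ZApprox K e e' a b) : ZApprox K e' e b a where
  pos_iff c d hc hd := (h.pos_iff c d hc hd).symm
  dvd_iff i r := (h.dvd_iff i r).symm

theorem ZApprox.refl (K : ℕ) (e : M) (a : ι → M) : ZApprox K e e a a :=
  ⟨fun _ _ _ _ => Iff.rfl, fun _ _ => Iff.rfl⟩

end

/-! ### Extending approximations between Z-groups by one element. -/

section Approx

variable {ι : Type*} [Fintype ι] {M M' : Type*} [AddCommGroup M] [LinearOrder M]
  [IsOrderedAddMonoid M] [AddCommGroup M'] [LinearOrder M'] [IsOrderedAddMonoid M']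
  {e : M} {e' : M'} {a : ι → M} {b : ι → M'} {K K' : ℕ}

/-- Modulo `N` each `a i` may be replaced by the multiple `r i • e` of the unit, which turns the
question into a congruence of integers. -/
theorem zdvd_zlin_iff (he : IsDiscreteZGroup e) {N : ℤ} (hN : 0 < N) {r : ι → ℤ}
    (hr : ∀ i, ZDvd N (a i - r i • e)) (c : ι → ℤ) (d : ℤ) :
    ZDvd N (zlin e a c d) ↔ N ∣ ∑ i, c i * r i + d := by
  rw [← he.dvd_smul_iff hN]
  apply ZDvd.iff_of_sub
  have : zlin e a c d - (∑ i, c i * r i + d) • e = ∑ i, c i • (a i - r i • e) := by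
    simp only [zlin, smul_sub, Finset.sum_sub_distrib, add_smul, Finset.sum_smul, mul_smul]
    abel
  rw [this]
  exact ZDvd.sum fun i _ => (hr i).smul _

theorem ZApprox.zdvd_zlin_iff (h : ZApprox K e e' a b) (he : IsDiscreteZGroup e)
    (he' : IsDiscreteZGroup e') {N : ℤ} (hN : 0 < N) (hNK : N ∣ (K.factorial : ℤ))
    (c : ι → ℤ) (d : ℤ) :
    ZDvd N (zlin e a c d) ↔ ZDvd N (zlin e' b c d) := by
  choose r hr using fun i => he.exists_residue (K.factorial : ℤ)
    (by exact_mod_cast K.factorial_pos) (a i)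
  rw [_root_.zdvd_zlin_iff he hN (fun i => (hr i).of_dvd hNK),
    _root_.zdvd_zlin_iff he' hN (fun i => (((h.dvd_iff i (r i)).1 (hr i)).of_dvd hNK))]

theorem ZApprox.mono (h : ZApprox K' e e' a b) (he : IsDiscreteZGroup e) (he' : IsDiscreteZGroup e')
    (hK : K ≤ K') : ZApprox K e e' a b where
  pos_iff c d hc hd := h.pos_iff c d (fun i => (hc i).trans (by exact_mod_cast hK))
    (hd.trans (by exact_mod_cast hK))
  dvd_iff i r := by
    classical
    have := h.zdvd_zlin_iff he he' (N := K.factorial) (by exact_mod_cast K.factorial_pos)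
      (by exact_mod_cast Nat.factorial_dvd_factorial hK) (Pi.single i 1) (-r)
    simpa [zlin, Pi.single_apply, ite_smul, sub_eq_add_neg] using this

/-- The back-and-forth step, with an explicit bound for the new element. -/
theorem ZApprox.exists_extension (h : ZApprox (zbound K) e e' a b) (he : IsDiscreteZGroup e)
    (he' : IsDiscreteZGroup e') (x : M) : ∃ y : M',
      (∀ (k : ℤ) (c : ι → ℤ) (d : ℤ), |k| ≤ K → (∀ i, |c i| ≤ K) → |d| ≤ K →
        (0 < k • x + zlin e a c d ↔ 0 < k • y + zlin e' b c d)) ∧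
      (∀ r : ℤ, ZDvd (K.factorial : ℤ) (x - r • e) ↔ ZDvd (K.factorial : ℤ) (y - r • e')) ∧
      ∃ (c : ι → ℤ) (d : ℤ), (∀ i, |c i| ≤ K.factorial * K) ∧
        |d| ≤ K.factorial * K + K.factorial * K.factorial ∧
        (K.factorial : ℤ) • y = zlin e' b c d := by
  classical
  set L : ℤ := (K.factorial : ℤ) with hL
  have hL0 : 0 < L := by rw [hL]; exact_mod_cast K.factorial_pos
  have hK0 : (0 : ℤ) ≤ K := by positivity
  have hLK : 0 ≤ L * K := by positivity
  have hb : ((zbound K : ℕ) : ℤ) = 2 * (L * K) + L * L + 2 * L := by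
    simp [zbound, hL]
  -- A nonzero coefficient `k` of `x` divides `L = K!`. Multiplying by the cofactor turns every
  -- inequality in question into a comparison of `L • x` with a form of height at most `L * K`.
  let P : Finset ((ι → ℤ) × ℤ) :=
    (Fintype.piFinset fun _ => Finset.Icc (-(L * K)) (L * K)) ×ˢ Finset.Icc (-(L * K)) (L * K)
  have hP : ∀ p : (ι → ℤ) × ℤ, p ∈ P ↔ (∀ i, |p.1 i| ≤ L * K) ∧ |p.2| ≤ L * K := by
    intro p
    simp only [P, Finset.mem_product, Fintype.mem_piFinset, Finset.mem_Icc, abs_le]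
  have hP0 : (0, 0) ∈ P := (hP _).2 ⟨fun _ => by simpa using hLK, by simpa using hLK⟩
  -- The residue of `L • x` is matched modulo `L * L`, because `y` arises by division by `L` and its
  -- residue modulo `L` must still be right.
  obtain ⟨t₀, ht₀, u, hu, hdvd, hcut⟩ := he.exists_same_cut
    (P.image fun p => zlin e a p.1 p.2) ⟨_, Finset.mem_image_of_mem _ hP0⟩ (L • x)
    (mul_pos hL0 hL0)
  obtain ⟨p₀, hp₀, rfl⟩ := Finset.mem_image.1 ht₀
  obtain ⟨hp₁, hp₂⟩ := (hP _).1 hp₀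
  have hs : ∀ {G : Type _} [AddCommGroup G] (ε : G) (α : ι → G),
      zlin ε α p₀.1 p₀.2 + u • ε = zlin ε α p₀.1 (p₀.2 + u) := by
    intro G _ ε α; simp only [zlin, add_smul, add_assoc]
  rw [hs] at hdvd hcut
  obtain ⟨r, q, hq⟩ := he.exists_residue L hL0 x
  have h1 : ZDvd (L * L) (zlin e a (-p₀.1) (L * r - (p₀.2 + u))) := by
    have h2 : ZDvd (L * L) (L • (x - r • e)) := ⟨q, by rw [hq, smul_smul]⟩
    have h3 := hdvd.sub h2
    convert h3 using 1
    have := zlin_neg e a p₀.1 (p₀.2 + u)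
    rw [smul_sub, smul_smul, sub_sub_sub_comm, sub_self, zero_sub, neg_sub]
    rw [sub_eq_add_neg (L * r)]
    have h4 := zlin_add e a 0 (-p₀.1) (L * r) (-(p₀.2 + u))
    rw [zero_add] at h4
    rw [h4, this]
    simp only [zlin, Pi.zero_apply, zero_smul, Finset.sum_const_zero, zero_add]
    abel
  -- Transferred to `M'`, this divisibility makes the counterpart of `t₀ + u • e` divisible by `L`,
  -- with quotient `r • e' - L • q'`.
  rw [h.zdvd_zlin_iff he he' (mul_pos hL0 hL0)
    (by rw [hL]; exact_mod_cast factorial_sq_dvd_factorial_zbound K)] at h1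
  obtain ⟨q', hq'⟩ := h1
  have hy : L • (r • e' - L • q') = zlin e' b p₀.1 (p₀.2 + u) := by
    rw [smul_sub, smul_smul, smul_smul, ← hq']
    have h4 := zlin_sub e' b 0 p₀.1 (L * r) (p₀.2 + u)
    rw [zero_sub] at h4
    rw [h4]
    simp only [zlin, Pi.zero_apply, zero_smul, Finset.sum_const_zero, zero_add]
    abel
  refine ⟨r • e' - L • q', ?_, ?_, p₀.1, p₀.2 + u, hp₁, ?_, hy⟩
  · -- the order relations
    -- Comparing two forms requires the sign of their difference: twice `L * K`, plus `L * L` for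
    -- the shift `u`. These are the first two summands of `zbound`.
    have hbound : ∀ p ∈ P, (∀ i, |(p₀.1 - p.1) i| ≤ ((zbound K : ℕ) : ℤ)) ∧
        |p₀.2 + u - p.2| ≤ ((zbound K : ℕ) : ℤ) := by
      intro p hp
      obtain ⟨hpa, hpb⟩ := (hP _).1 hp
      rw [hb]
      refine ⟨fun i => ?_, ?_⟩
      · have := abs_sub (p₀.1 i) (p.1 i)
        have h2 := hp₁ i
        have h3 := hpa i
        have h4 := mul_pos hL0 hL0
        rw [Pi.sub_apply]; linarith
      · have := abs_sub (p₀.2 + u) p.2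
        have := abs_add_le p₀.2 u
        linarith
    have hlo : ∀ p ∈ P, (zlin e a p.1 p.2 < L • x ↔
        zlin e' b p.1 p.2 < L • (r • e' - L • q')) := by
      intro p hp
      rw [(hcut _ (Finset.mem_image_of_mem _ hp)).1, hy, ← sub_pos, ← zlin_sub,
        ← sub_pos (b := zlin e' b p.1 p.2),
        ← zlin_sub]
      exact h.pos_iff _ _ (hbound p hp).1 (hbound p hp).2
    have hhi : ∀ p ∈ P, (L • x < zlin e a p.1 p.2 ↔
        L • (r • e' - L • q') < zlin e' b p.1 p.2) := by
      intro p hp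
      rw [(hcut _ (Finset.mem_image_of_mem _ hp)).2, hy, ← sub_pos, ← zlin_sub,
        ← sub_pos (a := zlin e' b p.1 p.2),
        ← zlin_sub]
      refine h.pos_iff _ _ (fun i => ?_) ?_
      · have := (hbound p hp).1 i
        rwa [← abs_neg, ← Pi.neg_apply, neg_sub] at this
      · have := (hbound p hp).2
        rwa [← abs_neg, neg_sub] at this
    have hdiv : ∀ k : ℤ, 0 < k → k ≤ K → ∃ m, 0 < m ∧ m ≤ L ∧ L = m * k := by
      intro k hk hkK
      have : k ∣ L := by
        obtain ⟨j, rfl⟩ := Int.eq_ofNat_of_zero_le hk.le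
        rw [hL]
        exact_mod_cast Nat.dvd_factorial (by exact_mod_cast hk) (by exact_mod_cast hkK)
      obtain ⟨m, hm⟩ := this
      have hm0 : 0 < m := by
        by_contra hcon
        push Not at hcon
        nlinarith
      exact ⟨m, hm0, by nlinarith, by rw [hm, mul_comm]⟩
    have hmem : ∀ (m : ℤ) (c : ι → ℤ) (d : ℤ), |m| ≤ L → (∀ i, |c i| ≤ K) → |d| ≤ K →
        (m • c, m * d) ∈ P := by
      intro m c d hm hc hd
      refine (hP _).2 ⟨fun i => ?_, ?_⟩
      · change |m * c i| ≤ L * K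
        rw [abs_mul]
        exact mul_le_mul hm (hc i) (abs_nonneg _) hL0.le
      · change |m * d| ≤ L * K
        rw [abs_mul]
        exact mul_le_mul hm hd (abs_nonneg _) hL0.le
    intro k c d hk hc hd
    rcases lt_trichotomy k 0 with hk0 | rfl | hk0
    · obtain ⟨m, hm0, hmL, hm⟩ := hdiv (-k) (by omega) (by rwa [abs_of_neg hk0] at hk)
      have := hhi _ (hmem m c d (by rwa [abs_of_pos hm0]) hc hd)
      simp only [zlin_smul] at this
      rw [← sub_pos, ← sub_pos (b := L • (r • e' - L • q')), hm, mul_smul m,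
        mul_smul m (-k) (r • e' - _), ← smul_sub, ← smul_sub,
        zsmul_pos_iff_of_pos hm0, zsmul_pos_iff_of_pos hm0, neg_smul, neg_smul, sub_neg_eq_add,
        sub_neg_eq_add] at this
      rw [add_comm, this, add_comm, ← hm]
    · simp only [zero_smul, zero_add]
      exact h.pos_iff c d (fun i => (hc i).trans (by exact_mod_cast le_zbound K))
        (hd.trans (by exact_mod_cast le_zbound K))
    · obtain ⟨m, hm0, hmL, hm⟩ := hdiv k hk0 (by rwa [abs_of_pos hk0] at hk)
      have := hlo _ (hmem (-m) c d (by rwa [abs_neg, abs_of_pos hm0]) hc hd)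
      simp only [zlin_smul] at this
      rw [← sub_pos, ← sub_pos (a := L • (r • e' - L • q')), hm, mul_smul m,
        mul_smul m k (r • e' - _), neg_smul, neg_smul,
        sub_neg_eq_add, sub_neg_eq_add, ← smul_add, ← smul_add, zsmul_pos_iff_of_pos hm0,
        zsmul_pos_iff_of_pos hm0] at this
      rw [this, ← hm]
  · intro r'
    rw [he.dvd_sub_iff hL0 ⟨q, hq⟩, he'.dvd_sub_iff hL0 (r := r)]
    exact ⟨-q', by rw [smul_neg]; abel⟩
  · have := abs_add_le p₀.2 u
    linarith

end Approx

open FirstOrder FirstOrder.Language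

/-! ### Elementary transfer between Z-groups -/

/-- The symbols `+` and `<` are interpreted by the algebraic operations of `M`. -/
class IsPrStructure (M : Type*) [Add M] [LT M] [prLanguage.Structure M] : Prop where
  funMap_add : ∀ v : Fin 2 → M,
    Structure.funMap (L := prLanguage) (PrFunc.add : prLanguage.Functions 2) v = v 0 + v 1
  relMap_lt : ∀ v : Fin 2 → M,
    Structure.RelMap (L := prLanguage) (PrRel.lt : prLanguage.Relations 2) v ↔ v 0 < v 1

instance : IsPrStructure ℤ := ⟨fun _ => rfl, fun _ => Iff.rfl⟩

/-- The precision needed to evaluate the formula with a given code. -/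
def zlevel (m : ℕ) : ℕ := zbound^[m] (m + 1)

theorem zbound_mono : Monotone zbound := by
  intro a b h
  have h1 := Nat.factorial_le h
  have h2 := Nat.mul_le_mul h1 h
  have h3 := Nat.mul_le_mul h1 h1
  unfold zbound; omega

theorem lt_zlevel (m : ℕ) : m < zlevel m :=
  Function.id_le_iterate_of_id_le (f := zbound) le_zbound m (m + 1)

/-- Passing to a subformula lowers the code, and `zlevel m` contains `m` iterations of `zbound`, so
there is always one left to pay for a quantifier. -/
theorem zbound_zlevel_le {s m : ℕ} (h : s < m) : zbound (zlevel s) ≤ zlevel m := by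
  obtain ⟨k, rfl⟩ := Nat.exists_eq_add_of_lt h
  have h1 : zlevel (s + k + 1) = zbound^[s + 1] (zbound^[k] (s + 1 + k + 1)) := by
    rw [zlevel, show s + k + 1 = s + 1 + k by omega, Function.iterate_add_apply]
  rw [h1, zlevel, ← Function.iterate_succ_apply' zbound s]
  refine (zbound_mono.iterate (s + 1)) ?_
  exact le_trans (b := s + 1 + k + 1) (by omega)
    (Function.id_le_iterate_of_id_le (f := zbound) le_zbound k _)

theorem zlevel_le {s m : ℕ} (h : s < m) : zlevel s ≤ zlevel m :=
  (le_zbound _).trans (zbound_zlevel_le h)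

section Transfer

variable {n k : ℕ}

/-- The multiplicities of the variables in a term. -/
def prTermCoeff : prLanguage.Term (Fin n ⊕ Fin k) → Fin n ⊕ Fin k → ℤ
  | .var i => Pi.single i 1
  | .func PrFunc.add ts => prTermCoeff (ts 0) + prTermCoeff (ts 1)

theorem prTermCoeff_nonneg (t : prLanguage.Term (Fin n ⊕ Fin k)) (i : Fin n ⊕ Fin k) :
    0 ≤ prTermCoeff t i := by
  induction t with
  | var j => rw [prTermCoeff, Pi.single_apply]; split_ifs <;> simp
  | func f ts ih => cases f; exact add_nonneg (ih 0) (ih 1)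

/-- A pair dominates the sum of its components, so codes bound the heights of linear forms. This is
why precision can be measured by codes alone. -/
theorem prTermCoeff_le (t : prLanguage.Term (Fin n ⊕ Fin k)) (i : Fin n ⊕ Fin k) :
    prTermCoeff t i ≤ prTermCode t + 1 := by
  induction t with
  | var j =>
    rw [prTermCoeff, Pi.single_apply]
    split_ifs
    · have : (0 : ℤ) ≤ prTermCode (Term.var (L := prLanguage) j) := by positivity
      linarith
    · positivity
  | func f ts ih =>
    cases f
    have h1 := ih 0
    have h2 := ih 1
    have h3 := Nat.add_le_pair 1 (Nat.pair (prTermCode (ts 0)) (prTermCode (ts 1)))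
    have h4 := Nat.add_le_pair (prTermCode (ts 0)) (prTermCode (ts 1))
    have h5 : prTermCode (.func PrFunc.add ts) =
      Nat.pair 1 (Nat.pair (prTermCode (ts 0)) (prTermCode (ts 1))) := rfl
    rw [← h5] at h3
    have h6 : ((1 + (prTermCode (ts 0) + prTermCode (ts 1)) : ℕ) : ℤ) ≤
      prTermCode (Term.func (L := prLanguage) PrFunc.add ts) := by exact_mod_cast by omega
    push_cast at h6
    change prTermCoeff (ts 0) i + prTermCoeff (ts 1) i ≤ _
    linarith

theorem realize_prTerm {M : Type*} [AddCommGroup M] [LinearOrder M] [prLanguage.Structure M]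
    [IsPrStructure M] (e : M) (a : Fin n ⊕ Fin k → M) (t : prLanguage.Term (Fin n ⊕ Fin k)) :
    t.realize a = zlin e a (prTermCoeff t) 0 := by
  induction t with
  | var j => simp [prTermCoeff, zlin, Pi.single_apply, ite_smul]
  | func f ts ih =>
    cases f
    have h1 : (Term.func (L := prLanguage) PrFunc.add ts).realize a =
        (ts 0).realize a + (ts 1).realize a := IsPrStructure.funMap_add _
    have h2 := zlin_add e a (prTermCoeff (ts 0)) (prTermCoeff (ts 1)) 0 0
    rw [h1, ih, ih, ← h2, add_zero]
    rfl

theorem zlin_snoc {M : Type*} [AddCommGroup M] (e : M) (v : Fin n → M) (xs : Fin k → M) (y : M)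
    (c : Fin n ⊕ Fin (k + 1) → ℤ) (d : ℤ) :
    zlin e (Sum.elim v (Fin.snoc xs y : Fin (k + 1) → M)) c d =
      c (Sum.inr (Fin.last k)) • y + zlin e (Sum.elim v xs)
        (Sum.elim (fun i => c (Sum.inl i)) fun i => c (Sum.inr i.castSucc)) d := by
  simp only [zlin, Fintype.sum_sum_type, Sum.elim_inl, Sum.elim_inr, Fin.sum_univ_castSucc,
    Fin.snoc_castSucc, Fin.snoc_last]
  abel

variable {M M' : Type*} [AddCommGroup M] [LinearOrder M]
  [IsOrderedAddMonoid M] [AddCommGroup M'] [LinearOrder M'] [IsOrderedAddMonoid M']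
  {e : M} {e' : M'} {K : ℕ}

theorem ZApprox.exists_snoc {v : Fin n → M} {xs : Fin k → M} {v' : Fin n → M'} {xs' : Fin k → M'}
    (h : ZApprox (zbound K) e e' (Sum.elim v xs) (Sum.elim v' xs')) (he : IsDiscreteZGroup e)
    (he' : IsDiscreteZGroup e') (x : M) : ∃ y : M',
      ZApprox K e e' (Sum.elim v (Fin.snoc xs x : Fin (k + 1) → M))
        (Sum.elim v' (Fin.snoc xs' y : Fin (k + 1) → M')) ∧
      ∃ (c : Fin n ⊕ Fin k → ℤ) (d : ℤ), (∀ i, |c i| ≤ K.factorial * K) ∧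
        |d| ≤ K.factorial * K + K.factorial * K.factorial ∧
        (K.factorial : ℤ) • y = zlin e' (Sum.elim v' xs') c d := by
  obtain ⟨y, hpos, hdvd, hb⟩ := h.exists_extension he he' x
  refine ⟨y, ⟨fun c d hc hd => ?_, ?_⟩, hb⟩
  · rw [zlin_snoc, zlin_snoc]
    refine hpos _ _ _ (hc _) (fun i => ?_) hd
    cases i <;> exact hc _
  · have hold := (h.mono he he' (le_zbound K)).dvd_iff
    rintro (i | i)
    · exact hold (Sum.inl i)
    · refine Fin.lastCases ?_ (fun i => ?_) i
      · simpa using hdvd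
      · simpa using hold (Sum.inr i)

/-- Tuples that are sufficiently similar satisfy the same formula. -/
theorem ZApprox.realize_iff (he : IsDiscreteZGroup e) (he' : IsDiscreteZGroup e')
    [prLanguage.Structure M] [IsPrStructure M] [prLanguage.Structure M'] [IsPrStructure M']
    (φ : prLanguage.BoundedFormula (Fin n) k) : ∀ {v : Fin n → M} {xs : Fin k → M}
    {v' : Fin n → M'} {xs' : Fin k → M'},
    ZApprox (zlevel (prFormulaCode φ)) e e' (Sum.elim v xs) (Sum.elim v' xs') →
    (φ.Realize v xs ↔ φ.Realize v' xs') := by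
  have atom : ∀ {k : ℕ} (t₁ t₂ : prLanguage.Term (Fin n ⊕ Fin k)) (m : ℕ) {v : Fin n → M}
      {xs : Fin k → M} {v' : Fin n → M'} {xs' : Fin k → M'},
      prTermCode t₁ + prTermCode t₂ < m →
      ZApprox (zlevel m) e e' (Sum.elim v xs) (Sum.elim v' xs') →
      (t₁.realize (Sum.elim v xs) < t₂.realize (Sum.elim v xs) ↔
        t₁.realize (Sum.elim v' xs') < t₂.realize (Sum.elim v' xs')) := by
    intro k t₁ t₂ m v xs v' xs' hm h
    rw [realize_prTerm e, realize_prTerm e, realize_prTerm e', realize_prTerm e', ← sub_pos,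
      ← zlin_sub, ← sub_pos (b := zlin e' _ (prTermCoeff t₁) 0), ← zlin_sub]
    refine h.pos_iff _ _ (fun i => ?_) (by simp)
    have h1 := prTermCoeff_nonneg t₁ i
    have h2 := prTermCoeff_nonneg t₂ i
    have h3 := prTermCoeff_le t₁ i
    have h4 := prTermCoeff_le t₂ i
    have h6 := lt_zlevel m
    have h7 : ((prTermCode t₁ + prTermCode t₂ + 1 : ℕ) : ℤ) ≤ zlevel m := by
      exact_mod_cast by omega
    push_cast at h7
    rw [Pi.sub_apply, abs_le]
    constructor <;> linarith
  induction φ with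
  | falsum => intros; exact Iff.rfl
  | equal t₁ t₂ =>
    intro v xs v' xs' h
    have hm : prTermCode t₁ + prTermCode t₂ < prFormulaCode (.equal t₁ t₂) := by
      have := Nat.add_le_pair 1 (Nat.pair (prTermCode t₁) (prTermCode t₂))
      have := Nat.add_le_pair (prTermCode t₁) (prTermCode t₂)
      change _ < Nat.pair _ _
      omega
    have h1 := atom t₁ t₂ _ hm h
    have h2 := atom t₂ t₁ _ (by omega) h
    change t₁.realize _ = t₂.realize _ ↔ t₁.realize _ = t₂.realize _
    rw [eq_iff_le_not_lt, eq_iff_le_not_lt, ← not_lt, ← not_lt, h1, h2]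
  | rel R ts =>
    intro v xs v' xs' h
    cases R
    have hm : prTermCode (ts 0) + prTermCode (ts 1) < prFormulaCode (.rel PrRel.lt ts) := by
      have := Nat.add_le_pair 2 (Nat.pair (prTermCode (ts 0)) (prTermCode (ts 1)))
      have := Nat.add_le_pair (prTermCode (ts 0)) (prTermCode (ts 1))
      change _ < Nat.pair _ _
      omega
    exact (IsPrStructure.relMap_lt fun i => (ts i).realize (Sum.elim v xs)).trans
      ((atom _ _ _ hm h).trans
        (IsPrStructure.relMap_lt fun i => (ts i).realize (Sum.elim v' xs')).symm)
  | imp φ ψ ihφ ihψ =>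
    intro v xs v' xs' h
    have h1 := Nat.add_le_pair 3 (Nat.pair (prFormulaCode φ) (prFormulaCode ψ))
    have h2 := Nat.add_le_pair (prFormulaCode φ) (prFormulaCode ψ)
    have h3 : prFormulaCode (.imp φ ψ) =
      Nat.pair 3 (Nat.pair (prFormulaCode φ) (prFormulaCode ψ)) := rfl
    exact imp_congr (ihφ (h.mono he he' (zlevel_le (by omega))))
      (ihψ (h.mono he he' (zlevel_le (by omega))))
  | all φ ih =>
    intro v xs v' xs' h
    have h1 := Nat.add_le_pair 4 (prFormulaCode φ)
    have h2 : prFormulaCode (.all φ) = Nat.pair 4 (prFormulaCode φ) := rfl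
    have h3 := h.mono he he' (zbound_zlevel_le (s := prFormulaCode φ) (by omega))
    constructor
    · intro H y
      obtain ⟨x, hx, -⟩ := h3.symm.exists_snoc he' he y
      exact (ih hx.symm).1 (H x)
    · intro H x
      obtain ⟨y, hy, -⟩ := h3.exists_snoc he he' x
      exact (ih hy).2 (H y)

/-- Every tuple of a Z-group is approximated by a tuple of a given Z-group. -/
theorem exists_zapprox (he : IsDiscreteZGroup e) (he' : IsDiscreteZGroup e') :
    ∀ (k : ℕ) (K : ℕ) (a : Fin k → M), ∃ b : Fin k → M', ZApprox K e e' a b := by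
  have main : ∀ (k : ℕ) (K : ℕ) (a : Fin k → M), ∃ b : Fin k → M',
      ZApprox K e e' (Sum.elim (Fin.elim0 : Fin 0 → M) a)
        (Sum.elim (Fin.elim0 : Fin 0 → M') b) := by
    intro k
    induction k with
    | zero =>
      intro K a
      refine ⟨Fin.elim0, ⟨fun c d _ _ => ?_, ?_⟩⟩
      · simp only [zlin, Finset.univ_eq_empty, Finset.sum_empty, zero_add]
        rw [he.pos_smul_iff, he'.pos_smul_iff]
      · rintro (i | i) <;> exact i.elim0
    | succ k ih =>
      intro K a
      obtain ⟨b, hb⟩ := ih (zbound K) (Fin.init a)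
      obtain ⟨y, hy, -⟩ := hb.exists_snoc he he' (a (Fin.last k))
      rw [Fin.snoc_init_self] at hy
      exact ⟨_, hy⟩
  intro k K a
  obtain ⟨b, hb⟩ := main k K a
  refine ⟨b, ⟨fun c d hc hd => ?_, fun i => hb.dvd_iff (Sum.inr i)⟩⟩
  have := hb.pos_iff (Sum.elim Fin.elim0 c) d (by rintro (i | i); exacts [i.elim0, hc i]) hd
  simpa [zlin] using this

end Transfer

/-! ### A decision procedure for Presburger arithmetic -/

/-- The function determined by its values on a list of arguments of smaller measure. -/
def listRec {α σ : Type*} (subs : α → List α) (comb : α → List σ → σ) (μ : α → ℕ)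
    (hμ : ∀ a, ∀ b ∈ subs a, μ b < μ a) (a : α) : σ :=
  comb a ((subs a).attach.map fun b => listRec subs comb μ hμ b.1)
termination_by μ a
decreasing_by exact hμ a b.1 b.2

theorem listRec_eq {α σ : Type*} (subs : α → List α) (comb : α → List σ → σ) (μ : α → ℕ)
    (hμ : ∀ a, ∀ b ∈ subs a, μ b < μ a) (a : α) :
    listRec subs comb μ hμ a = comb a ((subs a).map (listRec subs comb μ hμ)) := by
  rw [listRec]
  congr 1
  simp

/-- The arguments of the evaluation functions: a code, the values of the free variables and the
values of the bound variables. -/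
abbrev EvalArg : Type := ℕ × List ℤ × List ℤ

theorem unpair_fst_lt {m : ℕ} (h : 0 < m.unpair.1) : m.unpair.2.unpair.1 < m := by
  have h1 := Nat.unpair_left_le m.unpair.2
  have h2 := Nat.add_le_pair m.unpair.1 m.unpair.2
  rw [Nat.pair_unpair] at h2; omega

theorem unpair_snd_lt {m : ℕ} (h : 0 < m.unpair.1) : m.unpair.2.unpair.2 < m := by
  have h1 := Nat.unpair_right_le m.unpair.2
  have h2 := Nat.add_le_pair m.unpair.1 m.unpair.2
  rw [Nat.pair_unpair] at h2; omega

theorem unpair_lt {m : ℕ} (h : 0 < m.unpair.1) : m.unpair.2 < m := by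
  have h2 := Nat.add_le_pair m.unpair.1 m.unpair.2
  rw [Nat.pair_unpair] at h2; omega

/-- The pair of arguments with the two components of the code `m.unpair.2`. -/
def evalPair (a : EvalArg) : List EvalArg :=
  [(a.1.unpair.2.unpair.1, a.2), (a.1.unpair.2.unpair.2, a.2)]

def termEvalSubs (a : EvalArg) : List EvalArg :=
  if a.1.unpair.1 = 1 then evalPair a else []

def termEvalComb (a : EvalArg) (L : List (Option ℤ)) : Option ℤ :=
  if a.1.unpair.1 = 0 then
    if a.1.unpair.2 % 2 = 0 then a.2.1[a.1.unpair.2 / 2]? else a.2.2[a.1.unpair.2 / 2]?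
  else if a.1.unpair.1 = 1 then
    (L.getD 0 none).bind fun x => (L.getD 1 none).map fun y => x + y
  else none

theorem termEvalSubs_lt (a b : EvalArg) (h : b ∈ termEvalSubs a) : b.1 < a.1 := by
  unfold termEvalSubs at h
  split_ifs at h with h1
  · simp only [evalPair, List.mem_cons, List.not_mem_nil, or_false] at h
    rcases h with rfl | rfl
    · exact unpair_fst_lt (by omega)
    · exact unpair_snd_lt (by omega)
  · simp at h

/-- Evaluation of a coded term over the integers; `none` if there is no such term. -/
def termEval : EvalArg → Option ℤ :=
  listRec termEvalSubs termEvalComb Prod.fst termEvalSubs_lt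

/-- A bound for the absolute value of the integers that have to be tried in order to evaluate a
universal quantifier in front of the formula with code `r`. -/
def evalBound (r : ℕ) (l xs : List ℤ) : ℕ :=
  (zlevel r).factorial * zlevel r *
      ((l.map Int.natAbs).sum + (xs.map Int.natAbs).sum + 1) +
    (zlevel r).factorial * (zlevel r).factorial

def formulaEvalSubs (a : EvalArg) : List EvalArg :=
  if a.1.unpair.1 = 3 then evalPair a
  else if a.1.unpair.1 = 4 then
    (List.range (2 * evalBound a.1.unpair.2 a.2.1 a.2.2 + 1)).map fun i : ℕ =>
      (a.1.unpair.2, a.2.1, a.2.2 ++ [(i : ℤ) - (evalBound a.1.unpair.2 a.2.1 a.2.2 : ℕ)])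
  else []

/-- Strict conjunction of partially defined truth values. -/
def optAnd (x y : Option Bool) : Option Bool := x.bind fun p => y.map fun q => p && q

def formulaEvalComb (a : EvalArg) (L : List (Option Bool)) : Option Bool :=
  if a.1.unpair.1 = 0 then (if a.1.unpair.2 = 0 then some false else none)
  else if a.1.unpair.1 = 1 then
    (termEval (a.1.unpair.2.unpair.1, a.2)).bind fun x =>
      (termEval (a.1.unpair.2.unpair.2, a.2)).map fun y => decide (x = y)
  else if a.1.unpair.1 = 2 then
    (termEval (a.1.unpair.2.unpair.1, a.2)).bind fun x =>
      (termEval (a.1.unpair.2.unpair.2, a.2)).map fun y => decide (x < y)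
  else if a.1.unpair.1 = 3 then
    (L.getD 0 none).bind fun x => (L.getD 1 none).map fun y => !x || y
  else if a.1.unpair.1 = 4 then L.foldr optAnd (some true)
  else none

theorem formulaEvalSubs_lt (a b : EvalArg) (h : b ∈ formulaEvalSubs a) : b.1 < a.1 := by
  unfold formulaEvalSubs at h
  split_ifs at h with h1 h2
  · simp only [evalPair, List.mem_cons, List.not_mem_nil, or_false] at h
    rcases h with rfl | rfl
    · exact unpair_fst_lt (by omega)
    · exact unpair_snd_lt (by omega)
  · obtain ⟨i, -, rfl⟩ := List.mem_map.1 h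
    exact unpair_lt (by omega)
  · simp at h

/-- Evaluation of a coded formula over the integers; `none` if there is no such formula. -/
def formulaEval : EvalArg → Option Bool :=
  listRec formulaEvalSubs formulaEvalComb Prod.fst formulaEvalSubs_lt

/-! #### Correctness -/

theorem termEval_var_even (r : ℕ) (l xs : List ℤ) :
    termEval (Nat.pair 0 (2 * r), l, xs) = l[r]? := by
  rw [termEval, listRec_eq]
  simp [termEvalComb]

theorem termEval_var_odd (r : ℕ) (l xs : List ℤ) :
    termEval (Nat.pair 0 (2 * r + 1), l, xs) = xs[r]? := by
  rw [termEval, listRec_eq]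
  have : (2 * r + 1) / 2 = r := by omega
  simp [termEvalComb, this]

theorem termEval_add (r s : ℕ) (p : List ℤ × List ℤ) :
    termEval (Nat.pair 1 (Nat.pair r s), p) =
      (termEval (r, p)).bind fun x => (termEval (s, p)).map fun y => x + y := by
  conv_lhs => rw [termEval, listRec_eq]
  simp [termEvalComb, termEvalSubs, evalPair, termEval]

theorem termEval_eq_none {m : ℕ} (p : List ℤ × List ℤ) (h : 2 ≤ m.unpair.1) :
    termEval (m, p) = none := by
  rw [termEval, listRec_eq, termEvalComb, if_neg (by dsimp only; omega),
    if_neg (by dsimp only; omega)]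

theorem formulaEval_zero (r : ℕ) (p : List ℤ × List ℤ) :
    formulaEval (Nat.pair 0 r, p) = if r = 0 then some false else none := by
  rw [formulaEval, listRec_eq]
  simp [formulaEvalComb]

theorem formulaEval_eq (r s : ℕ) (p : List ℤ × List ℤ) :
    formulaEval (Nat.pair 1 (Nat.pair r s), p) =
      (termEval (r, p)).bind fun x => (termEval (s, p)).map fun y => decide (x = y) := by
  rw [formulaEval, listRec_eq]
  simp [formulaEvalComb]

theorem formulaEval_lt (r s : ℕ) (p : List ℤ × List ℤ) :
    formulaEval (Nat.pair 2 (Nat.pair r s), p) =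
      (termEval (r, p)).bind fun x => (termEval (s, p)).map fun y => decide (x < y) := by
  rw [formulaEval, listRec_eq]
  simp [formulaEvalComb]

theorem formulaEval_imp (r s : ℕ) (p : List ℤ × List ℤ) :
    formulaEval (Nat.pair 3 (Nat.pair r s), p) =
      (formulaEval (r, p)).bind fun x => (formulaEval (s, p)).map fun y => !x || y := by
  conv_lhs => rw [formulaEval, listRec_eq]
  simp [formulaEvalComb, formulaEvalSubs, evalPair, formulaEval]

theorem formulaEval_all (r : ℕ) (l xs : List ℤ) :
    formulaEval (Nat.pair 4 r, l, xs) =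
      ((List.range (2 * evalBound r l xs + 1)).map fun i : ℕ =>
        formulaEval (r, l, xs ++ [(i : ℤ) - (evalBound r l xs : ℕ)])).foldr optAnd (some true) := by
  conv_lhs => rw [formulaEval, listRec_eq]
  simp [formulaEvalComb, formulaEvalSubs, formulaEval, Function.comp_def]

theorem formulaEval_eq_none {m : ℕ} (p : List ℤ × List ℤ) (h : 5 ≤ m.unpair.1) :
    formulaEval (m, p) = none := by
  rw [formulaEval, listRec_eq, formulaEvalComb, if_neg (by dsimp only; omega),
    if_neg (by dsimp only; omega), if_neg (by dsimp only; omega), if_neg (by dsimp only; omega),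
    if_neg (by dsimp only; omega)]

theorem foldr_optAnd_some {α : Type*} (L : List α) (f : α → Bool) :
    (L.map fun a => some (f a)).foldr optAnd (some true) = some (L.all f) := by
  induction L with
  | nil => rfl
  | cons a L ih => rw [List.map_cons, List.foldr_cons, ih]; rfl

theorem isSome_of_foldr_optAnd {L : List (Option Bool)}
    (h : (L.foldr optAnd (some true)).isSome) : ∀ x ∈ L, x.isSome := by
  induction L with
  | nil => simp
  | cons a L ih =>
    rw [List.foldr_cons] at h
    cases ha : a with
    | none => simp [ha, optAnd] at h
    | some p =>
      cases hL : L.foldr optAnd (some true) with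
      | none => simp [hL, ha, optAnd] at h
      | some q =>
        intro x hx
        rcases List.mem_cons.1 hx with rfl | hx
        · rfl
        · exact ih (by simp [hL]) x hx

section Correctness

variable {n : ℕ}

theorem termEval_code {k : ℕ} (t : prLanguage.Term (Fin n ⊕ Fin k)) (v : Fin n → ℤ)
    (xs : Fin k → ℤ) : termEval (prTermCode t, List.ofFn v, List.ofFn xs) =
      some (t.realize (Sum.elim v xs)) := by
  induction t with
  | var i =>
    rcases i with i | i
    · rw [prTermCode, termEval_var_even]; simp
    · rw [prTermCode, termEval_var_odd]; simp
  | func f ts ih =>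
    cases f
    have h1 : (Term.func (L := prLanguage) PrFunc.add ts).realize (Sum.elim v xs) =
        (ts 0).realize (Sum.elim v xs) + (ts 1).realize (Sum.elim v xs) := rfl
    rw [prTermCode, termEval_add, ih, ih, h1]
    rfl

theorem exists_term_of_termEval {k : ℕ} (v : Fin n → ℤ) (xs : Fin k → ℤ) (m : ℕ)
    (h : (termEval (m, List.ofFn v, List.ofFn xs)).isSome) :
    ∃ t : prLanguage.Term (Fin n ⊕ Fin k), prTermCode t = m := by
  induction m using Nat.strong_induction_on with
  | _ m ih =>
    rcases hm : m.unpair.1 with _ | _ | j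
    · have hm' : m = Nat.pair 0 m.unpair.2 := by rw [← hm, Nat.pair_unpair]
      rcases Nat.even_or_odd' m.unpair.2 with ⟨r, hr | hr⟩
      · rw [hr] at hm'
        rw [hm', termEval_var_even] at h
        have : r < n := by simpa [List.getElem?_ofFn] using h
        exact ⟨.var (Sum.inl ⟨r, this⟩), hm'.symm⟩
      · rw [hr] at hm'
        rw [hm', termEval_var_odd] at h
        have : r < k := by simpa [List.getElem?_ofFn] using h
        exact ⟨.var (Sum.inr ⟨r, this⟩), hm'.symm⟩
    · rw [zero_add] at hm
      have hm' : m = Nat.pair 1 (Nat.pair m.unpair.2.unpair.1 m.unpair.2.unpair.2) := by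
        rw [Nat.pair_unpair, ← hm, Nat.pair_unpair]
      rw [hm', termEval_add] at h
      obtain ⟨t₁, ht₁⟩ := ih _ (unpair_fst_lt (by omega)) (by
        cases h1 : termEval (m.unpair.2.unpair.1, List.ofFn v, List.ofFn xs) with
        | none => simp [h1] at h
        | some x => rfl)
      obtain ⟨t₂, ht₂⟩ := ih _ (unpair_snd_lt (by omega)) (by
        cases h1 : termEval (m.unpair.2.unpair.2, List.ofFn v, List.ofFn xs) with
        | none => simp [h1] at h
        | some x => rfl)
      refine ⟨.func PrFunc.add ![t₁, t₂], ?_⟩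
      rw [hm', ← ht₁, ← ht₂]
      rfl
    · rw [termEval_eq_none _ (by omega)] at h
      simp at h

/-- The back-and-forth step supplies a `y` for which `K! • y` is a form of bounded height in the
parameters; since `1 ≤ K!`, the same bound holds for `y`. -/
theorem abs_le_evalBound {k r : ℕ} (v : Fin n → ℤ) (xs : Fin k → ℤ) (y : ℤ)
    (c : Fin n ⊕ Fin k → ℤ) (d : ℤ)
    (hc : ∀ i, |c i| ≤ (zlevel r).factorial * zlevel r)
    (hd : |d| ≤ (zlevel r).factorial * zlevel r + (zlevel r).factorial * (zlevel r).factorial)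
    (hy : ((zlevel r).factorial : ℤ) • y = zlin 1 (Sum.elim v xs) c d) :
    |y| ≤ evalBound r (List.ofFn v) (List.ofFn xs) := by
  set L : ℤ := ((zlevel r).factorial : ℤ) with hL
  have hL1 : 1 ≤ L := by rw [hL]; exact_mod_cast (zlevel r).factorial_pos
  have h1 : |y| ≤ |zlin 1 (Sum.elim v xs) c d| := by
    rw [← hy, smul_eq_mul, abs_mul, abs_of_pos (by omega : 0 < L)]
    exact le_mul_of_one_le_left (abs_nonneg _) hL1
  have h2 : |zlin 1 (Sum.elim v xs) c d| ≤ L * zlevel r * ∑ i, |Sum.elim v xs i| + |d| := by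
    refine (abs_add_le _ _).trans (add_le_add ?_ (by simp))
    refine (Finset.abs_sum_le_sum_abs _ _).trans ?_
    rw [Finset.mul_sum]
    refine Finset.sum_le_sum fun i _ => ?_
    rw [smul_eq_mul, abs_mul]
    exact mul_le_mul_of_nonneg_right (hc i) (abs_nonneg _)
  have h3 : ∀ {j : ℕ} (w : Fin j → ℤ), (((List.ofFn w).map Int.natAbs).sum : ℤ) =
      ∑ i, |w i| := by
    intro j w
    rw [List.map_ofFn, List.sum_ofFn]
    simp
  have h4 : (evalBound r (List.ofFn v) (List.ofFn xs) : ℤ) =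
      L * zlevel r * ((∑ i, |Sum.elim v xs i|) + 1) + L * L := by
    rw [evalBound]
    rw [Nat.cast_add, Nat.cast_mul, Nat.cast_mul, Nat.cast_mul, Nat.cast_add, Nat.cast_add, h3, h3,
      Fintype.sum_sum_type]
    simp [hL]
  rw [h4]
  linarith

/-- Testing a quantifier on a finite interval suffices: the back-and-forth step from the tuple to
itself replaces an arbitrary integer by one in the interval that satisfies the same body. -/
theorem formulaEval_code {k : ℕ} (φ : prLanguage.BoundedFormula (Fin n) k) (v : Fin n → ℤ) :
    ∀ xs : Fin k → ℤ, ∃ b : Bool,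
      formulaEval (prFormulaCode φ, List.ofFn v, List.ofFn xs) = some b ∧
        (b = true ↔ φ.Realize v xs) := by
  induction φ with
  | falsum =>
    intro xs
    refine ⟨false, ?_, ?_⟩
    · rw [prFormulaCode, formulaEval_zero, if_pos rfl]
    · simp [BoundedFormula.Realize]
  | equal t₁ t₂ =>
    intro xs
    refine ⟨decide (t₁.realize (Sum.elim v xs) = t₂.realize (Sum.elim v xs)), ?_, ?_⟩
    · rw [prFormulaCode, formulaEval_eq, termEval_code, termEval_code]; rfl
    · simp [BoundedFormula.Realize]
  | rel R ts =>
    cases R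
    intro xs
    refine ⟨decide ((ts 0).realize (Sum.elim v xs) < (ts 1).realize (Sum.elim v xs)), ?_, ?_⟩
    · rw [prFormulaCode, formulaEval_lt, termEval_code, termEval_code]; rfl
    · rw [decide_eq_true_eq]; exact Iff.rfl
  | imp φ ψ ihφ ihψ =>
    intro xs
    obtain ⟨p, hp, hp'⟩ := ihφ xs
    obtain ⟨q, hq, hq'⟩ := ihψ xs
    refine ⟨!p || q, ?_, ?_⟩
    · rw [prFormulaCode, formulaEval_imp, hp, hq]; rfl
    · rw [BoundedFormula.realize_imp, ← hp', ← hq']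
      cases p <;> simp
  | @all k φ ih =>
    intro xs
    choose f hf hf' using ih
    have hsnoc : ∀ y : ℤ, List.ofFn xs ++ [y] = List.ofFn (Fin.snoc xs y : Fin (k + 1) → ℤ) := by
      intro y
      rw [List.ofFn_succ']
      simp
    set B := evalBound (prFormulaCode φ) (List.ofFn v) (List.ofFn xs) with hB
    refine ⟨(List.range (2 * B + 1)).all fun i : ℕ => f (Fin.snoc xs ((i : ℤ) - (B : ℕ))), ?_, ?_⟩
    · rw [prFormulaCode, formulaEval_all, ← foldr_optAnd_some, ← hB]
      simp only [hsnoc, hf]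
    · rw [List.all_eq_true, BoundedFormula.realize_all]
      constructor
      · intro H x
        obtain ⟨y, hy, c, d, hc, hd, hyc⟩ := (ZApprox.refl (zbound (zlevel (prFormulaCode φ)))
          (1 : ℤ) (Sum.elim v xs)).exists_snoc isDiscreteZGroup_int isDiscreteZGroup_int x
        have h1 := abs_le.1 (abs_le_evalBound v xs y c d hc hd hyc)
        rw [← hB] at h1
        have h2 := H (y + B).toNat (List.mem_range.2 (by omega))
        rw [hf', show (((y + B).toNat : ℕ) : ℤ) - (B : ℕ) = y by omega] at h2
        exact (hy.realize_iff isDiscreteZGroup_int isDiscreteZGroup_int).2 h2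
      · intro H i _
        exact (hf' _).2 (H _)

/-- Evaluation is strict: a defined value forces defined values of all components, so it certifies
that `m` is a code in the right variables. -/
theorem exists_formula_of_formulaEval (v : Fin n → ℤ) (m : ℕ) : ∀ {k : ℕ} (xs : Fin k → ℤ),
    (formulaEval (m, List.ofFn v, List.ofFn xs)).isSome →
    ∃ φ : prLanguage.BoundedFormula (Fin n) k, prFormulaCode φ = m := by
  induction m using Nat.strong_induction_on with
  | _ m ih =>
    intro k xs h
    have hm0 : m = Nat.pair m.unpair.1 (Nat.pair m.unpair.2.unpair.1 m.unpair.2.unpair.2) := by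
      rw [Nat.pair_unpair, Nat.pair_unpair]
    have atom : ∀ (f : ℤ → ℤ → Bool), ((termEval (m.unpair.2.unpair.1, List.ofFn v,
        List.ofFn xs)).bind fun x => (termEval (m.unpair.2.unpair.2, List.ofFn v,
        List.ofFn xs)).map fun y => f x y).isSome → ∃ t₁ t₂ : prLanguage.Term (Fin n ⊕ Fin k),
        prTermCode t₁ = m.unpair.2.unpair.1 ∧ prTermCode t₂ = m.unpair.2.unpair.2 := by
      intro f hf
      obtain ⟨t₁, ht₁⟩ := exists_term_of_termEval v xs m.unpair.2.unpair.1 (by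
        cases h1 : termEval (m.unpair.2.unpair.1, List.ofFn v, List.ofFn xs) with
        | none => simp [h1] at hf
        | some x => rfl)
      obtain ⟨t₂, ht₂⟩ := exists_term_of_termEval v xs m.unpair.2.unpair.2 (by
        cases h1 : termEval (m.unpair.2.unpair.2, List.ofFn v, List.ofFn xs) with
        | none => simp [h1] at hf
        | some x => rfl)
      exact ⟨t₁, t₂, ht₁, ht₂⟩
    rcases hm : m.unpair.1 with _ | _ | _ | _ | _ | j
    · have hm' : m = Nat.pair 0 m.unpair.2 := by rw [← hm, Nat.pair_unpair]
      rw [hm', formulaEval_zero] at h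
      split_ifs at h with h0
      · exact ⟨.falsum, by rw [hm', h0]; rfl⟩
      · simp at h
    · rw [hm] at hm0
      rw [hm0, formulaEval_eq] at h
      obtain ⟨t₁, t₂, h1, h2⟩ := atom _ h
      exact ⟨.equal t₁ t₂, by rw [hm0, ← h1, ← h2]; rfl⟩
    · rw [hm] at hm0
      rw [hm0, formulaEval_lt] at h
      obtain ⟨t₁, t₂, h1, h2⟩ := atom _ h
      exact ⟨.rel PrRel.lt ![t₁, t₂], by rw [hm0, ← h1, ← h2]; rfl⟩
    · rw [hm] at hm0
      rw [hm0, formulaEval_imp] at h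
      obtain ⟨φ, hφ⟩ := ih _ (unpair_fst_lt (m := m) (by omega)) xs (by
        cases h1 : formulaEval (m.unpair.2.unpair.1, List.ofFn v, List.ofFn xs) with
        | none => simp [h1] at h
        | some x => rfl)
      obtain ⟨ψ, hψ⟩ := ih _ (unpair_snd_lt (m := m) (by omega)) xs (by
        cases h1 : formulaEval (m.unpair.2.unpair.2, List.ofFn v, List.ofFn xs) with
        | none => simp [h1] at h
        | some x => rfl)
      exact ⟨.imp φ ψ, by rw [hm0, ← hφ, ← hψ]; rfl⟩
    · have hm' : m = Nat.pair 4 m.unpair.2 := by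
        conv_lhs => rw [← Nat.pair_unpair m, hm]
      rw [hm', formulaEval_all] at h
      -- The tested interval is never empty; its point with index `0` already shows that the body is
      -- a formula.
      have h1 := isSome_of_foldr_optAnd h _
        (List.mem_map.2 ⟨0, List.mem_range.2 (Nat.succ_pos _), rfl⟩)
      rw [show List.ofFn xs ++ [((0 : ℕ) : ℤ) -
        (evalBound m.unpair.2 (List.ofFn v) (List.ofFn xs) : ℕ)] =
        List.ofFn (Fin.snoc xs (((0 : ℕ) : ℤ) -
        (evalBound m.unpair.2 (List.ofFn v) (List.ofFn xs) : ℕ)) : Fin (k + 1) → ℤ) by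
          rw [List.ofFn_succ']; simp] at h1
      obtain ⟨φ, hφ⟩ := ih _ (unpair_lt (by omega)) _ h1
      exact ⟨.all φ, by rw [hm', ← hφ]; rfl⟩
    · rw [formulaEval_eq_none _ (by omega)] at h
      simp at h

end Correctness

/-! #### Computability of the decision procedure -/

theorem primrec_zbound : Primrec zbound := by
  have h1 : Primrec fun K : ℕ => K.factorial * K :=
    Primrec.nat_mul.comp Primrec.nat_factorial Primrec.id
  have h2 : Primrec fun K : ℕ => K.factorial * K.factorial :=
    Primrec.nat_mul.comp Primrec.nat_factorial Primrec.nat_factorial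
  exact Primrec.nat_add.comp (Primrec.nat_add.comp
    (Primrec.nat_mul.comp (Primrec.const 2) h1) h2)
    (Primrec.nat_mul.comp (Primrec.const 2) Primrec.nat_factorial)

theorem primrec_zlevel : Primrec zlevel :=
  Primrec.nat_iterate Primrec.id Primrec.succ (primrec_zbound.comp₂ Primrec₂.right)

theorem primrec_evalTag : Primrec fun a : EvalArg => a.1.unpair.1 :=
  Primrec.fst.comp (Primrec.unpair.comp Primrec.fst)

theorem primrec_evalBody : Primrec fun a : EvalArg => a.1.unpair.2 :=
  Primrec.snd.comp (Primrec.unpair.comp Primrec.fst)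

theorem primrec_evalFst : Primrec fun a : EvalArg => (a.1.unpair.2.unpair.1, a.2) :=
  (Primrec.fst.comp (Primrec.unpair.comp primrec_evalBody)).pair Primrec.snd

theorem primrec_evalSnd : Primrec fun a : EvalArg => (a.1.unpair.2.unpair.2, a.2) :=
  (Primrec.snd.comp (Primrec.unpair.comp primrec_evalBody)).pair Primrec.snd

theorem primrec_evalPair : Primrec evalPair :=
  Primrec.list_cons.comp primrec_evalFst
    (Primrec.list_cons.comp primrec_evalSnd (Primrec.const []))

theorem primrec_termEvalSubs : Primrec termEvalSubs :=
  Primrec.ite (Primrec.eq.comp primrec_evalTag (Primrec.const 1)) primrec_evalPair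
    (Primrec.const [])

/-- The strict lift of a binary operation to partially defined values. -/
theorem primrec_option_map₂ {α β : Type*} [Primcodable α] [Primcodable β] {f : α → α → β}
    (hf : Primrec₂ f) :
    Primrec₂ fun x y : Option α => x.bind fun a => y.map fun b => f a b := by
  refine Primrec.option_bind Primrec.fst ?_
  refine Primrec.option_map (Primrec.snd.comp Primrec.fst) ?_
  exact hf.comp (Primrec.snd.comp Primrec.fst) Primrec.snd

theorem primrec_termEvalComb : Primrec₂ termEvalComb := by
  have htag : Primrec fun p : EvalArg × List (Option ℤ) => p.1.1.unpair.1 :=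
    primrec_evalTag.comp Primrec.fst
  have hbody : Primrec fun p : EvalArg × List (Option ℤ) => p.1.1.unpair.2 :=
    primrec_evalBody.comp Primrec.fst
  have hidx : Primrec fun p : EvalArg × List (Option ℤ) => p.1.1.unpair.2 / 2 :=
    Primrec.nat_div.comp hbody (Primrec.const 2)
  refine Primrec.ite (Primrec.eq.comp htag (Primrec.const 0)) ?_
    (Primrec.ite (Primrec.eq.comp htag (Primrec.const 1)) ?_ (Primrec.const none))
  · refine Primrec.ite (Primrec.eq.comp (Primrec.nat_mod.comp hbody (Primrec.const 2))
      (Primrec.const 0)) ?_ ?_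
    · exact Primrec.list_getElem?.comp
        (Primrec.fst.comp (Primrec.snd.comp Primrec.fst)) hidx
    · exact Primrec.list_getElem?.comp
        (Primrec.snd.comp (Primrec.snd.comp Primrec.fst)) hidx
  · exact (primrec_option_map₂ Primrec.int_add).comp
      ((Primrec.list_getD none).comp Primrec.snd (Primrec.const 0))
      ((Primrec.list_getD none).comp Primrec.snd (Primrec.const 1))

theorem computable_termEval : Computable termEval :=
  Computable.of_wellFounded_recursion termEvalSubs termEvalComb primrec_termEvalSubs.to_comp
    primrec_termEvalComb.to_comp Prod.fst termEvalSubs_lt (listRec_eq _ _ _ _)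

theorem primrec_sum_natAbs : Primrec fun l : List ℤ => (l.map Int.natAbs).sum := by
  have h1 : Primrec₂ fun (_ : List ℤ) (p : ℤ × ℕ) => p.1.natAbs + p.2 :=
    Primrec.nat_add.comp (Primrec.int_natAbs.comp (Primrec.fst.comp Primrec.snd))
      (Primrec.snd.comp Primrec.snd)
  refine (Primrec.list_foldr Primrec.id (Primrec.const 0) h1).of_eq fun l => ?_
  induction l with
  | nil => rfl
  | cons a l ih => simp_all

theorem primrec_evalBound : Primrec fun p : ℕ × List ℤ × List ℤ =>
    evalBound p.1 p.2.1 p.2.2 := by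
  have h1 : Primrec fun p : ℕ × List ℤ × List ℤ => zlevel p.1 := primrec_zlevel.comp Primrec.fst
  have h2 : Primrec fun p : ℕ × List ℤ × List ℤ => (zlevel p.1).factorial :=
    Primrec.nat_factorial.comp h1
  have h3 : Primrec fun p : ℕ × List ℤ × List ℤ =>
      (p.2.1.map Int.natAbs).sum + (p.2.2.map Int.natAbs).sum + 1 :=
    Primrec.succ.comp (Primrec.nat_add.comp
      (primrec_sum_natAbs.comp (Primrec.fst.comp Primrec.snd))
      (primrec_sum_natAbs.comp (Primrec.snd.comp Primrec.snd)))
  exact Primrec.nat_add.comp (Primrec.nat_mul.comp (Primrec.nat_mul.comp h2 h1) h3)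
    (Primrec.nat_mul.comp h2 h2)

theorem primrec_formulaEvalSubs : Primrec formulaEvalSubs := by
  have hB : Primrec fun a : EvalArg => evalBound a.1.unpair.2 a.2.1 a.2.2 :=
    primrec_evalBound.comp (primrec_evalBody.pair Primrec.snd)
  refine Primrec.ite (Primrec.eq.comp primrec_evalTag (Primrec.const 3)) primrec_evalPair
    (Primrec.ite (Primrec.eq.comp primrec_evalTag (Primrec.const 4)) ?_ (Primrec.const []))
  refine Primrec.list_map (Primrec.list_range.comp (Primrec.succ.comp
    (Primrec.nat_mul.comp (Primrec.const 2) hB))) ?_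
  have hB' : Primrec fun p : EvalArg × ℕ =>
      (p.2 : ℤ) - (evalBound p.1.1.unpair.2 p.1.2.1 p.1.2.2 : ℕ) :=
    Primrec.int_subNat.comp Primrec.snd (hB.comp Primrec.fst)
  have hxs : Primrec fun p : EvalArg × ℕ =>
      p.1.2.2 ++ [(p.2 : ℤ) - (evalBound p.1.1.unpair.2 p.1.2.1 p.1.2.2 : ℕ)] :=
    Primrec.list_append.comp (Primrec.snd.comp (Primrec.snd.comp Primrec.fst))
      (Primrec.list_cons.comp hB' (Primrec.const []))
  exact (primrec_evalBody.comp Primrec.fst).pair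
    ((Primrec.fst.comp (Primrec.snd.comp Primrec.fst)).pair hxs)

theorem primrec_optAnd : Primrec₂ optAnd := primrec_option_map₂ Primrec.and

theorem computable_ite_nat {α σ : Type*} [Primcodable α] [Primcodable σ] {t : α → ℕ} (j : ℕ)
    (ht : Primrec t) {f g : α → σ} (hf : Computable f) (hg : Computable g) :
    Computable fun a => if t a = j then f a else g a := by
  have h1 : Computable fun a => decide (t a = j) :=
    (Primrec.eq.comp ht (Primrec.const j)).decide.to_comp
  refine (Computable.cond h1 hf hg).of_eq fun a => ?_
  by_cases h : t a = j <;> simp [h]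

theorem computable_formulaEvalComb : Computable₂ formulaEvalComb := by
  have htag : Primrec fun p : EvalArg × List (Option Bool) => p.1.1.unpair.1 :=
    primrec_evalTag.comp Primrec.fst
  have hbody : Primrec fun p : EvalArg × List (Option Bool) => p.1.1.unpair.2 :=
    primrec_evalBody.comp Primrec.fst
  have ht1 : Computable fun p : EvalArg × List (Option Bool) =>
      termEval (p.1.1.unpair.2.unpair.1, p.1.2) :=
    computable_termEval.comp (primrec_evalFst.comp Primrec.fst).to_comp
  have ht2 : Computable fun p : EvalArg × List (Option Bool) =>
      termEval (p.1.1.unpair.2.unpair.2, p.1.2) :=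
    computable_termEval.comp (primrec_evalSnd.comp Primrec.fst).to_comp
  have hlt : Primrec₂ fun x y : ℤ => decide (x < y) := Primrec.int_lt.decide
  have heq : Primrec₂ fun x y : ℤ => decide (x = y) := Primrec.eq.decide
  have himp : Primrec₂ fun x y : Bool => !x || y :=
    Primrec.or.comp (Primrec.not.comp Primrec.fst) Primrec.snd
  have hall : Primrec fun p : EvalArg × List (Option Bool) =>
      p.2.foldr optAnd (some true) := by
    have h : Primrec₂ fun (_ : EvalArg × List (Option Bool)) (q : Option Bool × Option Bool) =>
        optAnd q.1 q.2 :=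
      primrec_optAnd.comp (Primrec.fst.comp Primrec.snd) (Primrec.snd.comp Primrec.snd)
    exact Primrec.list_foldr Primrec.snd (Primrec.const (some true)) h
  refine computable_ite_nat 0 htag
    (computable_ite_nat 0 hbody (Computable.const _) (Computable.const _)) ?_
  refine computable_ite_nat 1 htag ((primrec_option_map₂ heq).to_comp.comp ht1 ht2) ?_
  refine computable_ite_nat 2 htag ((primrec_option_map₂ hlt).to_comp.comp ht1 ht2) ?_
  refine computable_ite_nat 3 htag ((primrec_option_map₂ himp).comp
    ((Primrec.list_getD none).comp Primrec.snd (Primrec.const 0))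
    ((Primrec.list_getD none).comp Primrec.snd (Primrec.const 1))).to_comp ?_
  exact computable_ite_nat 4 htag hall.to_comp (Computable.const _)

theorem computable_formulaEval : Computable formulaEval :=
  Computable.of_wellFounded_recursion formulaEvalSubs formulaEvalComb
    primrec_formulaEvalSubs.to_comp computable_formulaEvalComb Prod.fst formulaEvalSubs_lt
    (listRec_eq _ _ _ _)

/-! ### Types of tuples whose quantifier-free information is computable -/

namespace IdealComputable

variable {S : Set (ℕ → Bool)} {α σ : Type*} [Primcodable α] [Primcodable σ]

theorem forall_fin (hS : IsTuringIdeal S) : ∀ {n : ℕ} {p : Fin n → α → Bool},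
    (∀ i, IdealComputable S (p i)) → IdealComputable S (fun a => decide (∀ i, p i a = true))
  | 0, p, _ => (of_primrec hS (Primrec.const true)).of_eq fun a => by simp
  | n + 1, p, h => by
    refine ((h 0).and hS (forall_fin hS (n := n) fun i => h i.succ)).of_eq fun a => ?_
    rw [Bool.eq_iff_iff]
    simp [Fin.forall_fin_succ]

theorem sum_fin (hS : IsTuringIdeal S) : ∀ {n : ℕ} {f : Fin n → α → ℤ},
    (∀ i, IdealComputable S (f i)) → IdealComputable S (fun a => ∑ i, f i a)
  | 0, f, _ => (of_primrec hS (Primrec.const 0)).of_eq fun a => by simp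
  | n + 1, f, h => by
    refine (comp₂ hS Primrec.int_add (h 0)
      (sum_fin hS (n := n) fun i => h i.succ)).of_eq fun a => ?_
    rw [Fin.sum_univ_succ]

theorem apply_fin (hS : IsTuringIdeal S) {n : ℕ} {f : α → Fin n → σ} (hf : IdealComputable S f)
    (i : Fin n) : IdealComputable S (fun a => f a i) :=
  comp₂ hS Primrec.fin_app hf (of_primrec hS (Primrec.const i))

end IdealComputable

theorem charFun_eq_true {A : Set ℕ} {n : ℕ} : charFun A n = true ↔ n ∈ A := by simp [charFun]

theorem exists_primrec_surjective {α : Type*} [Primcodable α] (a₀ : α) :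
    ∃ b : ℕ → α, Primrec b ∧ Function.Surjective b :=
  ⟨fun s => (Encodable.decode (α := α) s).getD a₀,
    Primrec.option_getD.comp Primrec.decode (Primrec.const a₀),
    fun a => ⟨Encodable.encode a, by simp⟩⟩

/-- The `i`-th coordinate of the `s`-th integer vector in the box `[-K, K]^n`. -/
def boxDigit (K s i : ℕ) : ℤ := (s / (2 * K + 1) ^ i % (2 * K + 1) : ℕ) - (K : ℕ)

theorem primrec_nat_pow : Primrec₂ fun a b : ℕ => a ^ b := by
  have h : Primrec₂ fun (p : ℕ × ℕ) (x : ℕ) => x * p.1 :=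
    Primrec.nat_mul.comp Primrec.snd (Primrec.fst.comp Primrec.fst)
  refine (Primrec.nat_iterate (f := fun p : ℕ × ℕ => p.2) (g := fun _ => 1) Primrec.snd
    (Primrec.const 1) h).of_eq fun p => ?_
  obtain ⟨a, b⟩ := p
  dsimp only
  induction b with
  | zero => rfl
  | succ b ih => rw [Function.iterate_succ_apply', ih, pow_succ]

theorem primrec_boxDigit : Primrec fun p : (ℕ × ℕ) × ℕ => boxDigit p.1.1 p.1.2 p.2 := by
  have h1 : Primrec fun p : (ℕ × ℕ) × ℕ => 2 * p.1.1 + 1 :=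
    Primrec.succ.comp (Primrec.nat_mul.comp (Primrec.const 2) (Primrec.fst.comp Primrec.fst))
  exact Primrec.int_subNat.comp
    (Primrec.nat_mod.comp (Primrec.nat_div.comp (Primrec.snd.comp Primrec.fst)
      (primrec_nat_pow.comp h1 Primrec.snd)) h1) (Primrec.fst.comp Primrec.fst)

theorem abs_boxDigit_le (K s i : ℕ) : |boxDigit K s i| ≤ K := by
  have := Nat.mod_lt (s / (2 * K + 1) ^ i) (show 0 < 2 * K + 1 by omega)
  unfold boxDigit
  rw [abs_le]; omega

/-- Digits in base `2 * K + 1`, shifted by `K`, replace quantification over a box of vectors by a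
bounded quantifier over one number. -/
theorem exists_boxDigit {n K : ℕ} (c : Fin n → ℤ) (hc : ∀ i, |c i| ≤ K) :
    ∃ s < (2 * K + 1) ^ n, ∀ i : Fin n, boxDigit K s i = c i := by
  have hlt : ∀ i, (c i + K).toNat < 2 * K + 1 := fun i => by
    have := abs_le.1 (hc i); omega
  let f : Fin n → Fin (2 * K + 1) := fun i => ⟨(c i + K).toNat, hlt i⟩
  refine ⟨finFunctionFinEquiv f, (finFunctionFinEquiv f).2, fun i => ?_⟩
  have h1 := congrFun (finFunctionFinEquiv.symm_apply_apply f) i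
  have h2 := congrArg Fin.val h1
  rw [finFunctionFinEquiv_symm_apply_val] at h2
  have := abs_le.1 (hc i)
  rw [boxDigit, h2]
  simp only [f]
  omega

section

variable {S : Set (ℕ → Bool)} {n : ℕ} {M : Type*} [AddCommGroup M] [LinearOrder M]
  [IsOrderedAddMonoid M] {e : M}

/-- The order relations and the residues of the tuple `a` are computable in members of `S`. -/
structure IsComputableTuple (S : Set (ℕ → Bool)) {n : ℕ} {M : Type*} [AddCommGroup M]
    [LinearOrder M] (e : M) (a : Fin n → M) : Prop where
  pos : IdealComputable S fun p : (Fin n → ℤ) × ℤ => decide (0 < zlin e a p.1 p.2)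
  residue : ∀ i, ∃ ρ : ℕ → ℤ, IdealComputable S ρ ∧
    ∀ N : ℕ, 0 < N → ZDvd (N : ℤ) (a i - ρ N • e)

/-- Being approximated by a given integer tuple is a bounded condition: finitely many signs, with
the constant term of the form stored as digit `n`, and one congruence for each coordinate. It is
decidable from the data of `IsComputableTuple`. -/
theorem zapprox_int_iff (he : IsDiscreteZGroup e) {a : Fin n → M} {ρ : Fin n → ℕ → ℤ}
    (hρ : ∀ i, ∀ N : ℕ, 0 < N → ZDvd (N : ℤ) (a i - ρ i N • e)) (K : ℕ) (b : Fin n → ℤ) :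
    ZApprox K e (1 : ℤ) a b ↔
      (∀ s < (2 * K + 1) ^ (n + 1),
        (0 < zlin e a (fun i : Fin n => boxDigit K s i) (boxDigit K s n) ↔
        0 < ∑ i : Fin n, boxDigit K s i * b i + boxDigit K s n)) ∧
      ∀ i, ((K.factorial : ℕ) : ℤ) ∣ b i - ρ i K.factorial := by
  have hf : (0 : ℤ) < K.factorial := by exact_mod_cast K.factorial_pos
  have hz : ∀ (c : Fin n → ℤ) (d : ℤ), zlin (1 : ℤ) b c d = ∑ i, c i * b i + d := by
    intro c d; simp [zlin]
  have hd : ∀ (N x r : ℤ), ZDvd N (x - r • (1 : ℤ)) ↔ N ∣ x - r := by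
    intro N x r
    rw [smul_eq_mul, mul_one]; rfl
  constructor
  · intro h
    refine ⟨fun s _ => ?_, fun i => ?_⟩
    · rw [← hz]
      exact h.pos_iff _ _ (fun i => abs_boxDigit_le _ _ _) (abs_boxDigit_le _ _ _)
    · exact (hd _ _ _).1 ((h.dvd_iff i _).1 (hρ i _ K.factorial_pos))
  · rintro ⟨h1, h2⟩
    refine ⟨fun c d hc hd' => ?_, fun i r => ?_⟩
    · obtain ⟨s, hs, hsc⟩ := exists_boxDigit (Fin.snoc c d : Fin (n + 1) → ℤ) (K := K) (by
        intro i
        refine Fin.lastCases ?_ (fun i => ?_) i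
        · simpa using hd'
        · simpa using hc i)
      have h3 : boxDigit K s n = d := by simpa using hsc (Fin.last n)
      have h4 : (fun i : Fin n => boxDigit K s i) = c := by
        funext i
        simpa using hsc i.castSucc
      have h5 := h1 s hs
      rw [h3, h4] at h5
      rw [h5, hz]
      have h6 : ∀ i : Fin n, boxDigit K s i = c i := fun i => congrFun h4 i
      simp only [h6]
    · rw [he.dvd_sub_iff hf (hρ i _ K.factorial_pos), hd]
      constructor
      · intro h3
        have := dvd_add (h2 i) h3
        rwa [sub_add_sub_cancel] at this
      · intro h3
        have := dvd_sub h3 (h2 i)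
        rwa [sub_sub_sub_cancel_left] at this

/-- Given a code, search for an integer tuple that approximates `a` to the precision of that code;
one exists by `exists_zapprox`. Then evaluate the code over `ℤ`, where the truth value is the same
by `ZApprox.realize_iff`. -/
theorem IsComputableTuple.idealComputable_codes (hS : IsTuringIdeal S)
    (he : IsDiscreteZGroup e) [prLanguage.Structure M] [IsPrStructure M] {a : Fin n → M}
    (h : IsComputableTuple S e a) : IdealComputable S (charFun
      {m | ∃ φ : prLanguage.Formula (Fin n), φ.Realize a ∧ prFormulaCode φ = m}) := by
  choose ρ hρ hρ' using h.residue
  obtain ⟨b, hb, hbs⟩ := exists_primrec_surjective (0 : Fin n → ℤ)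
  let K : ℕ → ℕ := zlevel
  have hbi : ∀ i, IdealComputable S fun p : ℕ × ℕ => b p.2 i := fun i =>
    IdealComputable.apply_fin hS (f := fun p : ℕ × ℕ => b p.2)
      (.of_primrec hS (hb.comp Primrec.snd)) i
  let cf : (ℕ × ℕ) × ℕ → (Fin n → ℤ) × ℤ := fun p =>
    (fun i => boxDigit (K p.1.1) p.2 i, boxDigit (K p.1.1) p.2 n)
  have hcf : Primrec cf := by
    have h1 : Primrec fun p : (ℕ × ℕ) × ℕ => (K p.1.1, p.2) :=
      (primrec_zlevel.comp (Primrec.fst.comp Primrec.fst)).pair Primrec.snd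
    refine Primrec.pair ?_ (primrec_boxDigit.comp (h1.pair (Primrec.const n)))
    refine Primrec.fin_curry.2 ?_
    exact primrec_boxDigit.comp ((h1.comp Primrec.fst).pair
      (Primrec.fin_val.comp Primrec.snd))
  have hleft : IdealComputable S fun p : (ℕ × ℕ) × ℕ =>
      decide (0 < zlin e a (cf p).1 (cf p).2) :=
    h.pos.comp hS (.of_primrec hS hcf)
  have hsum : IdealComputable S fun p : (ℕ × ℕ) × ℕ =>
      ∑ i : Fin n, boxDigit (K p.1.1) p.2 i * b p.1.2 i := by
    refine IdealComputable.sum_fin hS fun i => ?_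
    refine IdealComputable.comp₂ hS Primrec.int_mul ?_
      ((hbi i).comp hS (.of_primrec hS Primrec.fst))
    exact IdealComputable.apply_fin hS (f := fun p => (cf p).1)
      (.of_primrec hS (Primrec.fst.comp hcf)) i
  have hright : IdealComputable S fun p : (ℕ × ℕ) × ℕ =>
      decide (0 < ∑ i : Fin n, boxDigit (K p.1.1) p.2 i * b p.1.2 i + boxDigit (K p.1.1) p.2 n) :=
    IdealComputable.comp₂ hS (Primrec.int_lt.decide) (.of_primrec hS (Primrec.const 0))
      (IdealComputable.comp₂ hS Primrec.int_add hsum (.of_primrec hS (Primrec.snd.comp hcf)))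
  have hsigns : IdealComputable S fun p : ℕ × ℕ =>
      decide (∀ s < (2 * K p.1 + 1) ^ (n + 1),
        (decide (0 < zlin e a (fun i : Fin n => boxDigit (K p.1) s i) (boxDigit (K p.1) s n)) ==
        decide (0 < ∑ i : Fin n, boxDigit (K p.1) s i * b p.2 i + boxDigit (K p.1) s n)) =
          true) := by
    refine IdealComputable.ball hS (p := fun (p : ℕ × ℕ) (s : ℕ) =>
      decide (0 < zlin e a (fun i : Fin n => boxDigit (K p.1) s i) (boxDigit (K p.1) s n)) ==
        decide (0 < ∑ i : Fin n, boxDigit (K p.1) s i * b p.2 i + boxDigit (K p.1) s n))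
      (B := fun p => (2 * K p.1 + 1) ^ (n + 1)) ?_ ?_
    · exact IdealComputable.comp₂ hS Primrec.beq hleft hright
    · exact .of_primrec hS (primrec_nat_pow.comp (Primrec.succ.comp
        (Primrec.nat_mul.comp (Primrec.const 2) (primrec_zlevel.comp Primrec.fst)))
        (Primrec.const (n + 1)))
  have hres : IdealComputable S fun p : ℕ × ℕ => decide (∀ i,
      (decide (((K p.1).factorial : ℤ) ∣ b p.2 i - ρ i (K p.1).factorial)) = true) := by
    refine IdealComputable.forall_fin hS (p := fun i (p : ℕ × ℕ) =>
      decide (((K p.1).factorial : ℤ) ∣ b p.2 i - ρ i (K p.1).factorial)) fun i => ?_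
    have h1 : IdealComputable S fun p : ℕ × ℕ => (K p.1).factorial :=
      .of_primrec hS (Primrec.nat_factorial.comp (primrec_zlevel.comp Primrec.fst))
    exact IdealComputable.comp₂ hS Primrec.int_natCast_dvd.decide h1
      (IdealComputable.comp₂ hS Primrec.int_sub (hbi i) ((hρ i).comp hS h1))
  let test : ℕ → ℕ → Bool := fun m s =>
    decide (∀ j < (2 * K m + 1) ^ (n + 1),
      (decide (0 < zlin e a (fun i : Fin n => boxDigit (K m) j i) (boxDigit (K m) j n)) ==
        decide (0 < ∑ i : Fin n, boxDigit (K m) j i * b s i + boxDigit (K m) j n)) = true) &&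
      decide (∀ i, (decide (((K m).factorial : ℤ) ∣ b s i - ρ i (K m).factorial)) = true)
  have htest : IdealComputable S fun p : ℕ × ℕ => test p.1 p.2 := hsigns.and hS hres
  have htest_iff : ∀ m s, test m s = true ↔ ZApprox (K m) e (1 : ℤ) a (b s) := by
    intro m s
    rw [zapprox_int_iff he hρ']
    simp [test]
  have hex : ∀ m, ∃ s, test m s = true := by
    intro m
    obtain ⟨b', hb'⟩ := exists_zapprox he isDiscreteZGroup_int n (K m) a
    obtain ⟨s, rfl⟩ := hbs b'
    exact ⟨s, (htest_iff m s).2 hb'⟩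
  have hfind := IdealComputable.find hS htest hex
  have hspec : ∀ m, ZApprox (K m) e (1 : ℤ) a (b (Nat.find (hex m))) := fun m =>
    (htest_iff m _).1 (Nat.find_spec (hex m))
  set w : ℕ → ℕ := fun m => Nat.find (hex m)
  have harg : IdealComputable S fun m => ((m, List.ofFn (b (w m)), []) : EvalArg) := by
    have h1 : Primrec fun s => List.ofFn fun i => b s i :=
      Primrec.list_ofFn fun i => Primrec.fin_app.comp hb (Primrec.const i)
    exact (IdealComputable.of_primrec hS Primrec.id).pair hS
      (((IdealComputable.of_primrec hS h1).comp hS hfind).pair hS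
        (.of_primrec hS (Primrec.const [])))
  refine (IdealComputable.comp₂ hS Primrec.eq.decide
    ((IdealComputable.of_computable hS computable_formulaEval).comp hS harg)
    (.of_primrec hS (Primrec.const (some true)))).of_eq fun m => ?_
  have key : ∀ φ : prLanguage.Formula (Fin n), prFormulaCode φ = m →
      ∃ c, formulaEval (m, List.ofFn (b (w m)), []) = some c ∧ (c = true ↔ φ.Realize a) := by
    rintro φ rfl
    obtain ⟨c, hc, hc'⟩ := formulaEval_code φ (b (w (prFormulaCode φ))) default
    refine ⟨c, by simpa using hc, hc'.trans ?_⟩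
    refine (ZApprox.realize_iff he isDiscreteZGroup_int φ (v := a) (xs := default) ?_).symm
    have := hspec (prFormulaCode φ)
    refine ⟨fun c d hc hd => ?_, ?_⟩
    · simpa [zlin] using this.pos_iff (fun i => c (Sum.inl i)) d (fun i => hc _) hd
    · rintro (i | i)
      · exact this.dvd_iff i
      · exact i.elim0
  rw [Bool.eq_iff_iff, charFun_eq_true, decide_eq_true_eq, Set.mem_ofPred_eq]
  constructor
  · intro h
    obtain ⟨φ, hφ⟩ := exists_formula_of_formulaEval (b (w m)) m (Fin.elim0 : Fin 0 → ℤ)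
      (by simp [h])
    obtain ⟨c, hc, hc'⟩ := key φ hφ
    rw [h, Option.some_inj] at hc
    exact ⟨φ, hc'.1 hc.symm, hφ⟩
  · rintro ⟨φ, hφ, hm⟩
    obtain ⟨c, hc, hc'⟩ := key φ hm
    rw [hc, hc'.2 hφ]

end

/-! ### Lexicographically ordered vector spaces and their cuts -/

/-- Finitely supported real functions on a linear order, ordered lexicographically. -/
abbrev LexSpace (I : Type*) [LinearOrder I] : Type _ := Lex (I →₀ ℝ)

namespace LexSpace

section

variable {I : Type*} [LinearOrder I]

/-- The coefficient at a given index. -/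
def coeff (i : I) (h : LexSpace I) : ℝ := ofLex h i

/-- The function supported at one index. -/
noncomputable def mono (i : I) (r : ℝ) : LexSpace I := toLex (Finsupp.single i r)

@[simp] theorem coeff_zero (i : I) : coeff i (0 : LexSpace I) = 0 := rfl
@[simp] theorem coeff_add (i : I) (g h : LexSpace I) : coeff i (g + h) = coeff i g + coeff i h :=
  rfl
@[simp] theorem coeff_sub (i : I) (g h : LexSpace I) : coeff i (g - h) = coeff i g - coeff i h :=
  rfl
@[simp] theorem coeff_neg (i : I) (h : LexSpace I) : coeff i (-h) = -coeff i h := rfl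
@[simp] theorem coeff_smul (i : I) (q : ℚ) (h : LexSpace I) :
    coeff i (q • h) = (q : ℝ) * coeff i h := Rat.smul_def q _
@[simp] theorem coeff_zsmul (i : I) (k : ℤ) (h : LexSpace I) :
    coeff i (k • h) = (k : ℝ) * coeff i h := zsmul_eq_mul _ k
theorem coeff_mono (i j : I) (r : ℝ) : coeff j (mono i r) = if i = j then r else 0 :=
  Finsupp.single_apply
@[simp] theorem coeff_mono_self (i : I) (r : ℝ) : coeff i (mono i r) = r := by simp [coeff_mono]
theorem coeff_mono_of_ne {i j : I} (h : i ≠ j) (r : ℝ) : coeff j (mono i r) = 0 := by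
  simp [coeff_mono, h]

theorem ext_coeff {g h : LexSpace I} (H : ∀ i, coeff i g = coeff i h) : g = h :=
  ofLex.injective (Finsupp.ext H)

theorem pos_iff (h : LexSpace I) :
    0 < h ↔ ∃ i, (∀ j < i, coeff j h = 0) ∧ 0 < coeff i h := by
  rw [Finsupp.Lex.lt_iff]
  constructor <;> rintro ⟨i, h1, h2⟩ <;> exact ⟨i, fun j hj => (h1 j hj).symm, h2⟩

/-- The index `i` carries the leading coefficient of `h`. -/
def Lead (i : I) (h : LexSpace I) : Prop := (∀ j < i, coeff j h = 0) ∧ coeff i h ≠ 0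

theorem Lead.neg {i : I} {h : LexSpace I} (H : Lead i h) : Lead i (-h) :=
  ⟨fun j hj => by simp [H.1 j hj], by simpa using H.2⟩

theorem Lead.unique {i j : I} {h : LexSpace I} (hi : Lead i h) (hj : Lead j h) : i = j := by
  rcases lt_trichotomy i j with hlt | rfl | hlt
  · exact absurd (hj.1 i hlt) hi.2
  · rfl
  · exact absurd (hi.1 j hlt) hj.2

theorem exists_lead {h : LexSpace I} (H : h ≠ 0) : ∃ i, Lead i h := by
  rcases lt_or_gt_of_ne H with hlt | hgt
  · obtain ⟨i, h1, h2⟩ := (pos_iff (-h)).1 (neg_pos.2 hlt)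
    rw [coeff_neg] at h2
    exact ⟨i, fun j hj => by simpa using h1 j hj, by linarith⟩
  · obtain ⟨i, h1, h2⟩ := (pos_iff h).1 hgt
    exact ⟨i, h1, h2.ne'⟩

theorem Lead.pos_iff {i : I} {h : LexSpace I} (H : Lead i h) : 0 < h ↔ 0 < coeff i h := by
  rw [LexSpace.pos_iff]
  constructor
  · rintro ⟨j, h1, h2⟩
    rwa [H.unique (⟨h1, h2.ne'⟩ : Lead j h)]
  · exact fun h2 => ⟨i, H.1, h2⟩

theorem lt_of_coeff_lt {i : I} {g h : LexSpace I} (h1 : ∀ j < i, coeff j g = coeff j h)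
    (h2 : coeff i g < coeff i h) : g < h := by
  rw [← sub_pos, LexSpace.pos_iff]
  exact ⟨i, fun j hj => by simp [h1 j hj], by simpa using h2⟩

theorem lt_of_lead_lt {i j : I} {g h : LexSpace I} (hh : Lead j h) (hpos : 0 < h)
    (hg : ∀ l < i, coeff l g = 0) (hij : j < i) : g < h :=
  lt_of_coeff_lt (i := j) (fun l hl => by rw [hg l (hl.trans hij), hh.1 l hl])
    (by rw [hg j hij]; exact hh.pos_iff.1 hpos)

end

/-! ### Cuts of rational subspaces of finite support. -/

section Cut

variable {Γ : Type*} [LinearOrder Γ]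

/-- The element `w + ρ t^γ` realizes the cut `L` of `W`, already at index `γ`. -/
def CutRealized (W : Submodule ℚ (LexSpace (WithTop Γ))) (L : Set (LexSpace (WithTop Γ))) (γ : Γ)
    (ρ : ℝ) (w : LexSpace (WithTop Γ)) : Prop :=
  ∀ u ∈ W, ∃ δ ≤ (γ : WithTop Γ), Lead δ (w + mono (γ : WithTop Γ) ρ - u) ∧
    (u ∈ L ↔ 0 < coeff δ (w + mono (γ : WithTop Γ) ρ - u))

/-- The coefficient `ρ` is trivial or can be approximated by means of the cut `L`. -/
def CutApprox (W : Submodule ℚ (LexSpace (WithTop Γ))) (L : Set (LexSpace (WithTop Γ))) (γ : Γ)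
    (ρ : ℝ) (w : LexSpace (WithTop Γ)) : Prop :=
  (ρ = 1 ∨ ρ = -1) ∨ ∃ u₁ ∈ W, ∃ ε : ℤ, (ε = 1 ∨ ε = -1) ∧ 0 < coeff (γ : WithTop Γ) u₁ ∧
    ∀ k : ℕ, 0 < k →
      (∃ m : ℕ, ¬(w + ((ε * m : ℤ) / k : ℚ) • u₁ ∈ L ↔
        w + ((ε * (m + 1) : ℤ) / k : ℚ) • u₁ ∈ L)) ∧
      ∀ m : ℕ, ¬(w + ((ε * m : ℤ) / k : ℚ) • u₁ ∈ L ↔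
        w + ((ε * (m + 1) : ℤ) / k : ℚ) • u₁ ∈ L) →
        |m * coeff (γ : WithTop Γ) u₁ - k * (ε * ρ)| ≤ coeff (γ : WithTop Γ) u₁

open Classical in
/-- The indices with respect to which the cut `L` is infinitely close to `w`. -/
noncomputable def closeIndices (W : Submodule ℚ (LexSpace (WithTop Γ)))
    (L : Set (LexSpace (WithTop Γ))) (Λ : Finset (WithTop Γ)) (w : LexSpace (WithTop Γ)) :
    Finset (WithTop Γ) :=
  Λ.filter fun γ => ∀ u ∈ W, 0 < u → Lead γ u → w - u ∈ L ∧ w + u ∉ L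

variable [DenselyOrdered Γ] [NoMinOrder Γ] [NoMaxOrder Γ] [Nonempty Γ]

/-- Density and the absence of endpoints produce the index; excluding `⊤` from the lower set is what
allows it to lie in `Γ` itself. -/
theorem exists_between_withTop (lo hi : Finset (WithTop Γ)) (hlo : ⊤ ∉ lo)
    (h : ∀ x ∈ lo, ∀ y ∈ hi, x < y) :
    ∃ m : Γ, (∀ x ∈ lo, x < (m : WithTop Γ)) ∧ ∀ y ∈ hi, (m : WithTop Γ) < y := by
  classical
  obtain ⟨m, h1, h2⟩ := Order.exists_between_finsets (α := Γ)
    (lo.preimage (fun x : Γ => (x : WithTop Γ)) (WithTop.coe_injective.injOn))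
    (hi.preimage (fun x : Γ => (x : WithTop Γ)) (WithTop.coe_injective.injOn))
    (fun x hx y hy => WithTop.coe_lt_coe.1
      (h _ (Finset.mem_preimage.1 hx) _ (Finset.mem_preimage.1 hy)))
  refine ⟨m, fun x hx => ?_, fun y hy => ?_⟩
  · cases x with
    | top => exact absurd hx hlo
    | coe x => exact WithTop.coe_lt_coe.2 (h1 x (Finset.mem_preimage.2 hx))
  · cases y with
    | top => exact WithTop.coe_lt_top m
    | coe y => exact WithTop.coe_lt_coe.2 (h2 y (Finset.mem_preimage.2 hy))

/-- The element `w`, which is as close to the cut as `W` permits, is continued by one further term.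
If positive elements of `W` with the same leading index `γ` fall on both sides of the cut when added
to `w`, the new coefficient is the supremum of the `γ`-coefficients that stay below. Otherwise each
index lies entirely on one side, and a new index fits between the two groups. -/
theorem exists_cutRealized_of_mem (W : Submodule ℚ (LexSpace (WithTop Γ)))
    (L : Set (LexSpace (WithTop Γ))) (Λ : Finset (WithTop Γ))
    (hΛ : ∀ u ∈ W, ∀ γ, coeff γ u ≠ 0 → γ ∈ Λ)
    (hL : ∀ u ∈ W, ∀ v ∈ W, u ≤ v → v ∈ L → u ∈ L)
    (htop : ∀ w ∈ W, ∀ u ∈ W, Lead ⊤ u → w ∈ L → w + u ∈ L)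
    {w : LexSpace (WithTop Γ)} (hw : w ∈ W) (hwL : w ∈ L)
    (hmax : ∀ w' ∈ W, ¬ closeIndices W L Λ w ⊂ closeIndices W L Λ w') :
    ∃ (γ : Γ) (ρ : ℝ), CutRealized W L γ ρ w ∧ CutApprox W L γ ρ w := by
  classical
  by_cases hB : ∃ γ : WithTop Γ, ∃ u₁ ∈ W, ∃ u₂ ∈ W, 0 < u₁ ∧ 0 < u₂ ∧ Lead γ u₁ ∧ Lead γ u₂ ∧
      w + u₁ ∈ L ∧ w + u₂ ∉ L
  · -- the cut has the magnitude of an element of `W`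
    obtain ⟨γ', u₁, hu₁, u₂, hu₂, hpos₁, hpos₂, hlead₁, hlead₂, hL₁, hL₂⟩ := hB
    cases γ' with
    | top => exact absurd (htop w hw u₂ hu₂ hlead₂ hwL) hL₂
    | coe γ =>
    set s := coeff (γ : WithTop Γ) u₁ with hs
    have hs0 : 0 < s := hlead₁.pos_iff.1 hpos₁
    let A : Set ℝ := {r | ∃ u ∈ W, (∀ j < (γ : WithTop Γ), coeff j u = 0) ∧ w + u ∈ L ∧
      coeff (γ : WithTop Γ) u = r}
    have hA₁ : s ∈ A := ⟨u₁, hu₁, hlead₁.1, hL₁, rfl⟩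
    have hA₂ : BddAbove A := by
      refine ⟨coeff (γ : WithTop Γ) u₂, ?_⟩
      rintro _ ⟨u, hu, hu0, huL, rfl⟩
      by_contra hlt
      push Not at hlt
      have h1 : u₂ < u := lt_of_coeff_lt (fun j hj => by rw [hu0 j hj, hlead₂.1 j hj]) hlt
      exact hL₂ (hL _ (W.add_mem hw hu₂) _ (W.add_mem hw hu) (add_le_add_right h1.le w) huL)
    set ρ := sSup A with hρ
    have hlow : ∀ u ∈ W, (∀ j < (γ : WithTop Γ), coeff j u = 0) → coeff (γ : WithTop Γ) u < ρ →
        w + u ∈ L := by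
      intro u hu hu0 hlt
      obtain ⟨_, ⟨v, hv, hv0, hvL, rfl⟩, hlt'⟩ := exists_lt_of_lt_csSup ⟨s, hA₁⟩ hlt
      have h1 : u < v := lt_of_coeff_lt (fun j hj => by rw [hu0 j hj, hv0 j hj]) hlt'
      exact hL _ (W.add_mem hw hu) _ (W.add_mem hw hv) (add_le_add_right h1.le w) hvL
    have hupp : ∀ u ∈ W, (∀ j < (γ : WithTop Γ), coeff j u = 0) → ρ < coeff (γ : WithTop Γ) u →
        w + u ∉ L := fun u hu hu0 hlt huL =>
      absurd (le_csSup hA₂ ⟨u, hu, hu0, huL, rfl⟩) (not_le.2 hlt)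
    have hρ0 : 0 < ρ := hs0.trans_le (le_csSup hA₂ hA₁)
    refine ⟨γ, ρ, fun u hu => ?_, Or.inr ⟨u₁, hu₁, 1, Or.inl rfl, hs0, fun k hk => ?_⟩⟩
    · -- the cut is realized
      have hy : u - w ∈ W := W.sub_mem hu hw
      have hwu : w + (u - w) = u := by abel
      by_cases hy0 : ∀ j < (γ : WithTop Γ), coeff j (u - w) = 0
      -- If `u - w` attained the supremum, `u` would be strictly closer to the cut than `w`: `γ` is
      -- close for `u` but not for `w`, and close indices of `w` that lead positive elements of `W`
      -- lie below `γ` and stay close for `u`.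
      · have hne : coeff (γ : WithTop Γ) (u - w) ≠ ρ := by
          intro heq
          refine hmax (w + (u - w)) (W.add_mem hw hy) ?_
          rw [Finset.ssubset_iff_of_subset]
          · refine ⟨(γ : WithTop Γ), ?_, ?_⟩
            · refine Finset.mem_filter.2 ⟨hΛ u₁ hu₁ _ hs0.ne', fun z hz hz0 hzl => ?_⟩
              have hzc := hzl.pos_iff.1 hz0
              have e1 : w + (u - w) - z = w + ((u - w) - z) := by abel
              have e2 : w + (u - w) + z = w + ((u - w) + z) := by abel
              rw [e1, e2]
              refine ⟨hlow _ (W.sub_mem hy hz) (fun j hj => ?_) ?_,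
                hupp _ (W.add_mem hy hz) (fun j hj => ?_) ?_⟩
              · rw [coeff_sub, hy0 j hj, hzl.1 j hj, sub_zero]
              · rw [coeff_sub, heq]; linarith
              · rw [coeff_add, hy0 j hj, hzl.1 j hj, add_zero]
              · rw [coeff_add, heq]; linarith
            · intro hmem
              exact ((Finset.mem_filter.1 hmem).2 u₁ hu₁ hpos₁ hlead₁).2 hL₁
          · intro γ' hγ'
            rw [closeIndices, Finset.mem_filter] at hγ' ⊢
            refine ⟨hγ'.1, fun z hz hz0 hzl => ?_⟩
            obtain ⟨hz1, hz2⟩ := hγ'.2 z hz hz0 hzl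
            have hlt : γ' < (γ : WithTop Γ) := by
              rcases lt_trichotomy γ' (γ : WithTop Γ) with h | h | h
              · exact h
              · subst h
                exact absurd hL₁ (hγ'.2 u₁ hu₁ hpos₁ hlead₁).2
              · have h1 : z < u₁ := lt_of_lead_lt hlead₁ hpos₁ hzl.1 h
                exact absurd (hL _ (W.add_mem hw hz) _ (W.add_mem hw hu₁)
                  (add_le_add_right h1.le w) hL₁) hz2
            have hylt : u - w < z := lt_of_lead_lt hzl hz0 hy0 hlt
            have hypos : 0 < u - w := by
              rw [LexSpace.pos_iff]
              exact ⟨_, hy0, by rw [heq]; exact hρ0⟩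
            refine ⟨hL _ (W.sub_mem (W.add_mem hw hy) hz) w hw ?_ hwL, fun hcon => hz2 ?_⟩
            · have h2 : w + (u - w) ≤ w + z := add_le_add_right hylt.le w
              exact sub_le_iff_le_add.2 h2
            · refine hL _ (W.add_mem hw hz) _ (W.add_mem (W.add_mem hw hy) hz) ?_ hcon
              exact add_le_add_left (le_add_of_nonneg_right hypos.le) z
        have hc : coeff (γ : WithTop Γ) (w + mono (γ : WithTop Γ) ρ - u) =
            ρ - coeff (γ : WithTop Γ) (u - w) := by
          simp only [coeff_sub, coeff_add, coeff_mono_self]; ring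
        refine ⟨γ, le_rfl, ⟨fun j hj => ?_, ?_⟩, ?_⟩
        · have := hy0 j hj
          rw [coeff_sub] at this
          rw [coeff_sub, coeff_add, coeff_mono_of_ne hj.ne']
          linarith
        · rw [hc]; exact sub_ne_zero.2 hne.symm
        · rw [hc, sub_pos]
          rcases lt_or_gt_of_ne hne with h | h
          · exact iff_of_true (hwu ▸ hlow _ hy hy0 h) h
          · exact iff_of_false (hwu ▸ hupp _ hy hy0 h) h.not_gt
      · have hyne : u - w ≠ 0 := fun h => hy0 (by simp [h])
        obtain ⟨δ, hδ⟩ := exists_lead hyne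
        have hδγ : δ < (γ : WithTop Γ) := by
          by_contra hle
          push Not at hle
          exact hy0 fun j hj => hδ.1 j (hj.trans_le hle)
        have hc : ∀ j < (γ : WithTop Γ), coeff j (w + mono (γ : WithTop Γ) ρ - u) =
            -coeff j (u - w) := by
          intro j hj
          simp only [coeff_sub, coeff_add, coeff_mono_of_ne hj.ne']; ring
        refine ⟨δ, hδγ.le, ⟨fun j hj => ?_, ?_⟩, ?_⟩
        · rw [hc j (hj.trans hδγ), hδ.1 j hj, neg_zero]
        · rw [hc δ hδγ]; exact neg_ne_zero.2 hδ.2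
        · rw [hc δ hδγ]
          rcases lt_or_gt_of_ne hyne with h | h
          · have h1 := hδ.neg.pos_iff.1 (neg_pos.2 h)
            rw [coeff_neg] at h1
            exact iff_of_true (hL _ hu _ hw (sub_nonpos.1 h.le) hwL) h1
          · have h1 := hδ.pos_iff.1 h
            refine iff_of_false (fun huL => hL₂ ?_) (by linarith)
            have h2 : u₂ < u - w := lt_of_lead_lt hδ h hlead₂.1 hδγ
            exact hL _ (W.add_mem hw hu₂) _ hu
              (by have := add_le_add_right h2.le w; rwa [hwu] at this) huL
    · -- the approximations
      have hk' : (0 : ℝ) < k := by exact_mod_cast hk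
      have hmem : ∀ q : ℚ, q • u₁ ∈ W := fun q => W.smul_mem q hu₁
      have hvan : ∀ q : ℚ, ∀ j < (γ : WithTop Γ), coeff j (q • u₁) = 0 := fun q j hj => by
        rw [coeff_smul, hlead₁.1 j hj, mul_zero]
      have hcq : ∀ m : ℤ, coeff (γ : WithTop Γ) (((m : ℚ) / k) • u₁) = m * s / k := by
        intro m
        rw [coeff_smul]
        push_cast
        ring
      have hlow' : ∀ m : ℤ, m * s < k * ρ → w + ((m : ℚ) / k) • u₁ ∈ L := fun m hm =>
        hlow _ (hmem _) (hvan _) (by rw [hcq, div_lt_iff₀ hk']; linarith)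
      have hupp' : ∀ m : ℤ, k * ρ < m * s → w + ((m : ℚ) / k) • u₁ ∉ L := fun m hm =>
        hupp _ (hmem _) (hvan _) (by rw [hcq, lt_div_iff₀ hk']; linarith)
      constructor
      -- The sequence starts at `w ∈ L` and leaves `L` once `m * s` exceeds `k * ρ`; the least index
      -- outside `L` gives a change of side.
      · have hex : ∃ m : ℕ, w + (((m : ℤ) : ℚ) / k) • u₁ ∉ L := by
          obtain ⟨m, hm⟩ := exists_nat_gt (k * ρ / s)
          exact ⟨m, hupp' m (by rw [div_lt_iff₀ hs0] at hm; exact_mod_cast hm)⟩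
        have h0 : Nat.find hex ≠ 0 := by
          intro h0
          have := Nat.find_spec hex
          rw [h0] at this
          apply this
          simpa using hwL
        obtain ⟨m, hm⟩ := Nat.exists_eq_succ_of_ne_zero h0
        refine ⟨m, fun hiff => ?_⟩
        have h1 := Nat.find_min hex (m := m) (by omega)
        have h2 := Nat.find_spec hex
        rw [hm] at h2
        rw [not_not] at h1
        apply h2
        have h3 := hiff.1 (by simpa using h1)
        simpa using h3
      -- A change of side between `m` and `m + 1` traps `k * ρ` between `m * s` and `(m + 1) * s`.
      · intro m hm
        have e1 : ((1 * m : ℤ) : ℚ) = ((m : ℤ) : ℚ) := by rw [one_mul]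
        have e2 : ((1 * (m + 1) : ℤ) : ℚ) = ((m + 1 : ℤ) : ℚ) := by rw [one_mul]
        rw [e1, e2] at hm
        have h1 : ¬ (((m : ℤ) : ℝ) * s > k * ρ) := by
          intro h
          refine hm (iff_of_false (hupp' _ h) (hupp' _ ?_))
          push_cast at h ⊢
          nlinarith
        have h2 : ¬ (((m + 1 : ℤ) : ℝ) * s < k * ρ) := by
          intro h
          refine hm (iff_of_true (hlow' _ ?_) (hlow' _ h))
          push_cast at h ⊢
          nlinarith
        push_cast at h1 h2 ⊢
        rw [one_mul, abs_le]
        constructor <;> linarith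
  · -- the cut is of a new magnitude
    push Not at hB
    -- Magnitudes that overshoot the cut from `w` go to `lo`, those that fall short go to `hi`.
    -- Larger magnitudes have smaller indices, and no index is in both sets, so `lo` lies to the
    -- left of `hi`.
    let lo := Λ.filter fun γ => ∃ u ∈ W, 0 < u ∧ Lead γ u ∧ w + u ∉ L
    let hi := Λ.filter fun γ => ∃ u ∈ W, 0 < u ∧ Lead γ u ∧ w + u ∈ L
    obtain ⟨γ, hγlo, hγhi⟩ := exists_between_withTop lo hi (by
        intro h
        obtain ⟨u, hu, -, hul, huL⟩ := (Finset.mem_filter.1 h).2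
        exact huL (htop w hw u hu hul hwL)) (by
      intro x hx y hy
      obtain ⟨u, hu, hu0, hul, huL⟩ := (Finset.mem_filter.1 hx).2
      obtain ⟨v, hv, hv0, hvl, hvL⟩ := (Finset.mem_filter.1 hy).2
      by_contra hle
      push Not at hle
      rcases hle.lt_or_eq with h | rfl
      · have h1 : u < v := lt_of_lead_lt hvl hv0 hul.1 h
        exact huL (hL _ (W.add_mem hw hu) _ (W.add_mem hw hv) (add_le_add_right h1.le w) hvL)
      · exact huL (hB _ v hv u hu hv0 hu0 hvl hul hvL))
    refine ⟨γ, 1, fun u hu => ?_, Or.inl (Or.inl rfl)⟩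
    have hy : u - w ∈ W := W.sub_mem hu hw
    have hwu : w + (u - w) = u := by abel
    have hc : ∀ j ≠ (γ : WithTop Γ), coeff j (w + mono (γ : WithTop Γ) 1 - u) =
        -coeff j (u - w) := by
      intro j hj
      simp only [coeff_sub, coeff_add, coeff_mono_of_ne hj.symm]; ring
    have hcγ : coeff (γ : WithTop Γ) (w + mono (γ : WithTop Γ) 1 - u) =
        1 - coeff (γ : WithTop Γ) (u - w) := by
      simp only [coeff_sub, coeff_add, coeff_mono_self]; ring
    by_cases hyne : u - w = 0
    · have h0 : ∀ j, coeff j (u - w) = 0 := fun j => by rw [hyne, coeff_zero]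
      refine ⟨γ, le_rfl, ⟨fun j hj => by rw [hc j hj.ne, h0, neg_zero], ?_⟩, ?_⟩
      · rw [hcγ, h0]; norm_num
      · rw [hcγ, h0, sub_eq_zero.1 hyne]
        exact iff_of_true hwL (by norm_num)
    obtain ⟨δ, hδ⟩ := exists_lead hyne
    have hδΛ : δ ∈ Λ := hΛ _ hy _ hδ.2
    have hδγ : δ ∈ lo ∨ δ ∈ hi := by
      rcases lt_or_gt_of_ne hyne with h | h
      · by_cases hm : w + -(u - w) ∈ L
        · exact Or.inr (Finset.mem_filter.2 ⟨hδΛ, _, W.neg_mem hy, neg_pos.2 h, hδ.neg, hm⟩)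
        · exact Or.inl (Finset.mem_filter.2 ⟨hδΛ, _, W.neg_mem hy, neg_pos.2 h, hδ.neg, hm⟩)
      · by_cases hm : w + (u - w) ∈ L
        · exact Or.inr (Finset.mem_filter.2 ⟨hδΛ, _, hy, h, hδ, hm⟩)
        · exact Or.inl (Finset.mem_filter.2 ⟨hδΛ, _, hy, h, hδ, hm⟩)
    have hsmall : δ < (γ : WithTop Γ) → Lead δ (w + mono (γ : WithTop Γ) 1 - u) ∧
        coeff δ (w + mono (γ : WithTop Γ) 1 - u) = -coeff δ (u - w) := fun h =>
      ⟨⟨fun j hj => by rw [hc j (hj.trans h).ne, hδ.1 j hj, neg_zero], by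
        rw [hc δ h.ne]; exact neg_ne_zero.2 hδ.2⟩, hc δ h.ne⟩
    have hbig : (γ : WithTop Γ) < δ → Lead (γ : WithTop Γ) (w + mono (γ : WithTop Γ) 1 - u) ∧
        coeff (γ : WithTop Γ) (w + mono (γ : WithTop Γ) 1 - u) = 1 := fun h => by
      have h1 : coeff (γ : WithTop Γ) (w + mono (γ : WithTop Γ) 1 - u) = 1 := by
        rw [hcγ, hδ.1 _ h, sub_zero]
      exact ⟨⟨fun j hj => by rw [hc j hj.ne, hδ.1 j (hj.trans h), neg_zero], by
        rw [h1]; norm_num⟩, h1⟩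
    rcases lt_or_gt_of_ne hyne with h | h
    · have huL : u ∈ L := hL _ hu _ hw (sub_nonpos.1 h.le) hwL
      have h1 := hδ.neg.pos_iff.1 (neg_pos.2 h)
      rw [coeff_neg] at h1
      rcases hδγ with hd | hd
      · obtain ⟨h2, h3⟩ := hsmall (hγlo _ hd)
        exact ⟨δ, (hγlo _ hd).le, h2, iff_of_true huL (by rw [h3]; exact h1)⟩
      · obtain ⟨h2, h3⟩ := hbig (hγhi _ hd)
        exact ⟨γ, le_rfl, h2, iff_of_true huL (by rw [h3]; norm_num)⟩
    · have h1 := hδ.pos_iff.1 h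
      by_cases huL : u ∈ L
      · have hd : δ ∈ hi := Finset.mem_filter.2 ⟨hδΛ, _, hy, h, hδ, by rwa [hwu]⟩
        obtain ⟨h2, h3⟩ := hbig (hγhi _ hd)
        exact ⟨γ, le_rfl, h2, iff_of_true huL (by rw [h3]; norm_num)⟩
      · have hd : δ ∈ lo := Finset.mem_filter.2 ⟨hδΛ, _, hy, h, hδ, by rwa [hwu]⟩
        obtain ⟨h2, h3⟩ := hsmall (hγlo _ hd)
        exact ⟨δ, (hγlo _ hd).le, h2, iff_of_false huL (by rw [h3]; linarith)⟩

/-- Every cut of a subspace of finite support that is not located at a standard distance of an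
element is realized, by an element whose new coefficient can be approximated from the cut. -/
theorem exists_cutRealized (W : Submodule ℚ (LexSpace (WithTop Γ)))
    (L : Set (LexSpace (WithTop Γ))) (Λ : Finset (WithTop Γ))
    (hΛ : ∀ u ∈ W, ∀ γ, coeff γ u ≠ 0 → γ ∈ Λ)
    (hL : ∀ u ∈ W, ∀ v ∈ W, u ≤ v → v ∈ L → u ∈ L)
    (htop : ∀ w ∈ W, ∀ u ∈ W, Lead ⊤ u → w ∈ L → w + u ∈ L) :
    ∃ w ∈ W, ∃ (γ : Γ) (ρ : ℝ), CutRealized W L γ ρ w ∧ CutApprox W L γ ρ w := by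
  classical
  obtain ⟨w, hw, hmax⟩ : ∃ w ∈ W, ∀ w' ∈ W, ¬ closeIndices W L Λ w ⊂ closeIndices W L Λ w' := by
    have hfin : (Set.range fun w : W => closeIndices W L Λ w).Finite :=
      (Λ.powerset.finite_toSet).subset (by
        rintro _ ⟨w, rfl⟩
        exact Finset.mem_coe.2 (Finset.mem_powerset.2 (Finset.filter_subset _ _)))
    obtain ⟨D, hD⟩ := hfin.exists_maximal ⟨_, ⟨(0 : W), rfl⟩⟩
    obtain ⟨⟨w, hw⟩, rfl⟩ := hD.prop
    exact ⟨w, hw, fun w' hw' hlt => hlt.not_ge (hD.le_of_ge ⟨⟨w', hw'⟩, rfl⟩ hlt.le)⟩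
  by_cases hwL : w ∈ L
  · exact ⟨w, hw, exists_cutRealized_of_mem W L Λ hΛ hL htop hw hwL hmax⟩
  -- If `w` is above the cut, reflect: negation exchanges the two sides and preserves the close
  -- indices. The sign `ε` and the value `-1` in `CutApprox` account for this reflection.
  let L' : Set (LexSpace (WithTop Γ)) := {u | -u ∉ L}
  have hclose : ∀ v, closeIndices W L' Λ (-v) = closeIndices W L Λ v := by
    intro v
    refine Finset.filter_congr fun γ _ => ?_
    refine forall₄_congr fun u _ _ _ => ?_
    have e1 : -(-v - u) = v + u := by abel
    have e2 : -(-v + u) = v - u := by abel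
    change -(-v - u) ∉ L ∧ ¬ (-(-v + u) ∉ L) ↔ _
    rw [e1, e2, not_not, and_comm]
  obtain ⟨γ, ρ, h1, h2⟩ := exists_cutRealized_of_mem W L' Λ hΛ
    (fun u hu v hv huv hvL huL => hvL (hL _ (W.neg_mem hv) _ (W.neg_mem hu) (neg_le_neg huv) huL))
    (fun v hv u hu hlead hvL hcon => hvL (by
      have := htop _ (W.neg_mem (W.add_mem hv hu)) u hu hlead hcon
      convert this using 1; abel))
    (W.neg_mem hw) (w := -w) (by change - -w ∉ L; rwa [neg_neg]) (fun w' hw' => by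
      have := hmax (-w') (W.neg_mem hw')
      rwa [← hclose, ← hclose, neg_neg] at this)
  have hmono : mono (γ : WithTop Γ) (-ρ) = -mono (γ : WithTop Γ) ρ :=
    ext_coeff fun i => by simp only [coeff_mono, coeff_neg]; split_ifs <;> simp
  refine ⟨w, hw, γ, -ρ, fun u hu => ?_, ?_⟩
  · obtain ⟨δ, hδ, hlead, hiff⟩ := h1 (-u) (W.neg_mem hu)
    have e : w + mono (γ : WithTop Γ) (-ρ) - u = -(-w + mono (γ : WithTop Γ) ρ - -u) := by
      rw [hmono]; abel
    refine ⟨δ, hδ, by rw [e]; exact hlead.neg, ?_⟩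
    have h3 : -u ∈ L' ↔ u ∉ L := by change - -u ∉ L ↔ u ∉ L; rw [neg_neg]
    rw [h3] at hiff
    rw [e, coeff_neg, ← not_iff_not, hiff]
    have := hlead.2
    constructor
    · intro h; linarith
    · intro h; exact lt_of_le_of_ne (by linarith) this.symm
  · rcases h2 with (rfl | rfl) | ⟨u₁, hu₁, ε, hε, hs, H⟩
    · exact Or.inl (Or.inr rfl)
    · exact Or.inl (Or.inl (by norm_num))
    · refine Or.inr ⟨u₁, hu₁, -ε, ?_, hs, fun k hk => ?_⟩
      · rcases hε with rfl | rfl <;> simp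
      have key : ∀ m : ℤ, w + (((-ε * m : ℤ) : ℚ) / k) • u₁ ∈ L ↔
          ¬ (-w + (((ε * m : ℤ) : ℚ) / k) • u₁ ∈ L') := by
        intro m
        change _ ↔ ¬ (-(-w + (((ε * m : ℤ) : ℚ) / k) • u₁) ∉ L)
        have e : -(-w + (((ε * m : ℤ) : ℚ) / k) • u₁) = w + (((-ε * m : ℤ) : ℚ) / k) • u₁ :=
          ext_coeff fun i => by
            simp only [coeff_neg, coeff_add, coeff_smul]; push_cast; ring
        rw [not_not, e]
      obtain ⟨⟨m, hm⟩, h4⟩ := H k hk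
      refine ⟨⟨m, ?_⟩, fun m hm => ?_⟩
      · rw [key, key, not_iff_not]; exact hm
      · rw [key, key, not_iff_not] at hm
        have := h4 m hm
        push_cast
        rwa [neg_mul_neg]

end Cut

end LexSpace

/-! ### Reals with an approximation in a Turing ideal -/

/-- The real `r` has an almost linear approximation `k ↦ f k` of `k r` that is computable in a
member of `S`. -/
def IsIdealReal (S : Set (ℕ → Bool)) (r : ℝ) : Prop :=
  ∃ f : ℕ → ℤ, IdealComputable S f ∧ ∃ C : ℕ, ∀ k : ℕ, |(f k : ℝ) - k * r| ≤ C

section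

variable {S : Set (ℕ → Bool)}

theorem exists_nat_bound {g : ℕ → ℝ} {C : ℝ} (h : ∀ k, g k ≤ C) : ∃ C' : ℕ, ∀ k, g k ≤ C' := by
  obtain ⟨n, hn⟩ := exists_nat_ge C
  exact ⟨n, fun k => (h k).trans hn⟩

theorem IsIdealReal.one (hS : IsTuringIdeal S) : IsIdealReal S 1 :=
  ⟨fun k => (k : ℤ), .of_primrec hS Primrec.int_ofNat, 0, fun k => by simp⟩

theorem IsIdealReal.add (hS : IsTuringIdeal S) {r s : ℝ} (hr : IsIdealReal S r)
    (hs : IsIdealReal S s) : IsIdealReal S (r + s) := by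
  obtain ⟨f, hf, C, hC⟩ := hr
  obtain ⟨g, hg, D, hD⟩ := hs
  refine ⟨fun k => f k + g k, IdealComputable.comp₂ hS Primrec.int_add hf hg, C + D, fun k => ?_⟩
  have h1 := abs_add_le ((f k : ℝ) - k * r) (g k - k * s)
  have h2 := hC k
  have h3 := hD k
  push_cast
  rw [show (f k + g k : ℝ) - k * (r + s) = (f k - k * r) + (g k - k * s) by ring]
  linarith

theorem IsIdealReal.zsmul (hS : IsTuringIdeal S) {r : ℝ} (a : ℤ) (hr : IsIdealReal S r) :
    IsIdealReal S (a * r) := by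
  obtain ⟨f, hf, C, hC⟩ := hr
  refine ⟨fun k => a * f k, IdealComputable.comp₂ hS Primrec.int_mul
    (.of_primrec hS (Primrec.const a)) hf, a.natAbs * C, fun k => ?_⟩
  push_cast
  rw [show (a * f k : ℝ) - k * (a * r) = a * (f k - k * r) by ring, abs_mul,
    Nat.cast_natAbs, Int.cast_abs]
  exact mul_le_mul_of_nonneg_left (hC k) (abs_nonneg _)

/-- Dividing the argument `k`, not the value, keeps the approximation integral; the remainder of `k`
modulo `b` costs at most `|r|`. -/
theorem IsIdealReal.div_nat (hS : IsTuringIdeal S) {r : ℝ} (b : ℕ) (hb : 0 < b)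
    (hr : IsIdealReal S r) : IsIdealReal S (r / b) := by
  obtain ⟨f, hf, C, hC⟩ := hr
  refine ⟨fun k => f (k / b), hf.comp hS (.of_primrec hS
    (Primrec.nat_div.comp Primrec.id (Primrec.const b))), ?_⟩
  refine exists_nat_bound (C := C + |r|) fun k => ?_
  have hb' : (0 : ℝ) < b := by exact_mod_cast hb
  have h1 : (k : ℝ) = b * (k / b : ℕ) + (k % b : ℕ) := by exact_mod_cast (Nat.div_add_mod k b).symm
  have h2 : ((k % b : ℕ) : ℝ) < b := by exact_mod_cast Nat.mod_lt k hb
  have h3 : (0 : ℝ) ≤ (k % b : ℕ) := by positivity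
  have h4 : (f (k / b) : ℝ) - k * (r / b) =
      (f (k / b) - (k / b : ℕ) * r) + -((k % b : ℕ) / b * r) := by
    conv_lhs => rw [h1]
    field_simp
    ring
  rw [h4]
  refine (abs_add_le _ _).trans (add_le_add (hC _) ?_)
  rw [abs_neg, abs_mul]
  refine mul_le_of_le_one_left (abs_nonneg _) ?_
  rw [abs_of_nonneg (by positivity), div_le_one hb']
  exact h2.le

/-- The rational vector space of the reals with an approximation in a Turing ideal. -/
def idealReals (hS : IsTuringIdeal S) : Submodule ℚ ℝ where
  carrier := {r | IsIdealReal S r}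
  add_mem' := fun hr hs => hr.add hS hs
  zero_mem' := by simpa using (IsIdealReal.one hS).zsmul hS 0
  smul_mem' := fun q r hr => by
    have := (IsIdealReal.zsmul hS q.num hr).div_nat hS q.den q.den_pos
    rw [Set.mem_ofPred_eq, Rat.smul_def]
    convert this using 1
    rw [mul_div_right_comm]
    congr 1
    exact_mod_cast (Rat.num_div_den q).symm

theorem mem_idealReals (hS : IsTuringIdeal S) {r : ℝ} : r ∈ idealReals hS ↔ IsIdealReal S r :=
  Iff.rfl

/-- A real is in the ideal if its ratio to a real of the ideal can be approximated. -/
theorem IsIdealReal.of_approx (hS : IsTuringIdeal S) {s x : ℝ} (hs : IsIdealReal S s) {m : ℕ → ℕ}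
    (hm : IdealComputable S m) {C : ℝ} (h : ∀ k, 0 < k → |m k * s - k * x| ≤ C) :
    IsIdealReal S x := by
  obtain ⟨f, hf, D, hD⟩ := hs
  refine ⟨fun k => f (m k), hf.comp hS hm, ?_⟩
  refine exists_nat_bound (C := D + (|m 0 * s| + |C|)) fun k => ?_
  rw [show (f (m k) : ℝ) - k * x = (f (m k) - m k * s) + (m k * s - k * x) by ring]
  refine (abs_add_le _ _).trans (add_le_add (hD _) ?_)
  rcases Nat.eq_zero_or_pos k with rfl | hk
  · have := abs_nonneg C
    simp only [Nat.cast_zero, zero_mul, sub_zero]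
    linarith
  · have h1 := h k hk
    have h2 := le_abs_self C
    have := abs_nonneg (m 0 * s)
    linarith

theorem exists_common_den {n : ℕ} (q : Fin n → ℚ) :
    ∃ D : ℕ, 0 < D ∧ ∃ z : Fin n → ℤ, ∀ i, (D : ℚ) * q i = z i := by
  refine ⟨∏ i, (q i).den, Finset.prod_pos fun i _ => (q i).den_pos,
    fun i => (∏ j ∈ Finset.univ.erase i, (q j).den : ℕ) * (q i).num, fun i => ?_⟩
  rw [← Finset.mul_prod_erase _ _ (Finset.mem_univ i)]
  push_cast
  have := Rat.den_mul_eq_num (q i)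
  rw [← this]
  ring

/-! ### Signs of integral combinations of finitely many reals. -/

variable {α : Type*} [Primcodable α]

/-- Approximations alone cannot detect zero. But the reals `r i` are fixed and span a
finite-dimensional rational space, so in a noneffectively chosen basis the sum vanishes exactly when
finitely many integral forms in the `z i a` vanish. -/
theorem IdealComputable.lin_eq_zero (hS : IsTuringIdeal S) {n : ℕ} {z : Fin n → α → ℤ}
    (hz : ∀ i, IdealComputable S (z i)) (r : Fin n → ℝ) :
    IdealComputable S fun a => decide (∑ i, (z i a : ℝ) * r i = 0) := by
  let U := Submodule.span ℚ (Set.range r)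
  have : FiniteDimensional ℚ U := FiniteDimensional.span_of_finite ℚ (Set.finite_range r)
  let B := Module.finBasis ℚ U
  let r' : Fin n → U := fun i => ⟨r i, Submodule.subset_span ⟨i, rfl⟩⟩
  choose D hD w hw using fun j => exists_common_den fun i => B.repr (r' i) j
  have key : ∀ a, (∑ i, (z i a : ℝ) * r i = 0) ↔ ∀ j, decide (∑ i, z i a * w j i = 0) = true := by
    intro a
    have h1 : (∑ i, (z i a : ℝ) * r i) = ((∑ i, (z i a) • r' i : U) : ℝ) := by
      simp [r']
    rw [h1, ZeroMemClass.coe_eq_zero, ← B.repr.map_eq_zero_iff, Finsupp.ext_iff]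
    refine forall_congr' fun j => ?_
    rw [decide_eq_true_eq]
    have hD' : (D j : ℚ) ≠ 0 := by exact_mod_cast (hD j).ne'
    have h2 : (D j : ℚ) * B.repr (∑ i, (z i a) • r' i) j = ((∑ i, z i a * w j i : ℤ) : ℚ) := by
      rw [map_sum, Finsupp.finsetSum_apply, Finset.mul_sum]
      push_cast
      refine Finset.sum_congr rfl fun i _ => ?_
      rw [map_zsmul, Finsupp.smul_apply, zsmul_eq_mul, ← hw]
      ring
    rw [Finsupp.zero_apply, ← mul_right_inj' hD', mul_zero, h2]
    exact_mod_cast Iff.rfl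
  have h3 : IdealComputable S fun a => decide (∀ j, decide (∑ i, z i a * w j i = 0) = true) := by
    refine IdealComputable.forall_fin hS (p := fun j a => decide (∑ i, z i a * w j i = 0))
      fun j => ?_
    refine IdealComputable.comp₂ hS Primrec.eq.decide ?_ (.of_primrec hS (Primrec.const 0))
    exact IdealComputable.sum_fin hS fun i => IdealComputable.comp₂ hS Primrec.int_mul (hz i)
      (.of_primrec hS (Primrec.const _))
  refine h3.of_eq fun a => ?_
  rw [decide_eq_decide, key]

/-- Vanishing is decided beforehand. For a nonzero sum, `k` times the sum grows while the error
bound `E a` does not depend on `k`, so a search finds a `k` at which the approximation exceeds the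
error and hence has the correct sign. -/
theorem IdealComputable.lin_pos (hS : IsTuringIdeal S) {n : ℕ} {z : Fin n → α → ℤ}
    (hz : ∀ i, IdealComputable S (z i)) {r : Fin n → ℝ} (hr : ∀ i, IsIdealReal S (r i)) :
    IdealComputable S fun a => decide (0 < ∑ i, (z i a : ℝ) * r i) := by
  have hzero := IdealComputable.lin_eq_zero hS hz r
  choose f hf C hC using hr
  let F : α → ℕ → ℤ := fun a k => ∑ i, z i a * f i k
  let E : α → ℤ := fun a => ∑ i, ((z i a).natAbs : ℤ) * C i
  have hF : IdealComputable S fun p : α × ℕ => F p.1 p.2 :=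
    IdealComputable.sum_fin hS fun i => IdealComputable.comp₂ hS Primrec.int_mul
      ((hz i).comp hS (.of_primrec hS Primrec.fst)) ((hf i).comp hS (.of_primrec hS Primrec.snd))
  have hE : IdealComputable S E :=
    IdealComputable.sum_fin hS fun i => IdealComputable.comp₂ hS Primrec.int_mul
      ((IdealComputable.of_primrec hS (Primrec.int_ofNat.comp Primrec.int_natAbs)).comp hS (hz i))
      (.of_primrec hS (Primrec.const _))
  have hbound : ∀ a k, |(F a k : ℝ) - k * ∑ i, (z i a : ℝ) * r i| ≤ E a := by
    intro a k
    have h1 : (F a k : ℝ) - k * ∑ i, (z i a : ℝ) * r i =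
        ∑ i, (z i a : ℝ) * (f i k - k * r i) := by
      simp only [F, Int.cast_sum, Int.cast_mul, Finset.mul_sum, mul_sub, Finset.sum_sub_distrib]
      congr 1
      exact Finset.sum_congr rfl fun i _ => by ring
    rw [h1]
    refine (Finset.abs_sum_le_sum_abs _ _).trans ?_
    simp only [E, Int.cast_sum, Int.cast_mul, Int.natCast_natAbs, Int.cast_abs, Int.cast_natCast]
    refine Finset.sum_le_sum fun i _ => ?_
    rw [abs_mul]
    exact mul_le_mul_of_nonneg_left (hC i k) (abs_nonneg _)
  let test : α → ℕ → Bool := fun a k =>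
    decide (∑ i, (z i a : ℝ) * r i = 0) || decide (E a < ((F a k).natAbs : ℤ))
  have htest : IdealComputable S fun p : α × ℕ => test p.1 p.2 :=
    IdealComputable.comp₂ hS Primrec.or (hzero.comp hS (.of_primrec hS Primrec.fst))
      (IdealComputable.comp₂ hS Primrec.int_lt.decide (hE.comp hS (.of_primrec hS Primrec.fst))
        ((IdealComputable.of_primrec hS (Primrec.int_ofNat.comp Primrec.int_natAbs)).comp hS hF))
  have hex : ∀ a, ∃ k, test a k = true := by
    intro a
    by_cases h0 : ∑ i, (z i a : ℝ) * r i = 0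
    · exact ⟨0, by simp [test, h0]⟩
    · have hpos := abs_pos.2 h0
      obtain ⟨k, hk⟩ := exists_nat_gt (2 * (E a : ℝ) / |∑ i, (z i a : ℝ) * r i|)
      rw [div_lt_iff₀ hpos] at hk
      refine ⟨k, ?_⟩
      have h1 := hbound a k
      have h2 := abs_sub_abs_le_abs_sub ((k : ℝ) * ∑ i, (z i a : ℝ) * r i) (F a k)
      rw [abs_sub_comm] at h1
      rw [abs_mul, Nat.abs_cast] at h2
      have h3 : (E a : ℝ) < |(F a k : ℝ)| := by linarith
      simp only [test, Bool.or_eq_true, decide_eq_true_eq, Int.natCast_natAbs]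
      right
      exact_mod_cast h3
  have hfind := IdealComputable.find hS htest hex
  have hsign : IdealComputable S fun a => decide (0 < F a (Nat.find (hex a))) :=
    IdealComputable.comp₂ hS Primrec.int_lt.decide (.of_primrec hS (Primrec.const 0))
      (hF.comp hS ((IdealComputable.of_primrec hS Primrec.id).pair hS hfind))
  refine (IdealComputable.and hS (hzero.not hS) hsign).of_eq fun a => ?_
  rw [Bool.eq_iff_iff, Bool.and_eq_true, Bool.not_eq_true', decide_eq_false_iff_not,
    decide_eq_true_eq, decide_eq_true_eq]
  have hspec := Nat.find_spec (hex a)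
  set k := Nat.find (hex a)
  simp only [test, Bool.or_eq_true, decide_eq_true_eq, Int.natCast_natAbs] at hspec
  by_cases h0 : ∑ i, (z i a : ℝ) * r i = 0
  · simp [h0]
  have h1 : (E a : ℝ) < |(F a k : ℝ)| := by exact_mod_cast hspec.resolve_left h0
  have h2 := hbound a k
  have hk : (0 : ℝ) ≤ k := by positivity
  rw [abs_le] at h2
  constructor
  · rintro ⟨-, h3⟩
    have h3' : (0 : ℝ) < F a k := by exact_mod_cast h3
    rw [abs_of_pos h3'] at h1
    by_contra hcon
    push Not at hcon
    have := mul_nonpos_of_nonneg_of_nonpos hk hcon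
    linarith
  · intro h3
    refine ⟨h0, ?_⟩
    by_contra hcon
    push Not at hcon
    have h4 : (F a k : ℝ) ≤ 0 := by exact_mod_cast hcon
    rw [abs_of_nonpos h4] at h1
    have := mul_nonneg hk h3.le
    linarith

end

/-! ### Profinitely convergent rational sequences -/

/-- The rational sequence `c` has, up to a denominator, a profinite limit computable in a member
of `S`. -/
def IsIdealColor (S : Set (ℕ → Bool)) (c : ℕ → ℚ) : Prop :=
  ∃ D : ℕ, 0 < D ∧ ∃ n : ℕ → ℤ, IdealComputable S n ∧ (∀ N, (D : ℚ) * c N = n N) ∧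
    ∀ m : ℕ, 0 < m → ∀ N N' : ℕ, m ≤ N → m ≤ N' → (m : ℤ) ∣ n N - n N'

section Colors

variable {S : Set (ℕ → Bool)}

theorem IsIdealColor.one (hS : IsTuringIdeal S) : IsIdealColor S 1 :=
  ⟨1, one_pos, fun _ => 1, .of_primrec hS (Primrec.const 1), by simp, by simp⟩

/-- The rational vector space of the profinitely convergent sequences in a Turing ideal. -/
def idealColors (hS : IsTuringIdeal S) : Submodule ℚ (ℕ → ℚ) where
  carrier := {c | IsIdealColor S c}
  add_mem' := by
    rintro c c' ⟨D, hD, n, hn, h1, h2⟩ ⟨D', hD', n', hn', h1', h2'⟩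
    refine ⟨D * D', Nat.mul_pos hD hD', fun N => D' * n N + D * n' N, ?_, fun N => ?_,
      fun m hm N N' hN hN' => ?_⟩
    · exact IdealComputable.comp₂ hS Primrec.int_add
        (IdealComputable.comp₂ hS Primrec.int_mul (.of_primrec hS (Primrec.const _)) hn)
        (IdealComputable.comp₂ hS Primrec.int_mul (.of_primrec hS (Primrec.const _)) hn')
    · push_cast
      rw [← h1, ← h1', Pi.add_apply]; ring
    · have h3 := (h2 m hm N N' hN hN').mul_left D'
      have h4 := (h2' m hm N N' hN hN').mul_left D
      have h5 : D' * n N + D * n' N - (D' * n N' + D * n' N') =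
          D' * (n N - n N') + D * (n' N - n' N') := by ring
      rw [h5]
      exact dvd_add h3 h4
  zero_mem' := ⟨1, one_pos, fun _ => 0, .of_primrec hS (Primrec.const 0), by simp, by simp⟩
  smul_mem' := by
    rintro q c ⟨D, hD, n, hn, h1, h2⟩
    refine ⟨q.den * D, Nat.mul_pos q.den_pos hD, fun N => q.num * n N, ?_, fun N => ?_,
      fun m hm N N' hN hN' => ?_⟩
    · exact IdealComputable.comp₂ hS Primrec.int_mul (.of_primrec hS (Primrec.const _)) hn
    · push_cast
      rw [← h1, ← Rat.den_mul_eq_num q, Pi.smul_apply, smul_eq_mul]; ring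
    · have h3 := (h2 m hm N N' hN hN').mul_left q.num
      rwa [mul_sub] at h3

theorem mem_idealColors (hS : IsTuringIdeal S) {c : ℕ → ℚ} :
    c ∈ idealColors hS ↔ IsIdealColor S c := Iff.rfl

/-- The index set: sequences of rationals, ordered lexicographically. -/
abbrev ColorIndex : Type := Lex (ℕ → ℚ)

instance : @DenselyOrdered ColorIndex Preorder.toLT := Pi.instDenselyOrderedLexForall

/-- The tail of an index. -/
def colorTail (γ : ColorIndex) : ℕ → ℚ := fun N => ofLex γ (N + 1)

/-- Coordinate `0` alone puts the index beyond `F`, which leaves the tail free to be any prescribed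
sequence. -/
theorem exists_colorTail_eq (c : ℕ → ℚ) (F : Finset ColorIndex) :
    ∃ γ : ColorIndex, colorTail γ = c ∧ ∀ δ ∈ F, δ < γ := by
  obtain ⟨x, hx⟩ : ∃ x : ℚ, ∀ δ ∈ F, ofLex δ 0 < x := by
    obtain ⟨y, hy⟩ := (F.image fun δ : ColorIndex => ofLex δ 0).bddAbove
    exact ⟨y + 1, fun δ hδ => lt_of_le_of_lt
      (hy (Finset.mem_coe.2 (Finset.mem_image_of_mem (fun δ : ColorIndex => ofLex δ 0) hδ)))
      (lt_add_one y)⟩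
  refine ⟨toLex fun N => Nat.casesOn N x c, rfl, fun δ hδ => ?_⟩
  exact ⟨0, fun j hj => absurd hj (Nat.not_lt_zero j), hx δ hδ⟩

open Classical in
/-- The color of an index. -/
noncomputable def color (hS : IsTuringIdeal S) : WithTop ColorIndex → ℕ → ℚ
  | none => 1
  | some γ => if colorTail γ ∈ idealColors hS then colorTail γ else 0

theorem color_of_mem (hS : IsTuringIdeal S) {γ : ColorIndex} (h : colorTail γ ∈ idealColors hS) :
    color hS (γ : WithTop ColorIndex) = colorTail γ := if_pos h

theorem color_of_notMem (hS : IsTuringIdeal S) {γ : ColorIndex}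
    (h : colorTail γ ∉ idealColors hS) : color hS (γ : WithTop ColorIndex) = 0 := if_neg h

theorem color_mem (hS : IsTuringIdeal S) (γ : WithTop ColorIndex) :
    color hS γ ∈ idealColors hS := by
  cases γ with
  | top => exact IsIdealColor.one hS
  | coe γ =>
    by_cases h : colorTail γ ∈ idealColors hS
    · rwa [color_of_mem hS h]
    · rw [color_of_notMem hS h]
      exact (idealColors hS).zero_mem

theorem color_top (hS : IsTuringIdeal S) : color hS ⊤ = 1 := rfl

theorem exists_color_eq (hS : IsTuringIdeal S) {c : ℕ → ℚ} (hc : c ∈ idealColors hS)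
    (F : Finset ColorIndex) :
    ∃ γ : ColorIndex, color hS (γ : WithTop ColorIndex) = c ∧ ∀ δ ∈ F, δ < γ := by
  obtain ⟨γ, hγ, h⟩ := exists_colorTail_eq c F
  refine ⟨γ, ?_, h⟩
  rw [← hγ] at hc
  rw [color_of_mem hS hc, hγ]

/-! ### The residue map. -/

theorem exists_ratProj : ∃ f : ℝ →ₗ[ℚ] ℚ, f 1 = 1 := by
  obtain ⟨f, hf⟩ := LinearMap.exists_leftInverse_of_injective (Algebra.linearMap ℚ ℝ)
    (LinearMap.ker_eq_bot.2 (algebraMap ℚ ℝ).injective)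
  exact ⟨f, by simpa using LinearMap.congr_fun hf 1⟩

/-- A `ℚ`-linear retraction of `ℝ` onto `ℚ`. -/
noncomputable def ratProj : ℝ →ₗ[ℚ] ℚ := exists_ratProj.choose

theorem ratProj_one : ratProj 1 = 1 := exists_ratProj.choose_spec

theorem ratProj_ratCast (q : ℚ) : ratProj (q : ℝ) = q := by
  have := ratProj.map_smul q 1
  rwa [ratProj_one, Rat.smul_def, mul_one, smul_eq_mul, mul_one] at this

open LexSpace

/-- The sequence of approximate residues of an element. -/
noncomputable def residueSeq (hS : IsTuringIdeal S) :
    LexSpace (WithTop ColorIndex) →+ (ℕ → ℚ) where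
  toFun h := Finsupp.lsum ℚ (fun γ =>
    (LinearMap.toSpanSingleton ℚ (ℕ → ℚ) (color hS γ)).comp ratProj) (ofLex h)
  map_zero' := map_zero _
  map_add' g h := map_add _ (ofLex g) (ofLex h)

theorem residueSeq_mono (hS : IsTuringIdeal S) (γ : WithTop ColorIndex) (r : ℝ) :
    residueSeq hS (mono γ r) = ratProj r • color hS γ := by
  change Finsupp.lsum ℚ (fun γ => (LinearMap.toSpanSingleton ℚ (ℕ → ℚ) (color hS γ)).comp ratProj)
    (Finsupp.single γ r) = _
  rw [Finsupp.lsum_single]; rfl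

theorem residueSeq_smul (hS : IsTuringIdeal S) (q : ℚ) (h : LexSpace (WithTop ColorIndex)) :
    residueSeq hS (q • h) = q • residueSeq hS h := map_smul (Finsupp.lsum ℚ (fun γ =>
    (LinearMap.toSpanSingleton ℚ (ℕ → ℚ) (color hS γ)).comp ratProj)) q (ofLex h)

/-- Each element involves a finite combination of colors with fixed rational coefficients, so the
noneffective choice of `ratProj` does no harm. -/
theorem residueSeq_mem (hS : IsTuringIdeal S) (h : LexSpace (WithTop ColorIndex)) :
    residueSeq hS h ∈ idealColors hS := by
  change Finsupp.lsum ℚ (fun γ => (LinearMap.toSpanSingleton ℚ (ℕ → ℚ) (color hS γ)).comp ratProj)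
    (ofLex h) ∈ _
  rw [Finsupp.lsum_apply]
  exact Submodule.sum_mem _ fun γ _ => (idealColors hS).smul_mem _ (color_mem hS γ)

end Colors

/-! ### The model -/

section Model

open LexSpace

variable {S : Set (ℕ → Bool)} (hS : IsTuringIdeal S)

/-- The Z-group attached to a Turing ideal. -/
noncomputable def idealModel : AddSubgroup (LexSpace (WithTop ColorIndex)) where
  carrier := {h | (∀ γ, coeff γ h ∈ idealReals hS) ∧ (∃ q : ℚ, coeff ⊤ h = q) ∧
    ∃ N₀ : ℕ, ∀ N ≥ N₀, ∃ z : ℤ, residueSeq hS h N = z}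
  zero_mem' := ⟨fun γ => (idealReals hS).zero_mem, ⟨0, by simp⟩, 0, fun N _ => ⟨0, by simp⟩⟩
  add_mem' := by
    rintro g h ⟨h1, ⟨q, hq⟩, N₀, hN⟩ ⟨h1', ⟨q', hq'⟩, N₀', hN'⟩
    refine ⟨fun γ => (idealReals hS).add_mem (h1 γ) (h1' γ), ⟨q + q', ?_⟩, max N₀ N₀',
      fun N hNN => ?_⟩
    · rw [coeff_add, hq, hq']; push_cast; rfl
    · obtain ⟨z, hz⟩ := hN N (le_trans (le_max_left _ _) hNN)
      obtain ⟨z', hz'⟩ := hN' N (le_trans (le_max_right _ _) hNN)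
      exact ⟨z + z', by rw [map_add, Pi.add_apply, hz, hz']; push_cast; rfl⟩
  neg_mem' := by
    rintro h ⟨h1, ⟨q, hq⟩, N₀, hN⟩
    refine ⟨fun γ => (idealReals hS).neg_mem (h1 γ), ⟨-q, ?_⟩, N₀, fun N hNN => ?_⟩
    · rw [coeff_neg, hq]; push_cast; rfl
    · obtain ⟨z, hz⟩ := hN N hNN
      exact ⟨-z, by rw [map_neg, Pi.neg_apply, hz]; push_cast; rfl⟩

theorem mem_idealModel {h : LexSpace (WithTop ColorIndex)} : h ∈ idealModel hS ↔
    (∀ γ, coeff γ h ∈ idealReals hS) ∧ (∃ q : ℚ, coeff ⊤ h = q) ∧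
      ∃ N₀ : ℕ, ∀ N ≥ N₀, ∃ z : ℤ, residueSeq hS h N = z := Iff.rfl

theorem residueSeq_top (q : ℚ) (N : ℕ) :
    residueSeq hS (mono ⊤ (q : ℝ)) N = q := by
  rw [residueSeq_mono, color_top, ratProj_ratCast, Pi.smul_apply, Pi.one_apply, smul_eq_mul,
    mul_one]

theorem mono_top_one_mem : mono ⊤ 1 ∈ idealModel hS := by
  refine ⟨fun γ => ?_, ⟨1, by simp⟩, 0, fun N _ => ⟨1, ?_⟩⟩
  · rw [coeff_mono]
    split_ifs
    · exact IsIdealReal.one hS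
    · exact (idealReals hS).zero_mem
  · have := residueSeq_top hS 1 N
    simpa using this

/-- The least positive element of the model. -/
noncomputable def modelOne : idealModel hS := ⟨mono ⊤ 1, mono_top_one_mem hS⟩

/-- The residue of an element of the model, in terms of a common denominator of its residue
sequence. -/
theorem zdvd_sub_residue {x : LexSpace (WithTop ColorIndex)} (hx : x ∈ idealModel hS) {D : ℕ}
    (hD : 0 < D) {n : ℕ → ℤ} (h1 : ∀ N, (D : ℚ) * residueSeq hS x N = n N)
    (h2 : ∀ m : ℕ, 0 < m → ∀ N N' : ℕ, m ≤ N → m ≤ N' → (m : ℤ) ∣ n N - n N') {N : ℕ}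
    (hN : 0 < N) : (D : ℤ) ∣ n (N * D) ∧
      ∀ r : ℤ, (D : ℤ) * r = n (N * D) →
        ZDvd (N : ℤ) ((⟨x, hx⟩ : idealModel hS) - r • modelOne hS) := by
  have hD' : (D : ℚ) ≠ 0 := by exact_mod_cast hD.ne'
  have hN' : (N : ℚ) ≠ 0 := by exact_mod_cast hN.ne'
  have hdiff : ∀ N' ≥ N * D, ((N * D : ℕ) : ℤ) ∣ n N' - n (N * D) := fun N' h =>
    h2 _ (Nat.mul_pos hN hD) _ _ h le_rfl
  obtain ⟨hc, ⟨q, hq⟩, N₀, hint⟩ := hx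
  have hdvd : (D : ℤ) ∣ n (N * D) := by
    obtain ⟨z, hz⟩ := hint (max N₀ (N * D)) (le_max_left _ _)
    have h3 := hdiff (max N₀ (N * D)) (le_max_right _ _)
    have h4 : n (max N₀ (N * D)) = D * z := by
      have := h1 (max N₀ (N * D))
      rw [hz] at this
      exact_mod_cast this.symm
    have h5 : (D : ℤ) ∣ n (max N₀ (N * D)) - n (N * D) :=
      dvd_trans (by push_cast; exact Dvd.intro_left _ rfl) h3
    rw [h4] at h5
    exact (dvd_sub_right (Dvd.intro _ rfl)).1 h5
  refine ⟨hdvd, fun r hr => ?_⟩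
  -- From index `N * D` on, `n` is constant modulo `N * D`, so the residue sequence of `x - r` takes
  -- values in the multiples of `N`. The quotient is integral only from there on, which is why
  -- membership asks for eventual integrality.
  let y : LexSpace (WithTop ColorIndex) := (1 / N : ℚ) • (x - r • mono ⊤ 1)
  have hy : y ∈ idealModel hS := by
    refine ⟨fun γ => ?_, ⟨(1 / N) * (q - r), ?_⟩, N * D, fun N' hN'' => ?_⟩
    · have h3 := (idealReals hS).smul_mem (1 / N : ℚ) ((idealReals hS).sub_mem (hc γ)
        (zsmul_mem ((mono_top_one_mem hS).1 γ) r))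
      rw [Rat.smul_def] at h3
      simpa [y, zsmul_eq_mul] using h3
    · simp only [y, coeff_smul, coeff_sub, coeff_zsmul, hq, coeff_mono_self, mul_one]
      push_cast; rfl
    · obtain ⟨k, hk⟩ := hdiff N' hN''
      refine ⟨k, ?_⟩
      have h3 : residueSeq hS y N' = (1 / N) * (residueSeq hS x N' - r) := by
        have h4 := residueSeq_top hS 1 N'
        rw [Rat.cast_one] at h4
        rw [residueSeq_smul, map_sub, map_zsmul, Pi.smul_apply, Pi.sub_apply, Pi.smul_apply, h4,
          smul_eq_mul, zsmul_eq_mul, mul_one]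
      have h4 : (n N' : ℚ) - D * r = N * D * k := by
        rw [← hr] at hk
        exact_mod_cast hk
      rw [h3]
      have h5 : (D : ℚ) * (residueSeq hS x N' - r) = D * (N * k) := by
        rw [mul_sub, h1, h4]; ring
      rw [mul_left_cancel₀ hD' h5]
      field_simp
  refine ⟨⟨y, hy⟩, Subtype.ext ?_⟩
  change x - r • mono ⊤ 1 = (N : ℤ) • y
  refine ext_coeff fun i => ?_
  have hN'' : (N : ℝ) ≠ 0 := by exact_mod_cast hN.ne'
  simp only [y, coeff_zsmul, coeff_smul]
  push_cast
  field_simp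

/-- A positive element whose leading index is below `⊤` exceeds the unit. One led by `⊤` is a
rational multiple `q` of the unit with constant residue sequence `q`, so `q` is a positive integer.
-/
theorem isDiscreteZGroup_idealModel : IsDiscreteZGroup (modelOne hS) where
  pos := by
    change (0 : LexSpace (WithTop ColorIndex)) < mono ⊤ 1
    rw [LexSpace.pos_iff]
    exact ⟨⊤, fun j hj => coeff_mono_of_ne hj.ne' 1, by simp⟩
  le_of_pos := by
    rintro ⟨x, hx⟩ hpos
    change (0 : LexSpace (WithTop ColorIndex)) < x at hpos
    change mono ⊤ 1 ≤ x
    obtain ⟨δ, hδ⟩ := exists_lead hpos.ne'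
    have h0 := hδ.pos_iff.1 hpos
    rcases lt_or_eq_of_le (le_top : δ ≤ ⊤) with hlt | rfl
    · exact (lt_of_lead_lt hδ hpos (i := ⊤) (fun j hj => coeff_mono_of_ne hj.ne' 1) hlt).le
    · obtain ⟨-, ⟨q, hq⟩, N₀, hint⟩ := hx
      have hxq : x = mono ⊤ (q : ℝ) := ext_coeff fun i => by
        rcases lt_or_eq_of_le (le_top : i ≤ ⊤) with hlt | rfl
        · rw [hδ.1 i hlt, coeff_mono_of_ne hlt.ne']
        · rw [hq, coeff_mono_self]
      obtain ⟨z, hz⟩ := hint N₀ le_rfl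
      rw [hxq, residueSeq_top] at hz
      rw [hq, hz] at h0
      have hz1 : (1 : ℤ) ≤ z := by
        have : (0 : ℤ) < z := by exact_mod_cast h0
        omega
      rcases hz1.eq_or_lt with rfl | hz1
      · rw [hxq, hz]; simp
      · refine (lt_of_coeff_lt (i := ⊤) (fun j hj => ?_) ?_).le
        · rw [hδ.1 j hj, coeff_mono_of_ne hj.ne']
        · rw [coeff_mono_self, hq, hz]; exact_mod_cast hz1
  exists_residue := by
    rintro N hN ⟨x, hx⟩
    obtain ⟨N, rfl⟩ := Int.eq_ofNat_of_zero_le hN.le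
    obtain ⟨D, hD, n, -, h1, h2⟩ := (mem_idealColors hS).1 (residueSeq_mem hS x)
    obtain ⟨⟨r, hr⟩, h3⟩ := zdvd_sub_residue hS hx hD h1 h2 (N := N) (by exact_mod_cast hN)
    exact ⟨r, h3 r hr.symm⟩

theorem coeff_zlin {n : ℕ} (a : Fin n → idealModel hS) (c : Fin n → ℤ) (d : ℤ)
    (γ : WithTop ColorIndex) : coeff γ (zlin (modelOne hS) a c d : idealModel hS).1 =
      ∑ i : Fin (n + 1), ((Fin.snoc c d : Fin (n + 1) → ℤ) i : ℝ) *
        (Fin.snoc (fun i => coeff γ (a i).1) (coeff γ (modelOne hS).1) : Fin (n + 1) → ℝ) i := by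
  rw [Fin.sum_univ_castSucc]
  simp only [Fin.snoc_castSucc, Fin.snoc_last, zlin]
  rw [AddSubgroup.coe_add, coeff_add, AddSubgroup.val_finsetSum]
  have h1 : ∀ (s : Finset (Fin n)) (f : Fin n → LexSpace (WithTop ColorIndex)),
      coeff γ (∑ i ∈ s, f i) = ∑ i ∈ s, coeff γ (f i) := by
    intro s f
    induction s using Finset.cons_induction with
    | empty => simp
    | cons i s hi ih => rw [Finset.sum_cons, Finset.sum_cons, coeff_add, ih]
  rw [h1]
  simp

theorem exists_finset_coeff_zlin {n : ℕ} (a : Fin n → idealModel hS) :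
    ∃ F : Finset (WithTop ColorIndex), ∀ c d, ∀ γ ∉ F,
      coeff γ (zlin (modelOne hS) a c d : idealModel hS).1 = 0 := by
  classical
  refine ⟨insert ⊤ (Finset.univ.biUnion fun i => (ofLex (a i).1).support), fun c d γ hγ => ?_⟩
  rw [coeff_zlin]
  refine Finset.sum_eq_zero fun i _ => mul_eq_zero_of_right _ ?_
  refine Fin.lastCases ?_ (fun i => ?_) i
  · rw [Fin.snoc_last]
    exact coeff_mono_of_ne (fun h : ⊤ = γ => hγ (h ▸ Finset.mem_insert_self _ _)) 1
  · rw [Fin.snoc_castSucc]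
    by_contra h
    exact hγ (Finset.mem_insert_of_mem (Finset.mem_biUnion.2
      ⟨i, Finset.mem_univ i, Finsupp.mem_support_iff.2 h⟩))

theorem IdealComputable.ball_finset (hS : IsTuringIdeal S) {α ι : Type*} [Primcodable α]
    (F : Finset ι)
    {p : ι → α → Bool} (hp : ∀ i, IdealComputable S (p i)) :
    IdealComputable S fun a => decide (∀ i ∈ F, p i a = true) := by
  classical
  induction F using Finset.cons_induction with
  | empty => exact (IdealComputable.of_primrec hS (Primrec.const true)).of_eq fun a => by simp
  | cons i F hi ih =>
    refine ((hp i).and hS ih).of_eq fun a => ?_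
    rw [Bool.eq_iff_iff]
    simp

/-- Every tuple of the model has computable order relations and residues. -/
theorem isComputableTuple_idealModel {n : ℕ} (a : Fin n → idealModel hS) :
    IsComputableTuple S (modelOne hS) a where
  pos := by
    obtain ⟨F, hF'⟩ := exists_finset_coeff_zlin hS a
    let z : Fin (n + 1) → (Fin n → ℤ) × ℤ → ℤ := fun i p => (Fin.snoc p.1 p.2 : Fin (n + 1) → ℤ) i
    have hz : ∀ i, IdealComputable S (z i) := by
      intro i
      refine Fin.lastCases ?_ (fun i => ?_) i
      · exact (IdealComputable.of_primrec hS Primrec.snd).of_eq fun p => by simp [z]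
      · exact (IdealComputable.apply_fin hS (f := fun p : (Fin n → ℤ) × ℤ => p.1)
          (.of_primrec hS Primrec.fst) i).of_eq fun p => by simp [z]
    let r : WithTop ColorIndex → Fin (n + 1) → ℝ := fun γ =>
      Fin.snoc (fun i => coeff γ (a i).1) (coeff γ (modelOne hS).1)
    have hr : ∀ γ i, IsIdealReal S (r γ i) := by
      intro γ i
      refine Fin.lastCases ?_ (fun i => ?_) i
      · simpa [r] using (mem_idealReals hS).1 ((modelOne hS).2.1 γ)
      · simpa [r] using (mem_idealReals hS).1 ((a i).2.1 γ)
    have hzero : ∀ γ, IdealComputable S fun p : (Fin n → ℤ) × ℤ =>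
        decide (coeff γ (zlin (modelOne hS) a p.1 p.2 : idealModel hS).1 = 0) := fun γ =>
      (IdealComputable.lin_eq_zero hS hz (r γ)).of_eq fun p => by rw [coeff_zlin]
    have hpos : ∀ γ, IdealComputable S fun p : (Fin n → ℤ) × ℤ =>
        decide (0 < coeff γ (zlin (modelOne hS) a p.1 p.2 : idealModel hS).1) := fun γ =>
      (IdealComputable.lin_pos hS hz (hr γ)).of_eq fun p => by rw [coeff_zlin]
    -- Positivity asks for a positive leading coefficient at one of the finitely many indices in
    -- `F`; as `ball_finset` provides conjunctions, this disjunction is expressed by negating twice.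
    have hlead : ∀ γ, IdealComputable S fun p : (Fin n → ℤ) × ℤ =>
        !(decide (∀ δ ∈ F.filter (· < γ),
          decide (coeff δ (zlin (modelOne hS) a p.1 p.2 : idealModel hS).1 = 0) = true) &&
        decide (0 < coeff γ (zlin (modelOne hS) a p.1 p.2 : idealModel hS).1)) := fun γ =>
      ((IdealComputable.ball_finset hS _ hzero).and hS (hpos γ)).not hS
    refine ((IdealComputable.ball_finset hS F hlead).not hS).of_eq fun p => ?_
    have hF := hF' p.1 p.2
    have hiff : (0 < zlin (modelOne hS) a p.1 p.2) ↔ ∃ γ ∈ F, (∀ δ ∈ F.filter (· < γ),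
        coeff δ (zlin (modelOne hS) a p.1 p.2 : idealModel hS).1 = 0) ∧
        0 < coeff γ (zlin (modelOne hS) a p.1 p.2 : idealModel hS).1 := by
      change 0 < (zlin (modelOne hS) a p.1 p.2 : idealModel hS).1 ↔ _
      rw [LexSpace.pos_iff]
      constructor
      · rintro ⟨γ, h1, h2⟩
        refine ⟨γ, ?_, fun δ hδ => h1 δ (Finset.mem_filter.1 hδ).2, h2⟩
        by_contra h
        exact h2.ne' (hF γ h)
      · rintro ⟨γ, -, h1, h2⟩
        refine ⟨γ, fun δ hδ => ?_, h2⟩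
        by_cases h : δ ∈ F
        · exact h1 δ (Finset.mem_filter.2 ⟨h, hδ⟩)
        · exact hF δ h
    rw [Bool.eq_iff_iff, decide_eq_true_eq, hiff]
    simp only [Bool.not_eq_true', decide_eq_false_iff_not, not_forall,
      Bool.and_eq_true, decide_eq_true_eq, exists_prop, Bool.not_eq_false]
  residue i := by
    obtain ⟨D, hD, n, hn, h1, h2⟩ := (mem_idealColors hS).1 (residueSeq_mem hS (a i).1)
    -- Exact division by `D`, in a primitive recursive form; only its values at multiples of `D`
    -- matter.
    let dv : ℤ → ℤ := fun z => ((z.toNat / D : ℕ) : ℤ) - ((-z).toNat / D : ℕ)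
    have hdv : Primrec dv := Primrec.int_subNat.comp
      (Primrec.nat_div.comp Primrec.int_toNat (Primrec.const D))
      (Primrec.nat_div.comp Primrec.int_negToNat (Primrec.const D))
    have hdv' : ∀ z : ℤ, (D : ℤ) ∣ z → (D : ℤ) * dv z = z := by
      rintro _ ⟨k, rfl⟩
      obtain ⟨j, rfl | rfl⟩ := k.eq_nat_or_neg
      · have e1 : ((D : ℤ) * j).toNat = D * j := by
          rw [← Nat.cast_mul, Int.toNat_natCast]
        have e2 : (-((D : ℤ) * j)).toNat = 0 := by
          rw [Int.toNat_eq_zero]; have : (0 : ℤ) ≤ D * j := by positivity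
          omega
        simp only [dv, e1, e2, Nat.mul_div_cancel_left _ hD]; simp
      · have e1 : (-((D : ℤ) * -j)).toNat = D * j := by
          rw [mul_neg, neg_neg, ← Nat.cast_mul, Int.toNat_natCast]
        have e2 : ((D : ℤ) * -j).toNat = 0 := by
          rw [Int.toNat_eq_zero]; have : (0 : ℤ) ≤ D * j := by positivity
          rw [mul_neg]; omega
        simp only [dv, e1, e2, Nat.mul_div_cancel_left _ hD]; simp
    refine ⟨fun N => dv (n (N * D)), ?_, fun N hN => ?_⟩
    · exact (IdealComputable.of_primrec hS hdv).comp hS (hn.comp hS (.of_primrec hS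
        (Primrec.nat_mul.comp Primrec.id (Primrec.const D))))
    · obtain ⟨h3, h4⟩ := zdvd_sub_residue hS (a i).2 hD h1 h2 hN
      exact h4 _ (hdv' _ h3)

end Model

/-! ### Formulas expressing order relations and residues -/

theorem toNat_smul_sub_toNat_smul {M : Type*} [AddCommGroup M] (c : ℤ)
    (x : M) : c.toNat • x - (-c).toNat • x = c • x := by
  rw [← natCast_zsmul, ← natCast_zsmul, ← sub_smul]
  congr 1; omega

section Terms

variable {m l : ℕ}

/-- The sum of two terms. -/
def prAdd (s t : prLanguage.Term (Fin m ⊕ Fin l)) : prLanguage.Term (Fin m ⊕ Fin l) :=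
  Term.func PrFunc.add ![s, t]

/-- The term `k s + t`. -/
def prMulAdd (k : ℕ) (s t : prLanguage.Term (Fin m ⊕ Fin l)) : prLanguage.Term (Fin m ⊕ Fin l) :=
  (prAdd s)^[k] t

/-- The term `∑ kᵢ xᵢ + t` in the free variables `xᵢ`. -/
def prLinTerm (k : Fin m → ℕ) (t : prLanguage.Term (Fin m ⊕ Fin l)) :
    prLanguage.Term (Fin m ⊕ Fin l) :=
  (List.finRange m).foldr (fun i s => prMulAdd (k i) (.var (Sum.inl i)) s) t

/-- The atomic formula `s < t`. -/
def prLt (s t : prLanguage.Term (Fin m ⊕ Fin l)) : prLanguage.BoundedFormula (Fin m) l :=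
  .rel PrRel.lt ![s, t]

/-- The formula saying that the two bound variables are zero and the least positive element. -/
def prZeroOne : prLanguage.BoundedFormula (Fin m) 2 :=
  (.equal (prAdd (.var (Sum.inr 0)) (.var (Sum.inr 0))) (.var (Sum.inr 0))) ⊓
    (prLt (.var (Sum.inr 0)) (.var (Sum.inr 1)) ⊓
      .all ((prLt (.var (Sum.inr 0)) (.var (Sum.inr 2))).imp
        (prLt (.var (Sum.inr 2)) (.var (Sum.inr 1))).not))

/-- The formula `0 < ∑ cᵢ xᵢ + d`. -/
def prPosFormula (c : Fin m → ℤ) (d : ℤ) : prLanguage.Formula (Fin m) :=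
  .all (.all (prZeroOne.imp (prLt
    (prLinTerm (fun i => (-c i).toNat) (prMulAdd (-d).toNat (.var (Sum.inr 1)) (.var (Sum.inr 0))))
    (prLinTerm (fun i => (c i).toNat) (prMulAdd d.toNat (.var (Sum.inr 1)) (.var (Sum.inr 0)))))))

/-- The formula `N ∣ xᵢ - r`. -/
def prResFormula (i : Fin m) (N r : ℕ) : prLanguage.Formula (Fin m) :=
  .all (.all (prZeroOne.imp (BoundedFormula.not (.all (BoundedFormula.not (.equal
    (prMulAdd N (.var (Sum.inr 2)) (prMulAdd r (.var (Sum.inr 1)) (.var (Sum.inr 0))))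
    (.var (Sum.inl i))))))))

section Realize

variable {M : Type*} [AddCommGroup M] [LinearOrder M] [prLanguage.Structure M] [IsPrStructure M]
  {w : Fin m ⊕ Fin l → M}

theorem realize_prAdd (s t : prLanguage.Term (Fin m ⊕ Fin l)) :
    (prAdd s t).realize w = s.realize w + t.realize w := IsPrStructure.funMap_add _

theorem realize_prMulAdd (k : ℕ) (s t : prLanguage.Term (Fin m ⊕ Fin l)) :
    (prMulAdd k s t).realize w = k • s.realize w + t.realize w := by
  induction k with
  | zero => simp [prMulAdd]
  | succ k ih =>
    rw [prMulAdd, Function.iterate_succ_apply', realize_prAdd, ← prMulAdd, ih, succ_nsmul]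
    abel

theorem realize_prLinTerm (k : Fin m → ℕ) (t : prLanguage.Term (Fin m ⊕ Fin l)) :
    (prLinTerm k t).realize w = ∑ i, k i • w (Sum.inl i) + t.realize w := by
  rw [Fin.sum_univ_def, prLinTerm]
  induction List.finRange m with
  | nil => simp
  | cons i L ih =>
    rw [List.foldr_cons, realize_prMulAdd, ih, List.map_cons, List.sum_cons, add_assoc]
    rfl

theorem realize_prLt (s t : prLanguage.Term (Fin m ⊕ Fin l)) (v : Fin m → M) (xs : Fin l → M) :
    (prLt s t).Realize v xs ↔ s.realize (Sum.elim v xs) < t.realize (Sum.elim v xs) :=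
  IsPrStructure.relMap_lt _

variable {e : M}

theorem realize_prZeroOne [IsOrderedAddMonoid M] (he : IsDiscreteZGroup e) (v : Fin m → M)
    (xs : Fin 2 → M) :
    (prZeroOne (m := m)).Realize v xs ↔ xs 0 = 0 ∧ xs 1 = e := by
  have h2 : ∀ x : M, (Fin.snoc xs x : Fin 3 → M) 0 = xs 0 ∧ (Fin.snoc xs x : Fin 3 → M) 1 = xs 1 ∧
      (Fin.snoc xs x : Fin 3 → M) 2 = x := fun x => ⟨rfl, rfl, rfl⟩
  have h : (prZeroOne (m := m)).Realize v xs ↔ xs 0 + xs 0 = xs 0 ∧ xs 0 < xs 1 ∧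
      ∀ x, xs 0 < x → ¬ x < xs 1 := by
    rw [prZeroOne, BoundedFormula.realize_inf, BoundedFormula.realize_inf]
    refine and_congr ?_ (and_congr (realize_prLt _ _ _ _) (forall_congr' fun x => ?_))
    · change (prAdd _ _).realize _ = Term.realize _ _ ↔ _
      rw [realize_prAdd]; rfl
    · exact imp_congr (realize_prLt _ _ _ _) (not_congr (realize_prLt _ _ _ _))
  rw [h, add_eq_left]
  refine and_congr_right fun h0 => ?_
  rw [h0]
  constructor
  · rintro ⟨h1, h3⟩
    exact le_antisymm (not_lt.1 (h3 e he.pos)) (he.le_of_pos _ h1)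
  · intro h1
    rw [h1]
    exact ⟨he.pos, fun x hx => not_lt.2 (he.le_of_pos x hx)⟩

/-- Zero and the unit are not symbols of the language. Exactly one pair satisfies `prZeroOne`, so
the guarded quantifiers amount to substituting that pair. -/
theorem realize_all_all_prZeroOne [IsOrderedAddMonoid M] (he : IsDiscreteZGroup e)
    (φ : prLanguage.BoundedFormula (Fin m) 2) (v : Fin m → M) :
    Formula.Realize (BoundedFormula.all (.all (prZeroOne.imp φ)) : prLanguage.Formula (Fin m)) v ↔
      φ.Realize v ![0, e] := by
  have key : ∀ z u : M, (Fin.snoc (Fin.snoc default z : Fin 1 → M) u : Fin 2 → M) = ![z, u] := by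
    intro z u; funext i; fin_cases i <;> rfl
  change (∀ z u : M, (prZeroOne (m := m)).Realize v (Fin.snoc (Fin.snoc default z) u) →
    φ.Realize v (Fin.snoc (Fin.snoc default z) u)) ↔ _
  simp only [key, realize_prZeroOne he]
  constructor
  · intro h
    exact h 0 e ⟨rfl, rfl⟩
  · rintro h z u ⟨hz, hu⟩
    change z = 0 at hz
    change u = e at hu
    rwa [hz, hu]

/-- The language has no subtraction: positive and negative parts of the coefficients stand on
opposite sides of `<`, and their difference restores the form. -/
theorem realize_prPosFormula [IsOrderedAddMonoid M] (he : IsDiscreteZGroup e) (c : Fin m → ℤ)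
    (d : ℤ) (v : Fin m → M) : (prPosFormula c d).Realize v ↔ 0 < zlin e v c d := by
  rw [prPosFormula, realize_all_all_prZeroOne he, realize_prLt, ← sub_pos]
  simp only [realize_prLinTerm, realize_prMulAdd]
  change 0 < ∑ i, (c i).toNat • v i + (d.toNat • e + 0) -
    (∑ i, (-c i).toNat • v i + ((-d).toNat • e + 0)) ↔ _
  rw [add_zero, add_zero, add_sub_add_comm, toNat_smul_sub_toNat_smul, ← Finset.sum_sub_distrib]
  simp only [toNat_smul_sub_toNat_smul, zlin]

theorem realize_prResFormula [IsOrderedAddMonoid M] (he : IsDiscreteZGroup e) (i : Fin m)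
    (N r : ℕ) (v : Fin m → M) :
    (prResFormula i N r).Realize v ↔ ZDvd (N : ℤ) (v i - (r : ℤ) • e) := by
  rw [prResFormula, realize_all_all_prZeroOne he, BoundedFormula.realize_not,
    BoundedFormula.realize_all, not_forall]
  refine exists_congr fun x => ?_
  rw [BoundedFormula.realize_not, not_not]
  change Term.realize _ _ = Term.realize _ _ ↔ _
  rw [realize_prMulAdd, realize_prMulAdd]
  change N • x + (r • e + 0) = v i ↔ _
  rw [natCast_zsmul, natCast_zsmul, add_zero, sub_eq_iff_eq_add, eq_comm]

end Realize

/-! ### Primitive recursive dependence of the codes on the coefficients. -/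

theorem prTermCode_prMulAdd (k : ℕ) (s t : prLanguage.Term (Fin m ⊕ Fin l)) :
    prTermCode (prMulAdd k s t) =
      (fun x => Nat.pair 1 (Nat.pair (prTermCode s) x))^[k] (prTermCode t) := by
  induction k with
  | zero => rfl
  | succ k ih =>
    rw [prMulAdd, Function.iterate_succ_apply', Function.iterate_succ_apply', ← ih]; rfl

theorem primrec_pair_iterate {α : Type*} [Primcodable α] (b : ℕ) {k f : α → ℕ} (hk : Primrec k)
    (hf : Primrec f) :
    Primrec fun a => (fun x => Nat.pair 1 (Nat.pair b x))^[k a] (f a) := by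
  refine Primrec.nat_iterate (h := fun _ x => Nat.pair 1 (Nat.pair b x)) hk hf ?_
  exact Primrec₂.natPair.comp (Primrec.const 1)
    (Primrec₂.natPair.comp (Primrec.const b) Primrec.snd)

theorem primrec_prLinTerm {α : Type*} [Primcodable α] {k : α → Fin m → ℕ}
    (hk : ∀ i, Primrec fun a => k a i) {t : α → prLanguage.Term (Fin m ⊕ Fin l)}
    (ht : Primrec fun a => prTermCode (t a)) :
    Primrec fun a => prTermCode (prLinTerm (k a) (t a)) := by
  unfold prLinTerm
  induction List.finRange m with
  | nil => exact ht
  | cons i L ih =>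
    simp only [List.foldr_cons, prTermCode_prMulAdd]
    exact primrec_pair_iterate _ (hk i) ih

theorem primrec_prMulAdd {α : Type*} [Primcodable α] {k : α → ℕ} (hk : Primrec k)
    (s : prLanguage.Term (Fin m ⊕ Fin l)) {t : α → prLanguage.Term (Fin m ⊕ Fin l)}
    (ht : Primrec fun a => prTermCode (t a)) :
    Primrec fun a => prTermCode (prMulAdd (k a) s (t a)) := by
  simp only [prTermCode_prMulAdd]
  exact primrec_pair_iterate _ hk ht

theorem primrec_prPosFormula {α : Type*} [Primcodable α] {c : α → Fin m → ℤ} {d : α → ℤ}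
    (hc : ∀ i, Primrec fun a => c a i) (hd : Primrec d) :
    Primrec fun a => prFormulaCode (prPosFormula (c a) (d a)) := by
  have h1 := primrec_prLinTerm (l := 2) (fun i => Primrec.int_negToNat.comp (hc i))
    (primrec_prMulAdd (Primrec.int_negToNat.comp hd) (.var (Sum.inr 1))
      (t := fun _ => .var (Sum.inr 0)) (Primrec.const _))
  have h2 := primrec_prLinTerm (l := 2) (fun i => Primrec.int_toNat.comp (hc i))
    (primrec_prMulAdd (Primrec.int_toNat.comp hd) (.var (Sum.inr 1))
      (t := fun _ => .var (Sum.inr 0)) (Primrec.const _))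
  have pr := fun (k : ℕ) {f : α → ℕ} (hf : Primrec f) =>
    Primrec₂.natPair.comp (Primrec.const k) hf
  exact pr 4 (pr 4 (pr 3 (pr (prFormulaCode (prZeroOne (m := m))) (pr 2
    (Primrec₂.natPair.comp h1 h2)))))

theorem primrec_prResFormula (i : Fin m) :
    Primrec fun p : ℕ × ℕ => prFormulaCode (prResFormula i p.1 p.2) := by
  have h1 := primrec_prMulAdd (m := m) (l := 3) (Primrec.fst (α := ℕ) (β := ℕ)) (.var (Sum.inr 2))
    (primrec_prMulAdd (Primrec.snd (α := ℕ) (β := ℕ)) (.var (Sum.inr 1))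
      (t := fun _ => .var (Sum.inr 0)) (Primrec.const _))
  have pr := fun (k : ℕ) {f : ℕ × ℕ → ℕ} (hf : Primrec f) =>
    Primrec₂.natPair.comp (Primrec.const k) hf
  have pr' := fun (k : ℕ) {f : ℕ × ℕ → ℕ} (hf : Primrec f) =>
    Primrec₂.natPair.comp hf (Primrec.const k)
  exact pr 4 (pr 4 (pr 3 (pr (prFormulaCode (prZeroOne (m := m))) (pr 3 (pr' _ (pr 4 (pr 3 (pr' _
    (pr 1 (pr' (prTermCode (k := 3) (.var (Sum.inl i))) h1))))))))))

end Terms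

/-! ### The model as a structure -/

section Structure

variable {S : Set (ℕ → Bool)} (hS : IsTuringIdeal S)

noncomputable instance : prLanguage.Structure (idealModel hS) where
  funMap | PrFunc.add, v => v 0 + v 1
  RelMap | PrRel.lt, v => v 0 < v 1

instance : IsPrStructure (idealModel hS) := ⟨fun _ => rfl, fun _ => Iff.rfl⟩

/-- Empty tuples of two Z-groups approximate each other to every precision, since their only linear
forms are multiples of the unit; `ZApprox.realize_iff` then transfers every sentence true in `ℤ`. -/
instance : (idealModel hS) ⊨ Pr := by
  refine Theory.model_iff _ |>.2 fun φ hφ => ?_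
  have he := isDiscreteZGroup_idealModel hS
  rw [Pr, mem_completeTheory] at hφ
  have key : ∀ {M : Type} [prLanguage.Structure M],
      (Formula.relabel (Empty.elim : Empty → Fin 0) φ).Realize (Fin.elim0 : Fin 0 → M) ↔ M ⊨ φ := by
    intro M _
    rw [Formula.realize_relabel]
    exact iff_of_eq (congrArg _ (Subsingleton.elim _ _))
  rw [← key] at hφ ⊢
  refine (ZApprox.realize_iff isDiscreteZGroup_int he _ ⟨fun c d _ _ => ?_, ?_⟩).1 hφ
  · simp only [zlin, Finset.univ_eq_empty, Finset.sum_empty, zero_add]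
    rw [he.pos_smul_iff, isDiscreteZGroup_int.pos_smul_iff]
  · rintro (i | i) <;> exact i.elim0

/-- The Z-group attached to a Turing ideal, as a model of Presburger arithmetic. -/
noncomputable def idealModelType : Pr.ModelType.{0, 0, 0} := Theory.ModelType.of Pr (idealModel hS)

end Structure

open Filter

/-! ### Realizing types of one new element -/

theorem IsDiscreteZGroup.exists_nsmul_eq {M : Type*} [AddCommGroup M] [LinearOrder M]
    [IsOrderedAddMonoid M] {e : M} (he : IsDiscreteZGroup e) :
    ∀ (J : ℕ) (x : M), 0 < x → x ≤ J • e → ∃ j ≤ J, x = j • e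
  | 0, x, h0, h => absurd h (by rw [zero_smul]; exact not_le.2 h0)
  | J + 1, x, h0, h => by
    rcases le_or_gt x (J • e) with h1 | h1
    · obtain ⟨j, hj, rfl⟩ := he.exists_nsmul_eq J x h0 h1
      exact ⟨j, by omega, rfl⟩
    · refine ⟨J + 1, le_rfl, le_antisymm h ?_⟩
      have h2 := he.le_of_pos _ (sub_pos.2 h1)
      rw [succ_nsmul', ← le_sub_iff_add_le]
      exact h2

section Cut

open LexSpace

variable {S : Set (ℕ → Bool)} (hS : IsTuringIdeal S) {n : ℕ}

/-- The order relations `Pos` and the residues `ρ` are the limits of the order relations and of the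
residues of the elements `β K` over the tuple `a`. -/
structure IsLimitCut (a : Fin n → idealModel hS) (Pos : ℤ → (Fin n → ℤ) → ℤ → Prop)
    (ρ : ℕ → ℤ) (β : ℕ → idealModel hS) : Prop where
  pos_iff : ∀ k c d, ∀ᶠ K in atTop, (Pos k c d ↔ 0 < k • β K + zlin (modelOne hS) a c d)
  residue : ∀ N : ℕ, 0 < N → ∀ᶠ K in atTop, ZDvd (N : ℤ) (β K - ρ N • modelOne hS)

/-- The rational vector space spanned by a tuple and the unit. -/
noncomputable def spanTuple (a : Fin n → idealModel hS) :
    Submodule ℚ (LexSpace (WithTop ColorIndex)) where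
  carrier := {h | ∃ E : ℤ, 0 < E ∧ ∃ c d, E • h = (zlin (modelOne hS) a c d : idealModel hS).1}
  zero_mem' := ⟨1, one_pos, 0, 0, by simp [zlin]⟩
  add_mem' := by
    rintro g h ⟨E, hE, c, d, H⟩ ⟨E', hE', c', d', H'⟩
    refine ⟨E * E', mul_pos hE hE', E' • c + E • c', E' * d + E * d', ?_⟩
    rw [zlin_add, zlin_smul, zlin_smul, AddSubgroup.coe_add, AddSubgroup.coe_zsmul,
      AddSubgroup.coe_zsmul, ← H, ← H', zsmul_add, smul_smul, smul_smul, mul_comm E']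
  smul_mem' := by
    rintro q h ⟨E, hE, c, d, H⟩
    refine ⟨E * q.den, mul_pos hE (by exact_mod_cast q.den_pos), q.num • c, q.num * d, ?_⟩
    rw [zlin_smul, AddSubgroup.coe_zsmul, ← H]
    refine ext_coeff fun i => ?_
    have hq : (q : ℝ) * q.den = q.num := by exact_mod_cast q.mul_den_eq_num
    simp only [coeff_zsmul, coeff_smul]
    push_cast
    rw [← hq]; ring

theorem coeff_eq_of_zsmul_eq {h : LexSpace (WithTop ColorIndex)} {E : ℤ} (hE : 0 < E)
    {x : LexSpace (WithTop ColorIndex)} (H : E • h = x) (γ : WithTop ColorIndex) :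
    coeff γ h = ((1 / E : ℚ) : ℝ) * coeff γ x := by
  have hE' : (E : ℝ) ≠ 0 := by exact_mod_cast hE.ne'
  rw [← H, coeff_zsmul]
  push_cast
  field_simp

theorem coeff_mem_of_mem_spanTuple {a : Fin n → idealModel hS}
    {h : LexSpace (WithTop ColorIndex)} (hh : h ∈ spanTuple hS a) :
    (∀ γ, coeff γ h ∈ idealReals hS) ∧ ∃ q : ℚ, coeff ⊤ h = q := by
  obtain ⟨E, hE, c, d, H⟩ := hh
  obtain ⟨h1, ⟨q, hq⟩, -⟩ := (mem_idealModel hS).1 (zlin (modelOne hS) a c d : idealModel hS).2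
  refine ⟨fun γ => ?_, (1 / E) * q, ?_⟩
  · rw [coeff_eq_of_zsmul_eq hE H, ← Rat.smul_def]
    exact (idealReals hS).smul_mem _ (h1 γ)
  · rw [coeff_eq_of_zsmul_eq hE H, hq]
    push_cast; rfl

variable {hS} {a : Fin n → idealModel hS} {Pos : ℤ → (Fin n → ℤ) → ℤ → Prop} {ρ : ℕ → ℤ}
  {β : ℕ → idealModel hS}

namespace IsLimitCut

theorem not_pos_and_pos_neg (H : IsLimitCut hS a Pos ρ β) (k : ℤ) (c : Fin n → ℤ) (d : ℤ) :
    ¬ (Pos k c d ∧ Pos (-k) (-c) (-d)) := by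
  rintro ⟨h1, h2⟩
  obtain ⟨K, h3, h4⟩ := ((H.pos_iff k c d).and (H.pos_iff (-k) (-c) (-d))).exists
  rw [h3] at h1
  rw [h4, zlin_neg, neg_smul, ← neg_add, neg_pos] at h2
  exact h1.not_gt h2

/-- If the cut is located at an element of the divisible hull, then it is realized there. -/
theorem exists_of_eq (H : IsLimitCut hS a Pos ρ β) {k : ℤ} (hk : k ≠ 0) {c : Fin n → ℤ} {d : ℤ}
    (h1 : ¬ Pos k c d) (h2 : ¬ Pos (-k) (-c) (-d)) :
    ∃ b : idealModel hS, (∀ k c d, Pos k c d ↔ 0 < k • b + zlin (modelOne hS) a c d) ∧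
      ∀ N : ℕ, 0 < N → ZDvd (N : ℤ) (b - ρ N • modelOne hS) := by
  have h3 : ∀ᶠ K in atTop, k • β K = -zlin (modelOne hS) a c d := by
    filter_upwards [H.pos_iff k c d, H.pos_iff (-k) (-c) (-d)] with K h3 h4
    rw [h3] at h1
    rw [h4, zlin_neg, neg_smul, ← neg_add, neg_pos] at h2
    exact eq_neg_of_add_eq_zero_left (le_antisymm (not_lt.1 h1) (not_lt.1 h2))
  obtain ⟨K₀, h4⟩ := h3.exists
  -- Multiplication by `k ≠ 0` is injective, so `β` is eventually constant, and its final value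
  -- meets every limit condition.
  have h5 : ∀ᶠ K in atTop, β K = β K₀ := by
    filter_upwards [h3] with K h5
    exact zsmul_right_injective hk (h5.trans h4.symm)
  refine ⟨β K₀, fun k c d => ?_, fun N hN => ?_⟩
  · obtain ⟨K, h6, h7⟩ := ((H.pos_iff k c d).and h5).exists
    rw [h6, h7]
  · obtain ⟨K, h6, h7⟩ := ((H.residue N hN).and h5).exists
    rwa [h7] at h6

/-- The lower half of the cut. -/
def lower (β : ℕ → idealModel hS) : Set (LexSpace (WithTop ColorIndex)) :=
  {h | ∀ᶠ K in atTop, h < (β K).1}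

theorem zsmul_lt_iff {E : ℤ} (hE : 0 < E) {h : LexSpace (WithTop ColorIndex)}
    {c : Fin n → ℤ} {d : ℤ} (hh : E • h = (zlin (modelOne hS) a c d : idealModel hS).1)
    (x : idealModel hS) : h < x.1 ↔ 0 < E • x + zlin (modelOne hS) a (-c) (-d) := by
  change _ ↔ 0 < (E • x + zlin (modelOne hS) a (-c) (-d)).1
  rw [zlin_neg, AddSubgroup.coe_add, AddSubgroup.coe_neg, AddSubgroup.coe_zsmul, ← hh,
    ← sub_eq_add_neg, ← zsmul_sub, zsmul_pos_iff_of_pos hE, sub_pos]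

theorem mem_lower_iff (H : IsLimitCut hS a Pos ρ β) {E : ℤ} (hE : 0 < E)
    {h : LexSpace (WithTop ColorIndex)} {c : Fin n → ℤ} {d : ℤ}
    (hh : E • h = (zlin (modelOne hS) a c d : idealModel hS).1) :
    h ∈ lower β ↔ Pos E (-c) (-d) := by
  constructor
  · intro h1
    obtain ⟨K, h2, h3⟩ := ((H.pos_iff E (-c) (-d)).and h1).exists
    rwa [h2, ← zsmul_lt_iff hE hh]
  · intro h1
    filter_upwards [H.pos_iff E (-c) (-d)] with K h2
    rwa [h2, ← zsmul_lt_iff hE hh] at h1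

theorem notMem_lower (H : IsLimitCut hS a Pos ρ β) {h : LexSpace (WithTop ColorIndex)}
    (hh : h ∈ spanTuple hS a) (hL : h ∉ lower β) : ∀ᶠ K in atTop, (β K).1 ≤ h := by
  obtain ⟨E, hE, c, d, hh⟩ := hh
  rw [H.mem_lower_iff hE hh] at hL
  filter_upwards [H.pos_iff E (-c) (-d)] with K h2
  rw [h2, ← zsmul_lt_iff hE hh] at hL
  exact not_lt.1 hL

/-- Otherwise some `β K` far out lie between `w` and `w + u`, so that `E • (β K - w)` is one of
finitely many multiples of the unit. By `hne` each of these values is eventually avoided, a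
contradiction. -/
theorem add_mem_lower (H : IsLimitCut hS a Pos ρ β)
    (hne : ∀ k ≠ 0, ∀ c d, Pos k c d ∨ Pos (-k) (-c) (-d)) {w u : LexSpace (WithTop ColorIndex)}
    (hw : w ∈ spanTuple hS a) (hu : u ∈ spanTuple hS a) (hlead : Lead ⊤ u) (hwL : w ∈ lower β) :
    w + u ∈ lower β := by
  have he := isDiscreteZGroup_idealModel hS
  by_contra hcon
  have h1 := H.notMem_lower ((spanTuple hS a).add_mem hw hu) hcon
  obtain ⟨E, hE, c, d, hh⟩ := hw
  obtain ⟨J, hJ⟩ := exists_nat_gt ((E : ℝ) * coeff ⊤ u)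
  have h2 : E • u ≤ (J • modelOne hS).1 := by
    have e : ∀ i, coeff i (J • modelOne hS).1 = J * coeff i (mono ⊤ 1) := by
      intro i
      rw [AddSubgroup.coe_nsmul, ← natCast_zsmul, coeff_zsmul]; simp [modelOne]
    refine (lt_of_coeff_lt (i := ⊤) (fun j hj => ?_) ?_).le
    · rw [e, coeff_zsmul, hlead.1 j hj, coeff_mono_of_ne hj.ne', mul_zero, mul_zero]
    · rw [e, coeff_zsmul, coeff_mono_self, mul_one]; exact hJ
  have h3 : ∀ᶠ K in atTop, ∀ j ∈ Finset.range (J + 1),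
      E • β K + zlin (modelOne hS) a (-c) (-d) ≠ j • modelOne hS := by
    refine (Finset.range (J + 1)).eventually_all.2 fun j _ => ?_
    filter_upwards [H.pos_iff E (-c) (-d - j), H.pos_iff (-E) (-(-c)) (-(-d - j))] with K h4 h5 h6
    have h7 : E • β K + zlin (modelOne hS) a (-c) (-d - j) = 0 := by
      have := zlin_add (modelOne hS) a (-c) 0 (-d) (-j)
      rw [add_zero, ← sub_eq_add_neg] at this
      rw [this, ← add_assoc, h6]
      simp [zlin]
    rw [zlin_neg, neg_smul, ← neg_add, h7, neg_zero] at h5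
    rw [h7] at h4
    rcases hne E hE.ne' (-c) (-d - j) with h | h
    · exact lt_irrefl _ (h4.1 h)
    · exact lt_irrefl _ (h5.1 h)
  obtain ⟨K, ⟨h4, h5⟩, h6⟩ := ((h1.and hwL).and h3).exists
  have h7 : E • β K + zlin (modelOne hS) a (-c) (-d) ≤ J • modelOne hS := by
    refine le_trans (b := (E • β K + zlin (modelOne hS) a (-c) (-d)).1) le_rfl (le_trans ?_ h2)
    rw [zlin_neg, AddSubgroup.coe_add, AddSubgroup.coe_neg, AddSubgroup.coe_zsmul, ← hh,
      ← sub_eq_add_neg, ← zsmul_sub]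
    exact zsmul_le_zsmul_right hE.le (sub_le_iff_le_add'.2 h4)
  obtain ⟨j, hj, hj'⟩ := he.exists_nsmul_eq J _ ((zsmul_lt_iff hE hh _).1 h5) h7
  exact h6 j (Finset.mem_range.2 (by omega)) hj'

/-- The membership of a uniform family of linear combinations in the lower half of the cut is
computable. -/
theorem idealComputable_mem_lower (H : IsLimitCut hS a Pos ρ β)
    {P : ℤ × (Fin n → ℤ) × ℤ → Bool} (hP : IdealComputable S P)
    (hP' : ∀ k c d, P (k, c, d) = true ↔ Pos k c d)
    {w u : LexSpace (WithTop ColorIndex)} (hw : w ∈ spanTuple hS a) (hu : u ∈ spanTuple hS a)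
    (ε : ℤ) : ∃ f : ℕ × ℕ → Bool, IdealComputable S f ∧ ∀ k m : ℕ, 0 < k →
      (f (k, m) = true ↔ w + (((ε * m : ℤ) : ℚ) / k) • u ∈ lower β) := by
  obtain ⟨E, hE, c, d, hw⟩ := hw
  obtain ⟨E', hE', c', d', hu⟩ := hu
  have key : ∀ x y : ℤ, Primrec fun p : ℕ × ℕ => -((p.1 : ℤ) * E' * x + ε * p.2 * E * y) := by
    intro x y
    have m := fun {f g : ℕ × ℕ → ℤ} (hf : Primrec f) (hg : Primrec g) => Primrec.int_mul.comp hf hg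
    exact Primrec.int_neg.comp (Primrec.int_add.comp
      (m (m (Primrec.int_ofNat.comp Primrec.fst) (Primrec.const E')) (Primrec.const x))
      (m (m (m (Primrec.const ε) (Primrec.int_ofNat.comp Primrec.snd)) (Primrec.const E))
        (Primrec.const y)))
  have hC : Primrec fun (p : ℕ × ℕ) (i : Fin n) =>
      -((p.1 : ℤ) * E' * c i + ε * p.2 * E * c' i) := by
    exact Primrec.fin_curry.2 (Primrec.fin_curry₁.2 fun i => key (c i) (c' i)).swap
  have hE0 : Primrec fun p : ℕ × ℕ => (p.1 : ℤ) * E * E' :=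
    Primrec.int_mul.comp (Primrec.int_mul.comp (Primrec.int_ofNat.comp Primrec.fst)
      (Primrec.const E)) (Primrec.const E')
  refine ⟨_, hP.comp hS (.of_primrec hS (hE0.pair (hC.pair (key d d')))), fun k m hk => ?_⟩
  have hk' : (k : ℝ) ≠ 0 := by exact_mod_cast hk.ne'
  rw [hP']
  refine (H.mem_lower_iff (c := ((k : ℤ) * E') • c + (ε * m * E) • c')
    (d := (k : ℤ) * E' * d + ε * m * E * d')
    (mul_pos (mul_pos (by exact_mod_cast hk) hE) hE') ?_).symm
  rw [zlin_add, zlin_smul, zlin_smul, AddSubgroup.coe_add, AddSubgroup.coe_zsmul,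
    AddSubgroup.coe_zsmul, ← hw, ← hu]
  refine ext_coeff fun i => ?_
  simp only [coeff_zsmul, coeff_add, coeff_smul]
  push_cast
  field_simp

/-- Away from the divisible hull, `exists_cutRealized` gives `y = w + r t^γ` in the right cut, with
`r` an ideal real because changes of side can be searched for. A smaller term then corrects the
residues, and the corrected element lies in the model because its residue sequence becomes the
prescribed integral one. -/
theorem exists_realization (H : IsLimitCut hS a Pos ρ β)
    {P : ℤ × (Fin n → ℤ) × ℤ → Bool} (hP : IdealComputable S P)
    (hP' : ∀ k c d, P (k, c, d) = true ↔ Pos k c d) (hρ : IdealComputable S ρ) :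
    ∃ b : idealModel hS, (∀ k c d, Pos k c d ↔ 0 < k • b + zlin (modelOne hS) a c d) ∧
      ∀ N : ℕ, 0 < N → ZDvd (N : ℤ) (b - ρ N • modelOne hS) := by
  have he := isDiscreteZGroup_idealModel hS
  by_cases hne : ∀ k ≠ 0, ∀ c d, Pos k c d ∨ Pos (-k) (-c) (-d)
  swap
  · push Not at hne
    obtain ⟨k, hk, c, d, h1, h2⟩ := hne
    exact H.exists_of_eq hk h1 h2
  obtain ⟨F, hF⟩ := exists_finset_coeff_zlin hS a
  obtain ⟨w, hw, γ, r, hcut, happ⟩ := exists_cutRealized (spanTuple hS a) (lower β) F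
    (by
      rintro u ⟨E, hE, c, d, hu⟩ γ hγ
      by_contra h
      rw [coeff_eq_of_zsmul_eq hE hu, hF c d γ h, mul_zero] at hγ
      exact hγ rfl)
    (fun u _ v _ huv hv => hv.mono fun K hK => huv.trans_lt hK)
    (fun w hw u hu hlead hwL => H.add_mem_lower hne hw hu hlead hwL)
  have hr : IsIdealReal S r := by
    rcases happ with (rfl | rfl) | ⟨u, hu, ε, hε, hs, happ⟩
    · exact IsIdealReal.one hS
    · exact (idealReals hS).neg_mem (IsIdealReal.one hS)
    obtain ⟨f, hf, hf'⟩ := H.idealComputable_mem_lower hP hP' hw hu ε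
    -- The denominator is shifted to `k + 1` because `f` describes the cut only for positive
    -- denominators, while the search must halt for every `k`.
    let q : ℕ → ℕ → Bool := fun k m => !(f (k + 1, m) == f (k + 1, m + 1))
    have hq : IdealComputable S fun p : ℕ × ℕ => q p.1 p.2 := by
      have h1 : Primrec fun p : ℕ × ℕ => (p.1 + 1, p.2) :=
        (Primrec.succ.comp Primrec.fst).pair Primrec.snd
      have h2 : Primrec fun p : ℕ × ℕ => (p.1 + 1, p.2 + 1) :=
        (Primrec.succ.comp Primrec.fst).pair (Primrec.succ.comp Primrec.snd)
      exact (IdealComputable.comp₂ hS Primrec.beq (hf.comp hS (.of_primrec hS h1))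
        (hf.comp hS (.of_primrec hS h2))).not hS
    have hq' : ∀ k m, q k m = true ↔
        ¬ (w + (((ε * m : ℤ) : ℚ) / ((k + 1 : ℕ) : ℚ)) • u ∈ lower β ↔
          w + (((ε * (m + 1) : ℤ) : ℚ) / ((k + 1 : ℕ) : ℚ)) • u ∈ lower β) := by
      intro k m
      have h1 := hf' (k + 1) m k.succ_pos
      have h2 := hf' (k + 1) (m + 1) k.succ_pos
      rw [Nat.cast_succ m] at h2
      rw [← h1, ← h2, ← Bool.eq_iff_iff]
      simp [q]
    have hex : ∀ k, ∃ m, q k m = true := fun k => by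
      obtain ⟨m, hm⟩ := (happ (k + 1) k.succ_pos).1
      exact ⟨m, (hq' k m).2 hm⟩
    have hfind := (IdealComputable.find hS hq hex).comp hS
      (.of_primrec hS Primrec.pred)
    have hx : IsIdealReal S (ε * r) := by
      refine IsIdealReal.of_approx hS ((mem_idealReals hS).1
        ((coeff_mem_of_mem_spanTuple hS hu).1 γ)) hfind
        (C := coeff (γ : WithTop ColorIndex) u) fun k hk => ?_
      have h1 := (hq' (k - 1) _).1 (Nat.find_spec (hex (k - 1)))
      obtain ⟨k, rfl⟩ := Nat.exists_eq_succ_of_ne_zero hk.ne'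
      exact (happ (k + 1) k.succ_pos).2 _ h1
    rcases hε with rfl | rfl
    · simpa using hx
    · have := (idealReals hS).neg_mem hx
      simpa using (mem_idealReals hS).1 this
  have hdvd : ∀ N N' : ℕ, 0 < N → 0 < N' → N ∣ N' → (N : ℤ) ∣ ρ N' - ρ N := by
    intro N N' hN hN' hNN
    obtain ⟨K, h1, h2⟩ := ((H.residue N hN).and (H.residue N' hN')).exists
    exact (he.dvd_sub_iff (by exact_mod_cast hN) (h2.of_dvd (by exact_mod_cast hNN))).1 h1
  let y := w + mono (γ : WithTop ColorIndex) r
  -- Sampling at factorials gives the required modulus of profinite convergence: `m ∣ N!` as soon as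
  -- `0 < m ≤ N`.
  let z : ℕ → ℚ := fun N => ρ N.factorial
  have hz : z ∈ idealColors hS := by
    refine ⟨1, one_pos, fun N => ρ N.factorial, hρ.comp hS (.of_primrec hS Primrec.nat_factorial),
      fun N => by simp [z], fun m hm N N' hN hN' => ?_⟩
    have h1 := hdvd m _ hm N.factorial_pos (Nat.dvd_factorial hm hN)
    have h2 := hdvd m _ hm N'.factorial_pos (Nat.dvd_factorial hm hN')
    have := dvd_sub h1 h2
    rwa [sub_sub_sub_cancel_right] at this
  -- The color of `γ'` is the discrepancy of the residues. As every difference `y - h` with `h` in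
  -- the span has its leading index at most `γ < γ'`, the extra term leaves the cut unchanged.
  obtain ⟨γ', hγ', hlt⟩ := exists_color_eq hS
    ((idealColors hS).sub_mem hz (residueSeq_mem hS y)) {γ}
  have hlt : (γ : WithTop ColorIndex) < γ' :=
    WithTop.coe_lt_coe.2 (hlt γ (Finset.mem_singleton_self γ))
  let b := y + mono (γ' : WithTop ColorIndex) 1
  have hbz : residueSeq hS b = z := by
    rw [map_add, residueSeq_mono, ratProj_one, one_smul, hγ', add_sub_cancel]
  have hb : b ∈ idealModel hS := by
    obtain ⟨hw1, q, hq⟩ := coeff_mem_of_mem_spanTuple hS hw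
    refine ⟨fun δ => ?_, ⟨q, ?_⟩, 0, fun N _ => ⟨ρ N.factorial, by rw [hbz]⟩⟩
    · refine (idealReals hS).add_mem ((idealReals hS).add_mem (hw1 δ) ?_) ?_
      · change coeff δ (mono _ _) ∈ _
        rw [coeff_mono]
        split_ifs
        exacts [hr, (idealReals hS).zero_mem]
      · change coeff δ (mono _ _) ∈ _
        rw [coeff_mono]
        split_ifs
        exacts [IsIdealReal.one hS, (idealReals hS).zero_mem]
    · simp only [b, y, coeff_add, hq, coeff_mono_of_ne (WithTop.coe_ne_top (a := γ)),
        coeff_mono_of_ne (WithTop.coe_ne_top (a := γ')), add_zero]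
  have hlead : ∀ h ∈ spanTuple hS a, h ≠ b ∧ (h ∈ lower β ↔ h < b) := by
    intro h hh
    obtain ⟨δ, hδ, hlead, hiff⟩ := hcut h hh
    have e : ∀ j ≤ δ, coeff j (b - h) = coeff j (y - h) := fun j hj => by
      simp only [b, coeff_sub, coeff_add, coeff_mono_of_ne ((hj.trans hδ).trans_lt hlt).ne',
        add_zero]
    have hlead' : Lead δ (b - h) := ⟨fun j hj => by rw [e j hj.le]; exact hlead.1 j hj, by
      rw [e δ le_rfl]; exact hlead.2⟩
    refine ⟨?_, ?_⟩
    · rintro rfl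
      apply hlead'.2
      rw [sub_self, coeff_zero]
    · rw [hiff, ← sub_pos (a := b), hlead'.pos_iff, e δ le_rfl]
  have hpos : ∀ k > 0, ∀ c d, (Pos k c d ↔
        0 < k • (⟨b, hb⟩ : idealModel hS) + zlin (modelOne hS) a c d) ∧
      k • (⟨b, hb⟩ : idealModel hS) + zlin (modelOne hS) a c d ≠ 0 := by
    intro k hk c d
    have hk' : (k : ℝ) ≠ 0 := by exact_mod_cast hk.ne'
    let h : LexSpace (WithTop ColorIndex) :=
      (1 / k : ℚ) • (zlin (modelOne hS) a (-c) (-d) : idealModel hS).1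
    have hh : k • h = (zlin (modelOne hS) a (-c) (-d) : idealModel hS).1 := ext_coeff fun i => by
      simp only [h, coeff_zsmul, coeff_smul]
      push_cast
      field_simp
    obtain ⟨h1, h2⟩ := hlead h ⟨k, hk, _, _, hh⟩
    rw [H.mem_lower_iff hk hh, neg_neg, neg_neg] at h2
    have h3 := zsmul_lt_iff hk hh (⟨b, hb⟩ : idealModel hS)
    rw [neg_neg, neg_neg] at h3
    refine ⟨h2.trans h3, fun h0 => ?_⟩
    have h4 := congrArg Subtype.val (eq_neg_of_add_eq_zero_left h0)
    rw [← zlin_neg, ← hh] at h4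
    exact h1 (zsmul_right_injective hk.ne' h4).symm
  refine ⟨⟨b, hb⟩, fun k c d => ?_, fun N hN => ?_⟩
  -- For `k < 0`, exactly one of the conditions for `k` and `-k` holds, by `not_pos_and_pos_neg` and
  -- `hne`; this matches the form in `b`, which is nonzero.
  · rcases lt_trichotomy k 0 with hk | rfl | hk
    · obtain ⟨h1, h2⟩ := hpos (-k) (neg_pos.2 hk) (-c) (-d)
      rw [zlin_neg, neg_smul, ← neg_add, neg_pos] at h1
      rw [zlin_neg, neg_smul, ← neg_add, neg_ne_zero] at h2
      have h3 := H.not_pos_and_pos_neg k c d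
      have h4 := hne k hk.ne c d
      constructor
      · intro h5
        have h6 := (not_congr h1).1 fun h6 => h3 ⟨h5, h6⟩
        exact lt_of_le_of_ne (not_lt.1 h6) h2.symm
      · intro h5
        exact h4.resolve_right fun h6 => (h1.1 h6).not_gt h5
    · obtain ⟨K, hK⟩ := (H.pos_iff 0 c d).exists
      rw [hK, zero_smul, zero_smul]
    · exact (hpos k hk c d).1
  · have h1 := (zdvd_sub_residue hS hb one_pos (n := fun N => ρ N.factorial)
      (fun N => by rw [hbz]; simp [z]) (fun m hm M M' hM hM' => by
        have h1 := hdvd m _ hm M.factorial_pos (Nat.dvd_factorial hm hM)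
        have h2 := hdvd m _ hm M'.factorial_pos (Nat.dvd_factorial hm hM')
        have := dvd_sub h1 h2
        rwa [sub_sub_sub_cancel_right] at this) hN).2 (ρ N.factorial) (by simp)
    exact (he.dvd_sub_iff (by exact_mod_cast hN) h1).2
      (hdvd N _ hN N.factorial_pos (Nat.dvd_factorial hN le_rfl))

end IsLimitCut

end Cut

/-! ### Injectivity of the Gödel coding -/

theorem prTermCode_injective {n k : ℕ} :
    Function.Injective (prTermCode : prLanguage.Term (Fin n ⊕ Fin k) → ℕ) := by
  intro s
  induction s with
  | var i =>
    intro t h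
    cases t with
    | var j =>
      rcases i with i | i <;> rcases j with j | j <;>
        · have h1 := (Nat.pair_eq_pair.1 h).2
          first
          | omega
          | rw [show i = j from Fin.ext (by omega)]
    | func f ts =>
      cases f
      rcases i with i | i <;> exact absurd (Nat.pair_eq_pair.1 h).1 zero_ne_one
  | func f ts ih =>
    intro t h
    cases f
    cases t with
    | var j => rcases j with j | j <;> exact absurd (Nat.pair_eq_pair.1 h).1 one_ne_zero
    | func g us =>
      cases g
      obtain ⟨h0, h1⟩ := Nat.pair_eq_pair.1 (Nat.pair_eq_pair.1 h).2
      congr 1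
      funext i
      fin_cases i
      exacts [ih 0 h0, ih 1 h1]

theorem prFormulaCode_injective {n k : ℕ} :
    Function.Injective (prFormulaCode : prLanguage.BoundedFormula (Fin n) k → ℕ) := by
  intro φ
  induction φ with
  | falsum =>
    intro ψ h
    cases ψ with
    | falsum => rfl
    | equal => exact absurd (Nat.pair_eq_pair.1 h).1 (by decide)
    | rel R _ => cases R; exact absurd (Nat.pair_eq_pair.1 h).1 (by decide)
    | imp => exact absurd (Nat.pair_eq_pair.1 h).1 (by decide)
    | all => exact absurd (Nat.pair_eq_pair.1 h).1 (by decide)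
  | equal t₁ t₂ =>
    intro ψ h
    cases ψ with
    | falsum => exact absurd (Nat.pair_eq_pair.1 h).1 (by decide)
    | equal =>
      obtain ⟨h0, h1⟩ := Nat.pair_eq_pair.1 (Nat.pair_eq_pair.1 h).2
      rw [prTermCode_injective h0, prTermCode_injective h1]
    | rel R _ => cases R; exact absurd (Nat.pair_eq_pair.1 h).1 (by decide)
    | imp => exact absurd (Nat.pair_eq_pair.1 h).1 (by decide)
    | all => exact absurd (Nat.pair_eq_pair.1 h).1 (by decide)
  | rel R ts =>
    intro ψ h
    cases R
    cases ψ with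
    | falsum => exact absurd (Nat.pair_eq_pair.1 h).1 (by decide)
    | equal => exact absurd (Nat.pair_eq_pair.1 h).1 (by decide)
    | rel R us =>
      cases R
      obtain ⟨h0, h1⟩ := Nat.pair_eq_pair.1 (Nat.pair_eq_pair.1 h).2
      congr 1
      funext i
      fin_cases i
      exacts [prTermCode_injective h0, prTermCode_injective h1]
    | imp => exact absurd (Nat.pair_eq_pair.1 h).1 (by decide)
    | all => exact absurd (Nat.pair_eq_pair.1 h).1 (by decide)
  | imp φ₁ φ₂ ih₁ ih₂ =>
    intro ψ h
    cases ψ with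
    | falsum => exact absurd (Nat.pair_eq_pair.1 h).1 (by decide)
    | equal => exact absurd (Nat.pair_eq_pair.1 h).1 (by decide)
    | rel R _ => cases R; exact absurd (Nat.pair_eq_pair.1 h).1 (by decide)
    | imp =>
      obtain ⟨h0, h1⟩ := Nat.pair_eq_pair.1 (Nat.pair_eq_pair.1 h).2
      rw [ih₁ h0, ih₂ h1]
    | all => exact absurd (Nat.pair_eq_pair.1 h).1 (by decide)
  | all φ ih =>
    intro ψ h
    cases ψ with
    | falsum => exact absurd (Nat.pair_eq_pair.1 h).1 (by decide)
    | equal => exact absurd (Nat.pair_eq_pair.1 h).1 (by decide)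
    | rel R _ => cases R; exact absurd (Nat.pair_eq_pair.1 h).1 (by decide)
    | imp => exact absurd (Nat.pair_eq_pair.1 h).1 (by decide)
    | all => rw [ih (Nat.pair_eq_pair.1 h).2]

theorem mem_typeCodes_iff {n : ℕ} {p : Pr.CompleteType (Fin n)}
    {φ : prLanguage.Formula (Fin n)} : prFormulaCode φ ∈ typeCodes p ↔ TypeContains p φ :=
  ⟨fun ⟨ψ, hψ, h⟩ => by rwa [prFormulaCode_injective h] at hψ, fun h => ⟨φ, h, rfl⟩⟩

/-! ### Saturation of the model -/

section Saturation

variable {S : Set (ℕ → Bool)} (hS : IsTuringIdeal S) {n : ℕ}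

theorem typeComputableIn_of_mem_realizedTypes {p : Pr.CompleteType (Fin n)}
    (hp : p ∈ Pr.realizedTypes (idealModelType hS) (Fin n)) : TypeComputableIn S p := by
  obtain ⟨a, rfl⟩ := hp
  have h := (isComputableTuple_idealModel hS (n := n) a).idealComputable_codes hS
    (isDiscreteZGroup_idealModel hS)
  obtain ⟨x, hx, hx'⟩ := h.exists_setComputableIn hS
  refine ⟨x, hx, ?_⟩
  convert hx' using 1
  ext m
  exact exists_congr fun φ => and_congr_left fun _ => Theory.CompleteType.formula_mem_typeOf

/-- A finitely satisfiable type is the limit of the types of a sequence of elements. -/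
theorem FinitelySatisfiableAt.exists_seq {M : Pr.ModelType.{0, 0, 0}}
    {p : Pr.CompleteType (Fin (n + 1))} {a : Fin n → M} (h : FinitelySatisfiableAt M p a) :
    ∃ β : ℕ → M, ∀ φ : prLanguage.Formula (Fin (n + 1)), ∀ᶠ K in atTop,
      (TypeContains p φ ↔ φ.Realize (Fin.cons (β K) a : Fin (n + 1) → M)) := by
  classical
  have : Countable (prLanguage.Formula (Fin (n + 1))) := prFormulaCode_injective.countable
  have : Nonempty (prLanguage.Formula (Fin (n + 1))) := ⟨⊥⟩
  obtain ⟨g, hg⟩ := exists_surjective_nat (prLanguage.Formula (Fin (n + 1)))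
  -- Satisfying whichever of `φ` and its negation belongs to the complete type gives an equivalence
  -- in the limit, not just an implication.
  let sgn : prLanguage.Formula (Fin (n + 1)) → prLanguage.Formula (Fin (n + 1)) := fun φ =>
    if TypeContains p φ then φ else φ.not
  have hsgn : ∀ φ, TypeContains p (sgn φ) := by
    intro φ
    by_cases hφ : TypeContains p φ
    · simpa only [sgn, if_pos hφ] using hφ
    · simp only [sgn, if_neg hφ]
      exact (p.not_mem_iff _).2 hφ
  choose β hβ using fun K : ℕ => h ((fun i => sgn (g i)) '' Set.Iic K)
    ((Set.finite_Iic K).image _) (by rintro _ ⟨i, -, rfl⟩; exact hsgn _)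
  refine ⟨β, fun φ => ?_⟩
  obtain ⟨i, rfl⟩ := hg φ
  filter_upwards [eventually_ge_atTop i] with K hK
  have h1 := hβ K _ ⟨i, hK, rfl⟩
  by_cases hφ : TypeContains p (g i)
  · simp only [sgn, if_pos hφ] at h1
    exact iff_of_true hφ h1
  · simp only [sgn, if_neg hφ] at h1
    exact iff_of_false hφ h1

theorem zlin_cons {M : Type*} [AddCommGroup M] (e b : M) (a : Fin n → M) (k : ℤ) (c : Fin n → ℤ)
    (d : ℤ) : zlin e (Fin.cons b a : Fin (n + 1) → M) (Fin.cons k c : Fin (n + 1) → ℤ) d =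
      k • b + zlin e a c d := by
  simp [zlin, Fin.sum_univ_succ, add_assoc]

/-- The truth of a formula is continuous in one variable with respect to order relations and
residues. -/
theorem eventually_realize_cons_iff {M : Type*} [AddCommGroup M] [LinearOrder M]
    [IsOrderedAddMonoid M] [prLanguage.Structure M] [IsPrStructure M] {e : M}
    (he : IsDiscreteZGroup e) {a : Fin n → M} {b : M} {β : ℕ → M}
    (hpos : ∀ (k : ℤ) c d, ∀ᶠ K in atTop, (0 < k • β K + zlin e a c d ↔ 0 < k • b + zlin e a c d))
    (hres : ∀ N : ℕ, 0 < N → ∀ᶠ K in atTop, ∀ r : ℤ,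
      (ZDvd (N : ℤ) (β K - r • e) ↔ ZDvd (N : ℤ) (b - r • e)))
    (φ : prLanguage.Formula (Fin (n + 1))) : ∀ᶠ K in atTop,
      (φ.Realize (Fin.cons (β K) a : Fin (n + 1) → M) ↔
        φ.Realize (Fin.cons b a : Fin (n + 1) → M)) := by
  obtain ⟨Z, hZ⟩ : ∃ Z, Z = zlevel (prFormulaCode φ) := ⟨_, rfl⟩
  -- The formula depends only on finitely many forms of height at most `Z` and on the modulus `Z!`,
  -- so finitely many eventual statements have to hold at once.
  have hbox : ∀ᶠ K in atTop, ∀ d ∈ Set.Icc (-(Z : ℤ)) Z,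
      ∀ c ∈ Set.pi Set.univ fun _ : Fin (n + 1) => Set.Icc (-(Z : ℤ)) Z,
      (0 < zlin e (Fin.cons (β K) a : Fin (n + 1) → M) c d ↔
        0 < zlin e (Fin.cons b a : Fin (n + 1) → M) c d) := by
    refine (eventually_all_finite (Set.finite_Icc _ _)).2 fun d _ =>
      (eventually_all_finite (Set.Finite.pi fun _ => Set.finite_Icc _ _)).2 fun c _ => ?_
    filter_upwards [hpos (c 0) (Fin.tail c) d] with K hK
    rwa [← Fin.cons_self_tail c, zlin_cons, zlin_cons]
  filter_upwards [hbox, hres _ Z.factorial_pos] with K h1 h2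
  refine ZApprox.realize_iff he he φ (xs := default) (xs' := default) ?_
  rw [← hZ]
  refine ⟨fun c d hc hd => ?_, ?_⟩
  · have := h1 d (abs_le.1 hd) (fun i => c (Sum.inl i)) fun i _ => abs_le.1 (hc _)
    simpa [zlin] using this
  · rintro (i | i) r
    · exact Fin.cases (motive := fun i => ZDvd (Z.factorial : ℤ)
        ((Fin.cons (β K) a : Fin (n + 1) → M) i - r • e) ↔ ZDvd (Z.factorial : ℤ)
        ((Fin.cons b a : Fin (n + 1) → M) i - r • e)) (h2 r) (fun i => Iff.rfl) i
    · exact i.elim0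

theorem IdealComputable.exists_choice (hS : IsTuringIdeal S) {p : ℕ → ℕ → Bool}
    (hp : IdealComputable S fun z : ℕ × ℕ => p z.1 z.2) (hex : ∀ N, ∃ r, p N r = true) :
    ∃ f : ℕ → ℕ, IdealComputable S f ∧ ∀ N, p N (f N) = true :=
  ⟨_, IdealComputable.find hS hp hex, fun N => Nat.find_spec (hex N)⟩

/-- For each modulus some `β K` agrees with the type on all the finitely many candidate residues, so
the type contains one of the formulas `prResFormula 0 N r`; searching the type for such an `r` is
computable. -/
theorem exists_residue_of_limit {p : Pr.CompleteType (Fin (n + 1))} {a : Fin n → idealModel hS}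
    {β : ℕ → idealModel hS}
    (hβ : ∀ φ : prLanguage.Formula (Fin (n + 1)), ∀ᶠ K in atTop,
      (TypeContains p φ ↔ φ.Realize (Fin.cons (β K) a : Fin (n + 1) → idealModel hS)))
    (hcodes : IdealComputable S (charFun (typeCodes p))) :
    ∃ ρ : ℕ → ℤ, IdealComputable S ρ ∧ ∀ N : ℕ, 0 < N → ∀ᶠ K in atTop,
      ZDvd (N : ℤ) (β K - ρ N • modelOne hS) := by
  have he := isDiscreteZGroup_idealModel hS
  have hres : ∀ N : ℕ, 0 < N → ∃ r : ℕ, TypeContains p (prResFormula 0 N r) := by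
    intro N hN
    have h1 : ∀ᶠ K in atTop, ∀ r ∈ Finset.range N, (TypeContains p (prResFormula 0 N r) ↔
        ZDvd (N : ℤ) (β K - (r : ℤ) • modelOne hS)) := by
      refine (Finset.range N).eventually_all.2 fun r _ => ?_
      filter_upwards [hβ (prResFormula 0 N r)] with K hK
      rw [hK, realize_prResFormula he]
      rfl
    obtain ⟨K, hK⟩ := h1.exists
    have hN' : (0 : ℤ) < N := by exact_mod_cast hN
    obtain ⟨r, hr⟩ := he.exists_residue N hN' (β K)
    have h2 := Int.emod_nonneg r hN'.ne'
    have h3 := Int.emod_lt_of_pos r hN'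
    refine ⟨(r % N).toNat, (hK _ (Finset.mem_range.2 (by omega))).2 ?_⟩
    rw [Int.toNat_of_nonneg h2]
    exact (he.dvd_sub_iff hN' hr).2 (Int.dvd_self_sub_emod)
  -- The search runs over the moduli `N + 1`, since existence of a residue is known only for
  -- positive moduli.
  obtain ⟨f, hf, hf'⟩ := IdealComputable.exists_choice hS
    (p := fun N r => charFun (typeCodes p)
      (prFormulaCode (prResFormula (0 : Fin (n + 1)) (N + 1) r)))
    (hcodes.comp hS (.of_primrec hS ((primrec_prResFormula 0).comp
      ((Primrec.succ.comp Primrec.fst).pair Primrec.snd))))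
    (fun N => (hres (N + 1) N.succ_pos).imp fun r hr =>
      charFun_eq_true.2 (mem_typeCodes_iff.2 hr))
  refine ⟨fun N => (f N.pred : ℤ), (IdealComputable.of_primrec hS Primrec.int_ofNat).comp hS
    (hf.comp hS (.of_primrec hS Primrec.pred)), fun N hN => ?_⟩
  obtain ⟨N, rfl⟩ := Nat.exists_eq_succ_of_ne_zero hN.ne'
  have h1 := mem_typeCodes_iff.1 (charFun_eq_true.1 (hf' N))
  filter_upwards [hβ (prResFormula 0 (N + 1) (f N))] with K hK
  rw [hK, realize_prResFormula he, Fin.cons_zero] at h1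
  exact h1

/-- The formulas `prPosFormula` and `prResFormula` extract the cut and the residues from the type.
An element with this cut and these residues agrees with `β K` on each formula for all large `K`,
hence satisfies the type. -/
theorem TypeComputableIn.exists_realize {p : Pr.CompleteType (Fin (n + 1))}
    (hp : TypeComputableIn S p) {a : Fin n → idealModel hS} {β : ℕ → idealModel hS}
    (hβ : ∀ φ : prLanguage.Formula (Fin (n + 1)), ∀ᶠ K in atTop,
      (TypeContains p φ ↔ φ.Realize (Fin.cons (β K) a : Fin (n + 1) → idealModel hS))) :
    ∃ b : idealModel hS, ∀ φ : prLanguage.Formula (Fin (n + 1)), TypeContains p φ →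
      φ.Realize (Fin.cons b a : Fin (n + 1) → idealModel hS) := by
  have he := isDiscreteZGroup_idealModel hS
  obtain ⟨x, hx, hp⟩ := hp
  have hcodes := SetComputableIn.idealComputable hx hp
  obtain ⟨ρ, hρ, hρ'⟩ := exists_residue_of_limit hS hβ hcodes
  let Pos : ℤ → (Fin n → ℤ) → ℤ → Prop := fun k c d =>
    TypeContains p (prPosFormula (Fin.cons k c : Fin (n + 1) → ℤ) d)
  let P : ℤ × (Fin n → ℤ) × ℤ → Bool := fun z =>
    charFun (typeCodes p)
      (prFormulaCode (prPosFormula (Fin.cons z.1 z.2.1 : Fin (n + 1) → ℤ) z.2.2))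
  have hP : IdealComputable S P := by
    refine hcodes.comp hS (.of_primrec hS (primrec_prPosFormula (fun i => ?_)
      (Primrec.snd.comp Primrec.snd)))
    refine Fin.cases ?_ (fun i => ?_) i
    · simp only [Fin.cons_zero]
      exact Primrec.fst
    · simp only [Fin.cons_succ]
      exact Primrec.fin_app.comp (Primrec.fst.comp Primrec.snd) (Primrec.const i)
  have hP' : ∀ k c d, P (k, c, d) = true ↔ Pos k c d := fun k c d =>
    charFun_eq_true.trans mem_typeCodes_iff
  have H : IsLimitCut hS a Pos ρ β := by
    refine ⟨fun k c d => ?_, hρ'⟩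
    filter_upwards [hβ (prPosFormula (Fin.cons k c : Fin (n + 1) → ℤ) d)] with K hK
    rw [realize_prPosFormula he, zlin_cons] at hK
    exact hK
  obtain ⟨b, hb, hb'⟩ := H.exists_realization hP hP' hρ
  have hlim := eventually_realize_cons_iff he (a := a) (b := b) (β := β)
    (fun k c d => (H.pos_iff k c d).mono fun K hK => hK.symm.trans (hb k c d))
    (fun N hN => (H.residue N hN).mono fun K hK r => by
      have hN' : (0 : ℤ) < N := by exact_mod_cast hN
      rw [he.dvd_sub_iff hN' hK, he.dvd_sub_iff hN' (hb' N hN)])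
  refine ⟨b, fun φ hφ => ?_⟩
  obtain ⟨K, h1, h2⟩ := ((hβ φ).and (hlim φ)).exists
  exact h2.1 (h1.1 hφ)

theorem realizedAt_idealModelType {p : Pr.CompleteType (Fin (n + 1))} (hp : TypeComputableIn S p)
    (a : Fin n → idealModelType hS) (hfin : FinitelySatisfiableAt (idealModelType hS) p a) :
    RealizedAt (idealModelType hS) p a := by
  obtain ⟨β, hβ⟩ := hfin.exists_seq
  exact hp.exists_realize hS (a := a) (β := β) hβ

end Saturation

theorem theorem3p1 (S : Set (ℕ → Bool)) (hS : IsScottSet S) :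
    ∃ M : Pr.ModelType.{0, 0, 0}, IsSSaturated S M :=
  ⟨idealModelType hS.ideal, fun _ _ hp => typeComputableIn_of_mem_realizedTypes hS.ideal hp,
    fun _ _ hp a hfin => realizedAt_idealModelType hS.ideal hp a hfin⟩
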